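/- Let $\Omega=(a,b)$ with $-\infty<a<b<\infty$, let $0<\mu\le 1$ with $\mu\neq\frac12$, let $\lambda\ge 0$ and $c_0>0$. All functions are real valued. Write $\mathscr F[f](\omega)=\int_{\mathbb R}e^{-i\omega x}f(x)\,dx$ (extended to $L^2(\mathbb R)$), $|f|^2_{H^\mu(\mathbb R)}=\int_{\mathbb R}|\omega|^{2\mu}|\mathscr F[f](\omega)|^2\,d\omega$, and let $H^\mu(\mathbb R)$ be the set of $f\in L^2(\mathbb R)$ for which this is finite. Let $H^\mu(\Omega)$ be the space of restrictions to $\Omega$ of functions in $H^\mu(\mathbb R)$, with $$|u|_{H^\mu(\Omega)}=\inf_{\tilde u|_\Omega=u}|\tilde u|_{H^\mu(\mathbb R)},\qquad \|u\|^2_{H^\mu(\Omega)}=\|u\|^2_{L^2(\Omega)}+|u|^2_{H^\mu(\Omega)},$$ and let $H_0^\mu(\Omega)$ be the closure of $C_0^\infty(\Omega)$ in $H^\mu(\Omega)$. For $u\in C_0^\infty(\Omega)$ and the integer $n\geq 1$ with $n-1\le\mu<n$, define the left and right tempered derivatives $${}_a\mathbb D_x^{\mu,\lambda}u(x)=\frac{e^{-\lambda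 x}}{\Gamma(n-\mu)}\frac{d^n}{dx^n}\int_a^x\frac{e^{\lambda\xi}u(\xi)}{(x-\xi)^{\mu-n+1}}\,d\xi,\qquad {}_x\mathbb D_b^{\mu,\lambda}u(x)=\frac{(-1)^n e^{\lambda x}}{\Gamma(n-\mu)}\frac{d^n}{dx^n}\int_x^b\frac{e^{-\lambda\xi}u(\xi)}{(\xi-x)^{\mu-n+1}}\,d\xi .$$ These operators extend continuously from $C_0^\infty(\Omega)$ to operators from $H_0^\mu(\Omega)$ to $L^2(\Omega)$, denoted by the same symbols. For $u,v\in H_0^\mu(\Omega)$ put, with $(\cdot,\cdot)$ the inner product of $L^2(\Omega)$, $$B(u,v)=\left({}_a\mathbb D_x^{\mu,\lambda}u,\;{}_x\mathbb D_b^{\mu,\lambda}v\right)\quad\text{if }0<\mu<\tfrac12,$$ $$B(u,v)=-\left({}_a\mathbb D_x^{\mu,\lambda}u,\;{}_x\mathbb D_b^{\mu,\lambda}v\right)+(1+c_0)\lambda^{2\mu}(u,v)\quad\text{if }\tfrac12<\mu\le1.$$ Then, for $u\in H_0^\mu(\Omega)$, $$B(u,u)\sim\|u\|^2_{H^\mu(\Omega)}\sim\left\|{}_a\mathbb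 D_x^{\mu,\lambda}u\right\|^2_{L^2(\Omega)}\sim\left\|{}_x\mathbb D_b^{\mu,\lambda}u\right\|^2_{L^2(\Omega)},$$ where $F(u)\sim G(u)$ means that there is a constant $C>0$, which may depend on $a,b,\mu,\lambda,c_0$ but not on $u$, with $F(u)\le C\,G(u)$ and $G(u)\le C\,F(u)$ for all $u\in H_0^\mu(\Omega)$. -/

import Mathlib

open MeasureTheory Set Filter Topology
open scoped ENNReal FourierTransform Distributions

noncomputable section

namespace TemperedFractional

/-- The open interval `Ω = (a, b)` as an open subset of the line. -/
def interval (a b : ℝ) : TopologicalSpace.Opens ℝ := ⟨Ioo a b, isOpen_Ioo⟩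

/-- The real Hilbert space `L²(Ω)`, `Ω = (a, b)`. -/
abbrev L2 (a b : ℝ) := Lp ℝ 2 (volume.restrict (Ioo a b))

/-- The class in `L²(Ω)` of a test function `φ ∈ C₀^∞(Ω)`. -/
def testToL2 {a b : ℝ} (φ : 𝓓(interval a b, ℝ)) : L2 a b :=
  (φ.continuous.memLp_of_hasCompactSupport (p := 2) (μ := volume.restrict (Ioo a b))
    φ.hasCompactSupport).toLp φ

/-! ### Sobolev spaces of order `μ` -/

/-- The Fourier transform `𝓕[f](ω) = ∫ e^{-iωx} f(x) dx` (in the sense of Plancherel) of a real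
`f ∈ L²(ℝ)`. Mathlib's transform has the kernel `e^{-2πiωx}`, hence the dilation. -/
def angularFourier (f : Lp ℝ 2 (volume : Measure ℝ)) (ω : ℝ) : ℂ :=
  (𝓕 (Complex.ofRealCLM.compLp f) : Lp ℂ 2 (volume : Measure ℝ)) (ω / (2 * Real.pi))

/-- `|f|²_{H^μ(ℝ)} = ∫ |ω|^{2μ} |𝓕[f](ω)|² dω`, possibly infinite. -/
def lineSeminormSq (μ : ℝ) (f : Lp ℝ 2 (volume : Measure ℝ)) : ℝ≥0∞ :=
  ∫⁻ ω : ℝ, ENNReal.ofReal (|ω| ^ (2 * μ) * ‖angularFourier f ω‖ ^ 2)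

/-- `|u|²_{H^μ(Ω)}`: the infimum of `|f|²_{H^μ(ℝ)}` over the extensions `f` of `u` to the line
(infinite if no extension lies in `H^μ(ℝ)`). -/
def seminormSq (μ : ℝ) {a b : ℝ} (u : L2 a b) : ℝ≥0∞ :=
  ⨅ (f : Lp ℝ 2 (volume : Measure ℝ)) (_ : f =ᵐ[volume.restrict (Ioo a b)] u),
    lineSeminormSq μ f

/-- `‖u‖²_{H^μ(Ω)} = ‖u‖²_{L²(Ω)} + |u|²_{H^μ(Ω)}`, possibly infinite. -/
def enormSq (μ : ℝ) {a b : ℝ} (u : L2 a b) : ℝ≥0∞ := ‖u‖ₑ ^ 2 + seminormSq μ u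

/-- The space `H^μ(Ω)` of restrictions to `Ω` of elements of `H^μ(ℝ)`. -/
def sobolev (μ a b : ℝ) : Set (L2 a b) :=
  {u | ∃ f : Lp ℝ 2 (volume : Measure ℝ),
    f =ᵐ[volume.restrict (Ioo a b)] u ∧ lineSeminormSq μ f < ∞}

/-- The norm `‖u‖_{H^μ(Ω)}` as a real number; meaningful for `u ∈ H^μ(Ω)`. -/
def sobolevNorm (μ : ℝ) {a b : ℝ} (u : L2 a b) : ℝ := √(enormSq μ u).toReal

/-- The sequence `φ n` of test functions converges to `u` in `H^μ(Ω)`. -/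
def TestTendsto (μ : ℝ) {a b : ℝ} (φ : ℕ → 𝓓(interval a b, ℝ)) (u : L2 a b) : Prop :=
  Tendsto (fun n => enormSq μ (u - testToL2 (φ n))) atTop (𝓝 0)

/-- `H₀^μ(Ω)`: the closure of `C₀^∞(Ω)` in `H^μ(Ω)`. -/
def sobolev₀ (μ a b : ℝ) : Set (L2 a b) :=
  {u | u ∈ sobolev μ a b ∧ ∃ φ : ℕ → 𝓓(interval a b, ℝ), TestTendsto μ φ u}

/-! ### Tempered Riemann-Liouville derivatives -/

/-- The left tempered derivative of order `n - 1 ≤ μ < n` of a function on `(a, b)`: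
`e^{-λx} / Γ(n - μ) · dⁿ/dxⁿ ∫_a^x e^{λξ} u(ξ) (x - ξ)^{n-1-μ} dξ`. -/
def leftClassical (μ lam a : ℝ) (u : ℝ → ℝ) (x : ℝ) : ℝ :=
  let n : ℕ := ⌊μ⌋₊ + 1
  Real.exp (-lam * x) / Real.Gamma (n - μ) *
    iteratedDeriv n
      (fun y => ∫ ξ in a..y, Real.exp (lam * ξ) * u ξ / (y - ξ) ^ (μ - n + 1)) x

/-- The right tempered derivative of order `n - 1 ≤ μ < n` of a function on `(a, b)`:
`(-1)ⁿ e^{λx} / Γ(n - μ) · dⁿ/dxⁿ ∫_x^b e^{-λξ} u(ξ) (ξ - x)^{n-1-μ} dξ`. -/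
def rightClassical (μ lam b : ℝ) (u : ℝ → ℝ) (x : ℝ) : ℝ :=
  let n : ℕ := ⌊μ⌋₊ + 1
  Real.exp (lam * x) / Real.Gamma (n - μ) * (-1) ^ n *
    iteratedDeriv n
      (fun y => ∫ ξ in y..b, Real.exp (-lam * ξ) * u ξ / (ξ - y) ^ (μ - n + 1)) x

/-- `w ∈ L²(Ω)` is the value at `u` of the continuous extension to `H₀^μ(Ω)` of the operator `T`
on test functions: `T (φ n) → w` in `L²(Ω)` whenever `φ n → u` in `H^μ(Ω)`. For `u ∈ H₀^μ(Ω)`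
there is at most one such `w`. -/
def IsExtensionValue (μ : ℝ) {a b : ℝ} (T : (ℝ → ℝ) → ℝ → ℝ) (u w : L2 a b) : Prop :=
  ∀ φ : ℕ → 𝓓(interval a b, ℝ), TestTendsto μ φ u →
    Tendsto (fun n => eLpNorm (fun x => T (φ n) x - w x) 2 (volume.restrict (Ioo a b)))
      atTop (𝓝 0)

/-- The left tempered derivative on `H₀^μ(Ω)`, the continuous extension of `leftClassical`. -/
def leftDeriv (μ lam : ℝ) {a b : ℝ} (u : L2 a b) : L2 a b :=
  Classical.epsilon (IsExtensionValue μ (leftClassical μ lam a) u)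

/-- The right tempered derivative on `H₀^μ(Ω)`, the continuous extension of `rightClassical`. -/
def rightDeriv (μ lam : ℝ) {a b : ℝ} (u : L2 a b) : L2 a b :=
  Classical.epsilon (IsExtensionValue μ (rightClassical μ lam b) u)

/-- The bilinear form `B`, for `0 < μ < 1/2` and for `1/2 < μ ≤ 1`. -/
def formB (μ lam c₀ : ℝ) {a b : ℝ} (u v : L2 a b) : ℝ :=
  if μ < 1 / 2 then inner ℝ (leftDeriv μ lam u) (rightDeriv μ lam v)
  else -inner ℝ (leftDeriv μ lam u) (rightDeriv μ lam v)
    + (1 + c₀) * lam ^ (2 * μ) * inner ℝ u v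

/-- `F ∼ G` on `S`: each is bounded by a constant multiple of the other, uniformly on `S`. -/
def EquivOn {α : Type*} (S : Set α) (F G : α → ℝ) : Prop :=
  ∃ C : ℝ, 0 < C ∧ ∀ u ∈ S, F u ≤ C * G u ∧ G u ≤ C * F u

end TemperedFractional

end

open scoped ComplexConjugate

noncomputable section

namespace TemperedFractional

/-! ### The symbol -/

/-! Everything is proved for test functions extended by zero and then passed to the limit. For λ > 0
the left derivative is convolution with a causal kernel, so it is the Fourier multiplier (λ + iω)^μ,
and the right derivative has the conjugate multiplier (`ft_lineDeriv`, `ft_lineDerivRight`). The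
left derivative vanishes left of a and the right one vanishes right of b, so their inner product
over Ω equals the one over ℝ. Parseval turns it into ∫ Re (λ + iω)^{2μ} |φ̂|²
(`setIntegral_lineDeriv_mul`), and λ = 0 follows by letting λ → 0+.

The symbol z = λ + iω lies in the closed right half-plane. There Re z^{2μ} is at least cos(πμ)
|z|^{2μ} if μ < 1/2, while (1 + c₀)(Re z)^{2μ} - Re z^{2μ} is at least c |z|^{2μ} if μ > 1/2
(`exists_symbol_lower_bound`). With the Poincaré inequality this makes the form coercive for the
Sobolev norm of the zero extension, `normSq`.

A single derivative also controls that norm: split the inner product by Young's inequality, bound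
the right derivative by the energy and absorb it. For μ > 1/2 an L² term of size λ^{2μ} is left
over. It is absent at λ = 0, and conjugation by e^{λx}, harmless on a bounded interval, carries the
L² bound from λ = 0 to λ > 0 (`exists_integral_sq_le_left`).

The norm of H^μ(Ω) is an infimum over all extensions, so the zero extension must be shown optimal up
to a constant (`exists_normSq_le_enormSq`). For μ < 1 the Gagliardo integral over Ω × Ω depends only
on the restriction, and a fractional Hardy inequality, which needs μ ≠ 1/2, bounds the interaction
with the complement of Ω. For μ = 1 difference quotients are compared directly
(`exists_energy_one_le`). -/

theorem cpow_ofReal_re_eq {z : ℂ} (hz : z ≠ 0) (p : ℝ) :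
    (z ^ (p : ℂ)).re = ‖z‖ ^ p * Real.cos (p * z.arg) := by
  rw [Complex.cpow_def_of_ne_zero hz, Complex.exp_re]
  simp only [Complex.mul_re, Complex.mul_im, Complex.log_re, Complex.log_im, Complex.ofReal_re,
    Complex.ofReal_im, mul_zero, sub_zero, zero_add]
  rw [Real.rpow_def_of_pos (norm_pos_iff.2 hz), mul_comm p z.arg]

/-- In the right half-plane |arg z| ≤ π/2, so 2μ|arg z| ≤ πμ, and the cosine decreases on [0, π]. -/
theorem re_cpow_ge_of_lt_half {μ : ℝ} (h0 : 0 < μ) (h1 : μ < 1 / 2) {z : ℂ} (hz : 0 ≤ z.re) :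
    Real.cos (Real.pi * μ) * ‖z‖ ^ (2 * μ) ≤ (z ^ ((2 * μ : ℝ) : ℂ)).re := by
  rcases eq_or_ne z 0 with rfl | hz0
  · have h : ((2 * μ : ℝ) : ℂ) ≠ 0 := by exact_mod_cast (by positivity : (2 * μ : ℝ) ≠ 0)
    rw [Complex.zero_cpow h, norm_zero, Real.zero_rpow (by positivity)]
    simp
  rw [cpow_ofReal_re_eq hz0, mul_comm]
  refine mul_le_mul_of_nonneg_left ?_ (by positivity)
  have ha := Complex.abs_arg_le_pi_div_two_iff.2 hz
  rw [← Real.cos_abs (2 * μ * z.arg), abs_mul, abs_of_pos (by positivity : 0 < 2 * μ)]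
  apply Real.cos_le_cos_of_nonneg_of_le_pi (by positivity)
  · nlinarith [Real.pi_pos]
  · nlinarith [Real.pi_pos]

/-- `cos (pθ) ≤ cos θ ^ p` for `1 ≤ p ≤ 2`. -/
theorem cos_mul_le_cos_rpow {p θ : ℝ} (h1 : 1 ≤ p) (h2 : p ≤ 2) (hθ0 : 0 ≤ θ)
    (hθ1 : θ < Real.pi / 2) : Real.cos (p * θ) ≤ Real.cos θ ^ p := by
  have hpi := Real.pi_pos
  have hc : ∀ x ∈ Ico 0 (Real.pi / 2), 0 < Real.cos x := fun x hx =>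
    Real.cos_pos_of_mem_Ioo ⟨by linarith [hx.1], hx.2⟩
  -- The quotient cos(px)/(cos x)^p equals 1 at 0, and its derivative is -p sin((p-1)x)/(cos
  -- x)^{p+1}, which is nonpositive because (p-1)x stays in [0, π].
  have hanti : AntitoneOn (fun x => Real.cos (p * x) * Real.cos x ^ (-p)) (Ico 0 (Real.pi / 2)) := by
    have hd : ∀ x ∈ Ico 0 (Real.pi / 2), HasDerivAt
        (fun x => Real.cos (p * x) * Real.cos x ^ (-p))
        (-p * Real.sin ((p - 1) * x) * Real.cos x ^ (-p - 1)) x := by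
      intro x hx
      have h1 : HasDerivAt (fun x => Real.cos (p * x)) (-Real.sin (p * x) * (p * 1)) x :=
        ((hasDerivAt_id x).const_mul p).cos
      have h2 : HasDerivAt (fun x => Real.cos x ^ (-p))
          (-Real.sin x * (-p) * Real.cos x ^ (-p - 1)) x :=
        (Real.hasDerivAt_cos x).rpow_const (Or.inl (hc x hx).ne')
      refine (h1.mul h2).congr_deriv ?_
      have h3 : Real.cos x ^ (-p) = Real.cos x ^ (-p - 1) * Real.cos x := by
        rw [← Real.rpow_add_one (hc x hx).ne']; ring_nf
      rw [h3, show (p - 1) * x = p * x - x by ring, Real.sin_sub]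
      ring
    apply antitoneOn_of_deriv_nonpos (convex_Ico _ _)
    · exact fun x hx => (hd x hx).continuousAt.continuousWithinAt
    · exact fun x hx => (hd x (interior_subset hx)).differentiableAt.differentiableWithinAt
    · intro x hx
      have hx' := interior_subset hx
      rw [(hd x hx').deriv]
      have : 0 ≤ Real.sin ((p - 1) * x) := by
        apply Real.sin_nonneg_of_nonneg_of_le_pi
        · exact mul_nonneg (by linarith) hx'.1
        · nlinarith [hx'.1, hx'.2]
      have h4 := Real.rpow_nonneg (hc x hx').le (-p - 1)
      have h5 : 0 ≤ p * Real.sin ((p - 1) * x) := by positivity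
      nlinarith [mul_nonneg h5 h4]
  have h := hanti ⟨le_rfl, by positivity⟩ ⟨hθ0, hθ1⟩ hθ0
  have hcθ := hc θ ⟨hθ0, hθ1⟩
  simp only [mul_zero, Real.cos_zero, Real.one_rpow, mul_one] at h
  rwa [Real.rpow_neg hcθ.le, ← div_eq_mul_inv, div_le_one (by positivity)] at h

/-- Both sides are homogeneous of degree 2μ in z, so only the angle matters. The constant is the
minimum over [0, π/2] of the angular function, whose positivity comes from `cos_mul_le_cos_rpow` and
c₀ > 0 inside and from cos(πμ) < 0 at the endpoint. -/
theorem exists_symbol_lower_bound {μ c₀ : ℝ} (h0 : 1 / 2 < μ) (h1 : μ ≤ 1) (hc₀ : 0 < c₀) :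
    ∃ c : ℝ, 0 < c ∧ ∀ z : ℂ, 0 ≤ z.re →
      c * ‖z‖ ^ (2 * μ) ≤ (1 + c₀) * z.re ^ (2 * μ) - (z ^ ((2 * μ : ℝ) : ℂ)).re := by
  have hpi := Real.pi_pos
  set F : ℝ → ℝ := fun θ => (1 + c₀) * Real.cos θ ^ (2 * μ) - Real.cos (2 * μ * θ) with hF
  have hcont : ContinuousOn F (Icc 0 (Real.pi / 2)) := by
    apply Continuous.continuousOn
    have : Continuous fun θ : ℝ => Real.cos θ ^ (2 * μ) :=
      Real.continuous_cos.rpow_const fun _ => Or.inr (by linarith)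
    fun_prop
  obtain ⟨θ₀, hθ₀, hmin⟩ := isCompact_Icc.exists_isMinOn (nonempty_Icc.2 (by positivity)) hcont
  have hpos : ∀ θ ∈ Icc 0 (Real.pi / 2), 0 < F θ := by
    intro θ hθ
    rcases hθ.2.lt_or_eq with h | h
    · have h2 := cos_mul_le_cos_rpow (p := 2 * μ) (by linarith) (by linarith) hθ.1 h
      have h3 : 0 < Real.cos θ ^ (2 * μ) :=
        Real.rpow_pos_of_pos (Real.cos_pos_of_mem_Ioo ⟨by linarith [hθ.1], h⟩) _
      simp only [hF]
      nlinarith [mul_pos hc₀ h3]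
    · simp only [hF, h, Real.cos_pi_div_two]
      rw [Real.zero_rpow (by linarith), mul_zero, zero_sub, neg_pos]
      apply Real.cos_neg_of_pi_div_two_lt_of_lt <;> nlinarith
  refine ⟨F θ₀, hpos _ hθ₀, fun z hz => ?_⟩
  rcases eq_or_ne z 0 with rfl | hz0
  · have h : ((2 * μ : ℝ) : ℂ) ≠ 0 := by
      exact_mod_cast (by linarith : (2 * μ : ℝ) ≠ 0)
    rw [Complex.zero_cpow h, norm_zero, Complex.zero_re, Real.zero_rpow (by linarith)]
    simp
  have ha := Complex.abs_arg_le_pi_div_two_iff.2 hz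
  have hm : F θ₀ ≤ F |z.arg| := hmin ⟨abs_nonneg _, ha⟩
  have hre : z.re = ‖z‖ * Real.cos |z.arg| := by rw [Real.cos_abs, Complex.norm_mul_cos_arg]
  have hcos : 0 ≤ Real.cos |z.arg| := Real.cos_nonneg_of_mem_Icc ⟨by linarith [abs_nonneg z.arg], ha⟩
  rw [cpow_ofReal_re_eq hz0, hre, Real.mul_rpow (norm_nonneg _) hcos]
  have : Real.cos (2 * μ * z.arg) = Real.cos (2 * μ * |z.arg|) := by
    rw [← Real.cos_abs (2 * μ * z.arg), abs_mul, abs_of_pos (by linarith : 0 < 2 * μ)]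
  rw [this]
  have h5 := mul_le_mul_of_nonneg_left hm (Real.rpow_nonneg (norm_nonneg z) (2 * μ))
  simp only [hF] at h5 ⊢
  linarith

/-! ### The tempered power kernel and its Fourier transform -/

/-- The kernel `t ^ (-μ) e^{-λt} / Γ(1 - μ)` on `t > 0`. -/
def kernel (μ lam : ℝ) : ℝ → ℝ :=
  (Ioi 0).indicator fun t => t ^ (-μ) * Real.exp (-lam * t) / Real.Gamma (1 - μ)

/-- The symbol `λ + 2πiξ` of `d/dx + λ`. -/
def symbol (lam ξ : ℝ) : ℂ := lam + 2 * Real.pi * Complex.I * ξ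

theorem symbol_re (lam ξ : ℝ) : (symbol lam ξ).re = lam := by simp [symbol]

theorem symbol_im (lam ξ : ℝ) : (symbol lam ξ).im = 2 * Real.pi * ξ := by simp [symbol]

theorem symbol_ne_zero {lam : ℝ} (h : 0 < lam) (ξ : ℝ) : symbol lam ξ ≠ 0 := fun h0 => by
  have := symbol_re lam ξ
  rw [h0] at this
  simp at this
  linarith

theorem symbol_mem_slitPlane {lam : ℝ} (h : 0 < lam) (ξ : ℝ) : symbol lam ξ ∈ Complex.slitPlane :=
  Or.inl (by rwa [symbol_re])

theorem norm_symbol_sq (lam ξ : ℝ) : ‖symbol lam ξ‖ ^ 2 = lam ^ 2 + (2 * Real.pi * ξ) ^ 2 := by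
  rw [← Complex.normSq_eq_norm_sq, Complex.normSq_apply, symbol_re, symbol_im]; ring

theorem hasDerivAt_symbol (lam ξ : ℝ) :
    HasDerivAt (symbol lam) (2 * Real.pi * Complex.I) ξ := by
  have h : HasDerivAt (fun x : ℝ => (x : ℂ)) 1 ξ := Complex.ofRealCLM.hasDerivAt
  have h2 := (h.const_mul (2 * Real.pi * Complex.I)).const_add (lam : ℂ)
  rw [mul_one] at h2
  exact h2

theorem norm_exp_symbol (lam ξ t : ℝ) :
    ‖Complex.exp (-(symbol lam ξ * t))‖ = Real.exp (-lam * t) := by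
  rw [Complex.norm_exp]
  congr 1
  simp [symbol_re]

/-! ### The Gamma integral along a vertical line -/

theorem integrableOn_rpow_mul_exp {s lam : ℝ} (hs : -1 < s) (h : 0 < lam) :
    IntegrableOn (fun t : ℝ => t ^ s * Real.exp (-lam * t)) (Ioi 0) := by
  simpa using integrableOn_rpow_mul_exp_neg_mul_rpow (p := 1) hs one_pos h

theorem integrableOn_rpow_mul_cexp {s lam : ℝ} (hs : -1 < s) (h : 0 < lam) (ξ : ℝ) :
    IntegrableOn (fun t : ℝ => ((t ^ s : ℝ) : ℂ) * Complex.exp (-(symbol lam ξ * t))) (Ioi 0) := by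
  refine Integrable.mono (integrableOn_rpow_mul_exp hs h) ?_ ?_
  · refine ContinuousOn.aestronglyMeasurable (fun t ht => ?_) measurableSet_Ioi
    have : ContinuousAt (fun t : ℝ => t ^ s) t := Real.continuousAt_rpow_const _ _ (Or.inl ht.ne')
    exact ((Complex.continuous_ofReal.continuousAt.comp this).mul
      (by fun_prop)).continuousWithinAt
  · refine Eventually.of_forall fun t => ?_
    rw [norm_mul, norm_exp_symbol, norm_mul, Complex.norm_real, Real.norm_eq_abs (Real.exp _),
      Real.abs_exp]

/-- Integration by parts, that is Γ(β + 1) = βΓ(β) with a complex rate. The boundary terms vanish at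
0 because β > 0 and at infinity because λ > 0. -/
theorem integral_rpow_mul_cexp_recurrence {β lam : ℝ} (hβ : 0 < β) (h : 0 < lam) (ξ : ℝ) :
    symbol lam ξ * ∫ t in Ioi (0 : ℝ), ((t ^ β : ℝ) : ℂ) * Complex.exp (-(symbol lam ξ * t)) =
      β * ∫ t in Ioi (0 : ℝ), ((t ^ (β - 1) : ℝ) : ℂ) * Complex.exp (-(symbol lam ξ * t)) := by
  have hi1 := (integrableOn_rpow_mul_cexp (s := β) (by linarith) h ξ).const_mul (symbol lam ξ)
  have hi2 := (integrableOn_rpow_mul_cexp (s := β - 1) (by linarith) h ξ).const_mul (β : ℂ)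
  have key := integral_Ioi_of_hasDerivAt_of_tendsto (a := (0 : ℝ)) (m := (0 : ℂ))
    (f := fun t : ℝ => ((t ^ β : ℝ) : ℂ) * Complex.exp (-(symbol lam ξ * t)))
    (f' := fun t : ℝ => β * (((t ^ (β - 1) : ℝ) : ℂ) * Complex.exp (-(symbol lam ξ * t))) -
      symbol lam ξ * (((t ^ β : ℝ) : ℂ) * Complex.exp (-(symbol lam ξ * t)))) ?_ ?_ ?_ ?_
  · rw [integral_sub hi2 hi1, integral_const_mul, integral_const_mul,
      Real.zero_rpow hβ.ne'] at key
    simp only [Complex.ofReal_zero, zero_mul, sub_zero] at key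
    exact (sub_eq_zero.1 key).symm
  · have : Continuous fun t : ℝ => t ^ β := Real.continuous_rpow_const hβ.le
    exact Continuous.continuousWithinAt (by fun_prop)
  · intro t ht
    have h1 : HasDerivAt (fun t : ℝ => ((t ^ β : ℝ) : ℂ)) ((β * t ^ (β - 1) : ℝ) : ℂ) t :=
      (Real.hasDerivAt_rpow_const (Or.inl ht.ne')).ofReal_comp
    have h2 : HasDerivAt (fun t : ℝ => Complex.exp (-(symbol lam ξ * t)))
        (Complex.exp (-(symbol lam ξ * t)) * (-(symbol lam ξ * 1))) t :=
      ((Complex.ofRealCLM.hasDerivAt (x := t)).const_mul (symbol lam ξ)).neg.cexp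
    refine (h1.mul h2).congr_deriv ?_
    push_cast
    ring
  · exact hi2.sub hi1
  · rw [tendsto_zero_iff_norm_tendsto_zero]
    refine (tendsto_rpow_mul_exp_neg_mul_atTop_nhds_zero β lam h).congr' ?_
    filter_upwards [eventually_gt_atTop 0] with t ht
    rw [norm_mul, norm_exp_symbol, Complex.norm_real, Real.norm_of_nonneg (by positivity)]

theorem kernel_integrable {μ lam : ℝ} (hμ : μ < 1) (h : 0 < lam) : Integrable (kernel μ lam) := by
  rw [kernel, integrable_indicator_iff measurableSet_Ioi]
  exact (integrableOn_rpow_mul_exp (by linarith) h).div_const _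

theorem fourier_indicator_rpow_mul_exp {s lam : ℝ} (ξ : ℝ) :
    𝓕 (fun t : ℝ => (((Ioi 0).indicator (fun t => t ^ s * Real.exp (-lam * t)) t : ℝ) : ℂ)) ξ =
      ∫ t in Ioi (0 : ℝ), ((t ^ s : ℝ) : ℂ) * Complex.exp (-(symbol lam ξ * t)) := by
  rw [Real.fourier_real_eq_integral_exp_smul, ← integral_indicator measurableSet_Ioi]
  congr 1
  ext t
  by_cases ht : t ∈ Ioi (0 : ℝ)
  · rw [indicator_of_mem ht, indicator_of_mem ht, smul_eq_mul, Complex.ofReal_mul (t ^ s),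
      Complex.ofReal_exp, mul_left_comm, ← Complex.exp_add]
    congr 2
    simp [symbol]; ring
  · rw [indicator_of_notMem ht, indicator_of_notMem ht]; simp

/-- No contour is moved: the transform times `symbol lam ξ ^ β` has zero derivative in ξ, since
differentiating the transform produces a factor t and the recurrence cancels it against the
derivative of the power. The constant is read off at ξ = 0 from the real Gamma integral. -/
theorem fourier_rpow_mul_exp {β lam : ℝ} (hβ : 0 < β) (h : 0 < lam) (ξ : ℝ) :
    𝓕 (fun t : ℝ => (((Ioi 0).indicator
      (fun t => t ^ (β - 1) * Real.exp (-lam * t)) t : ℝ) : ℂ)) ξ =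
      Real.Gamma β * symbol lam ξ ^ (-β : ℂ) := by
  set f : ℝ → ℂ := fun t : ℝ => (((Ioi 0).indicator
      (fun t => t ^ (β - 1) * Real.exp (-lam * t)) t : ℝ) : ℂ) with hf
  have hfi : Integrable f := by
    exact ((integrable_indicator_iff measurableSet_Ioi).2
      (integrableOn_rpow_mul_exp (by linarith) h)).ofReal
  have htf : (fun t : ℝ => t • f t) = fun t : ℝ => (((Ioi 0).indicator
      (fun t => t ^ β * Real.exp (-lam * t)) t : ℝ) : ℂ) := by
    ext t
    by_cases ht : t ∈ Ioi (0 : ℝ)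
    · have : t ^ β = t * t ^ (β - 1) := by
        rw [← Real.rpow_one_add' (le_of_lt ht) (by linarith)]; ring_nf
      simp only [hf, indicator_of_mem ht, this, Complex.real_smul]
      push_cast; ring
    · simp [hf, indicator_of_notMem ht]
  have hfi' : Integrable (fun t : ℝ => t • f t) := by
    rw [htf]
    exact ((integrable_indicator_iff measurableSet_Ioi).2
      (integrableOn_rpow_mul_exp (by linarith) h)).ofReal
  have hder : ∀ ξ, HasDerivAt (fun ξ => 𝓕 f ξ * symbol lam ξ ^ (β : ℂ)) 0 ξ := by
    intro ξ
    have h1 := Real.hasDerivAt_fourier hfi hfi' ξ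
    have h2 : 𝓕 (fun t : ℝ => (-2 * Real.pi * Complex.I * t) • f t) ξ =
        -2 * Real.pi * Complex.I * 𝓕 (fun t : ℝ => t • f t) ξ := by
      simp only [Real.fourier_real_eq_integral_exp_smul]
      rw [← integral_const_mul]
      congr 1
      ext t
      simp only [smul_eq_mul, Complex.real_smul]
      ring
    have h3 : HasDerivAt (fun ξ => symbol lam ξ ^ (β : ℂ))
        ((β : ℂ) * symbol lam ξ ^ ((β : ℂ) - 1) * (2 * Real.pi * Complex.I)) ξ := by
      have h4 := ((hasDerivAt_id (symbol lam ξ)).cpow_const (c := (β : ℂ))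
        (symbol_mem_slitPlane h ξ)).scomp ξ (hasDerivAt_symbol lam ξ)
      refine h4.congr_deriv ?_
      simp only [id, smul_eq_mul]
      ring
    refine (h1.mul h3).congr_deriv ?_
    have h4 := integral_rpow_mul_cexp_recurrence hβ h ξ
    rw [← fourier_indicator_rpow_mul_exp, ← fourier_indicator_rpow_mul_exp, ← htf] at h4
    have h5 : symbol lam ξ ^ (β : ℂ) = symbol lam ξ ^ ((β : ℂ) - 1) * symbol lam ξ := by
      rw [Complex.cpow_sub _ _ (symbol_ne_zero h ξ), Complex.cpow_one, div_mul_cancel₀ _ (symbol_ne_zero h ξ)]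
    rw [h2, h5]
    linear_combination (-2 * Real.pi * Complex.I * symbol lam ξ ^ ((β : ℂ) - 1)) * h4
  have hconst := is_const_of_deriv_eq_zero (fun ξ => (hder ξ).differentiableAt)
    (fun ξ => (hder ξ).deriv) ξ 0
  have h0 : 𝓕 f 0 = (((1 / lam) ^ β * Real.Gamma β : ℝ) : ℂ) := by
    rw [← Real.integral_rpow_mul_exp_neg_mul_Ioi hβ h, Real.fourier_real_eq_integral_exp_smul,
      ← integral_indicator measurableSet_Ioi, ← integral_complex_ofReal]
    congr 1
    ext t
    simp [hf]
  have hs0 : symbol lam 0 = (lam : ℂ) := by simp [symbol]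
  rw [h0, hs0, ← Complex.ofReal_cpow h.le, ← Complex.ofReal_mul, mul_right_comm,
    ← Real.mul_rpow (by positivity) h.le, one_div_mul_cancel h.ne', Real.one_rpow, one_mul] at hconst
  rw [Complex.cpow_neg, ← hconst]
  have : symbol lam ξ ^ (β : ℂ) ≠ 0 := by
    rw [Complex.cpow_ne_zero_iff]; exact Or.inl (symbol_ne_zero h ξ)
  field_simp

theorem fourier_kernel {μ lam : ℝ} (hμ : μ < 1) (h : 0 < lam) (ξ : ℝ) :
    𝓕 (fun t : ℝ => (kernel μ lam t : ℂ)) ξ = symbol lam ξ ^ ((μ - 1 : ℝ) : ℂ) := by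
  have h1 := fourier_rpow_mul_exp (β := 1 - μ) (by linarith) h ξ
  have hG : (Real.Gamma (1 - μ) : ℂ) ≠ 0 := by
    exact_mod_cast (Real.Gamma_pos_of_pos (by linarith)).ne'
  have h2 : (fun t : ℝ => (kernel μ lam t : ℂ)) = (Real.Gamma (1 - μ) : ℂ)⁻¹ •
      fun t : ℝ => (((Ioi 0).indicator
        (fun t => t ^ (1 - μ - 1) * Real.exp (-lam * t)) t : ℝ) : ℂ) := by
    ext t
    by_cases ht : t ∈ Ioi (0 : ℝ)
    · simp only [kernel, Pi.smul_apply, indicator_of_mem ht, smul_eq_mul]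
      rw [show 1 - μ - 1 = -μ by ring]
      push_cast
      ring
    · simp [kernel, indicator_of_notMem ht]
  rw [h2]
  have h3 : ∀ (c : ℂ) (f : ℝ → ℂ), 𝓕 (c • f) ξ = c * 𝓕 f ξ := by
    intro c f
    simp only [Real.fourier_real_eq_integral_exp_smul]
    rw [← integral_const_mul]
    congr 1
    ext t
    simp only [smul_eq_mul, Pi.smul_apply]
    ring
  rw [h3, h1, inv_mul_cancel_left₀ hG]
  congr 1
  push_cast
  ring

/-! ### Test functions on the line -/

/-- `φ : ℝ → ℝ` is smooth with compact support in `(a, b)`. -/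
structure IsTest (a b : ℝ) (φ : ℝ → ℝ) : Prop where
  contDiff : ContDiff ℝ (⊤ : ℕ∞) φ
  hasCompactSupport : HasCompactSupport φ
  tsupport_subset : tsupport φ ⊆ Ioo a b

theorem isTest_testFunction {a b : ℝ} (φ : 𝓓(interval a b, ℝ)) : IsTest a b φ :=
  ⟨φ.contDiff, φ.hasCompactSupport, φ.tsupport_subset⟩

/-- `φ' + λφ`. -/
def src (lam : ℝ) (φ : ℝ → ℝ) (x : ℝ) : ℝ := deriv φ x + lam * φ x

namespace IsTest

variable {a b : ℝ} {φ ψ : ℝ → ℝ}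

theorem continuous (h : IsTest a b φ) : Continuous φ := h.contDiff.continuous

theorem differentiable (h : IsTest a b φ) : Differentiable ℝ φ :=
  h.contDiff.differentiable (by simp)

theorem continuous_deriv (h : IsTest a b φ) : Continuous (deriv φ) :=
  h.contDiff.continuous_deriv (by simp)

theorem eq_zero (h : IsTest a b φ) {x : ℝ} (hx : x ∉ Ioo a b) : φ x = 0 :=
  image_eq_zero_of_notMem_tsupport fun h' => hx (h.tsupport_subset h')

theorem deriv_eq_zero (h : IsTest a b φ) {x : ℝ} (hx : x ∉ Ioo a b) : deriv φ x = 0 := by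
  by_contra h'
  exact hx (h.tsupport_subset (support_deriv_subset h'))

theorem exp_mul (h : IsTest a b φ) (lam : ℝ) : IsTest a b (fun x => Real.exp (lam * x) * φ x) :=
  ⟨(by fun_prop : ContDiff ℝ (⊤ : ℕ∞) fun x : ℝ => Real.exp (lam * x)).mul h.contDiff,
    h.hasCompactSupport.mul_left, (tsupport_mul_subset_right).trans h.tsupport_subset⟩

theorem comp_neg (h : IsTest a b φ) : IsTest (-b) (-a) (fun x => φ (-x)) := by
  refine ⟨h.contDiff.comp contDiff_neg, h.hasCompactSupport.comp_homeomorph (Homeomorph.neg ℝ), ?_⟩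
  intro x hx
  have h1 : tsupport (φ ∘ (Homeomorph.neg ℝ)) = (Homeomorph.neg ℝ) ⁻¹' tsupport φ :=
    tsupport_comp_eq_preimage φ (Homeomorph.neg ℝ)
  have h2 : -x ∈ tsupport φ := by
    have : x ∈ tsupport (φ ∘ (Homeomorph.neg ℝ)) := hx
    rw [h1] at this
    exact this
  have := h.tsupport_subset h2
  constructor <;> linarith [this.1, this.2]

theorem integrable (h : IsTest a b φ) : Integrable φ :=
  h.continuous.integrable_of_hasCompactSupport h.hasCompactSupport

theorem integrable_deriv (h : IsTest a b φ) : Integrable (deriv φ) :=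
  h.continuous_deriv.integrable_of_hasCompactSupport h.hasCompactSupport.deriv

theorem continuous_src (h : IsTest a b φ) (lam : ℝ) : Continuous (src lam φ) :=
  h.continuous_deriv.add (h.continuous.const_mul lam)

theorem hasCompactSupport_src (h : IsTest a b φ) (lam : ℝ) : HasCompactSupport (src lam φ) :=
  h.hasCompactSupport.deriv.add h.hasCompactSupport.mul_left

theorem src_eq_zero (h : IsTest a b φ) (lam : ℝ) {x : ℝ} (hx : x ∉ Ioo a b) : src lam φ x = 0 := by
  simp [src, h.eq_zero hx, h.deriv_eq_zero hx]

theorem integrable_src (h : IsTest a b φ) (lam : ℝ) : Integrable (src lam φ) :=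
  (h.continuous_src lam).integrable_of_hasCompactSupport (h.hasCompactSupport_src lam)

/-- Uniformity over λ in [0, 1] supplies the dominating functions for the limits λ → 0+. -/
theorem exists_src_bound (h : IsTest a b φ) :
    ∃ M : ℝ, ∀ lam ∈ Icc (0 : ℝ) 1, ∀ x, |src lam φ x| ≤ M := by
  obtain ⟨M₁, h₁⟩ := h.continuous.bounded_above_of_compact_support h.hasCompactSupport
  obtain ⟨M₂, h₂⟩ := h.continuous_deriv.bounded_above_of_compact_support h.hasCompactSupport.deriv
  refine ⟨M₂ + M₁, fun lam hl x => (abs_add_le _ _).trans (add_le_add (h₂ x) ?_)⟩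
  rw [abs_mul, abs_of_nonneg hl.1]
  exact (mul_le_of_le_one_left (abs_nonneg _) hl.2).trans (h₁ x)

end IsTest

/-! ### Tempered derivatives on the line -/

/-- The left tempered derivative of order `0 < μ ≤ 1` of a test function, on the whole line. -/
def lineDeriv (μ lam : ℝ) (φ : ℝ → ℝ) : ℝ → ℝ :=
  if μ < 1 then convolution (kernel μ lam) (src lam φ) (ContinuousLinearMap.mul ℝ ℝ) volume
  else src lam φ

theorem lineDeriv_of_lt {μ : ℝ} (hμ : μ < 1) (lam : ℝ) (φ : ℝ → ℝ) (x : ℝ) :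
    lineDeriv μ lam φ x = ∫ t, kernel μ lam t * src lam φ (x - t) := by
  simp [lineDeriv, hμ, convolution_def]

theorem lineDeriv_of_not_lt {μ : ℝ} (hμ : ¬ μ < 1) (lam : ℝ) (φ : ℝ → ℝ) :
    lineDeriv μ lam φ = src lam φ := by
  simp [lineDeriv, hμ]

theorem kernel_of_nonpos (μ lam : ℝ) {t : ℝ} (ht : t ≤ 0) : kernel μ lam t = 0 :=
  indicator_of_notMem (by simpa using ht) _

theorem kernel_of_pos (μ lam : ℝ) {t : ℝ} (ht : 0 < t) :
    kernel μ lam t = t ^ (-μ) * Real.exp (-lam * t) / Real.Gamma (1 - μ) :=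
  indicator_of_mem (mem_Ioi.2 ht) _

theorem kernel_nonneg {μ : ℝ} (hμ : μ < 1) (lam t : ℝ) : 0 ≤ kernel μ lam t :=
  indicator_nonneg (fun t ht => by
    have := Real.Gamma_pos_of_pos (sub_pos.2 hμ)
    have := Real.rpow_nonneg (le_of_lt ht) (-μ)
    positivity) t

theorem kernel_le_kernel_zero {μ lam : ℝ} (hμ : μ < 1) (hlam : 0 ≤ lam) (t : ℝ) :
    kernel μ lam t ≤ kernel μ 0 t := by
  rcases le_or_gt t 0 with ht | ht
  · rw [kernel_of_nonpos _ _ ht, kernel_of_nonpos _ _ ht]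
  · rw [kernel_of_pos _ _ ht, kernel_of_pos _ _ ht]
    have := Real.Gamma_pos_of_pos (sub_pos.2 hμ)
    gcongr

/-- The singularity t^{-μ} is integrable at 0 but not at infinity. Hence the untempered kernel is
only locally integrable, and identities at λ = 0 are obtained as limits from λ > 0. -/
theorem kernel_zero_integrableOn {μ : ℝ} (hμ : μ < 1) (R : ℝ) :
    IntegrableOn (kernel μ 0) (Iio R) := by
  have h1 : IntegrableOn (fun t : ℝ => t ^ (-μ) * Real.exp (-0 * t) / Real.Gamma (1 - μ))
      (Ioo 0 R) := by
    rcases le_or_gt R 0 with hR | hR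
    · simp [Ioo_eq_empty (not_lt.2 hR)]
    · simp only [neg_zero, zero_mul, Real.exp_zero, mul_one]
      exact ((intervalIntegral.integrableOn_Ioo_rpow_iff hR).2 (by linarith)).div_const _
  rw [kernel, IntegrableOn, integrable_indicator_iff measurableSet_Ioi, IntegrableOn,
    Measure.restrict_restrict measurableSet_Ioi]
  exact h1

theorem measurable_kernel (μ lam : ℝ) : Measurable (kernel μ lam) :=
  Measurable.indicator (by fun_prop) measurableSet_Ioi

theorem kernel_locallyIntegrable {μ lam : ℝ} (hμ : μ < 1) (hlam : 0 ≤ lam) :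
    LocallyIntegrable (kernel μ lam) := by
  intro x
  refine ⟨Iio (x + 1), Iio_mem_nhds (by linarith), ?_⟩
  refine Integrable.mono (kernel_zero_integrableOn hμ (x + 1)) (measurable_kernel μ lam).aestronglyMeasurable
    (Eventually.of_forall fun t => ?_)
  rw [Real.norm_of_nonneg (kernel_nonneg hμ _ _), Real.norm_of_nonneg (kernel_nonneg hμ _ _)]
  exact kernel_le_kernel_zero hμ hlam t

section

variable {a b μ lam : ℝ} {φ ψ : ℝ → ℝ}

/-- Causality: the kernel lives on t > 0, so the value at x only sees the function to the left of x.
-/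
theorem lineDeriv_eq_zero (h : IsTest a b φ) {x : ℝ} (hx : x ≤ a) : lineDeriv μ lam φ x = 0 := by
  by_cases hμ : μ < 1
  · rw [lineDeriv_of_lt hμ]
    refine integral_eq_zero_of_ae (Eventually.of_forall fun t => ?_)
    rcases le_or_gt t 0 with ht | ht
    · simp [kernel_of_nonpos _ _ ht]
    · have : x - t ∉ Ioo a b := fun h' => by linarith [h'.1]
      simp [h.src_eq_zero lam this]
  · rw [lineDeriv_of_not_lt hμ]
    exact h.src_eq_zero lam fun h' => by linarith [h'.1]

theorem continuous_lineDeriv (h : IsTest a b φ) (hlam : 0 ≤ lam) :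
    Continuous (lineDeriv μ lam φ) := by
  by_cases hμ : μ < 1
  · simp only [lineDeriv, hμ, if_true]
    exact (h.hasCompactSupport_src lam).continuous_convolution_right _
      (kernel_locallyIntegrable hμ hlam) (h.continuous_src lam)
  · rw [lineDeriv_of_not_lt hμ]
    exact h.continuous_src lam

theorem integrable_lineDeriv (h : IsTest a b φ) (hlam : 0 < lam) :
    Integrable (lineDeriv μ lam φ) := by
  by_cases hμ : μ < 1
  · simp only [lineDeriv, hμ, if_true]
    exact (kernel_integrable hμ hlam).integrable_convolution _ (h.integrable_src lam)
  · rw [lineDeriv_of_not_lt hμ]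
    exact h.integrable_src lam

theorem lineDeriv_sub (h : IsTest a b φ) (h' : IsTest a b ψ) (hlam : 0 ≤ lam) (x : ℝ) :
    lineDeriv μ lam (fun x => φ x - ψ x) x = lineDeriv μ lam φ x - lineDeriv μ lam ψ x := by
  have hsrc : ∀ y, src lam (fun x => φ x - ψ x) y = src lam φ y - src lam ψ y := fun y => by
    have := deriv_sub (h.differentiable y) (h'.differentiable y)
    simp only [src]
    rw [show (fun x => φ x - ψ x) = φ - ψ from rfl, this]
    ring
  by_cases hμ : μ < 1
  · have hc : ∀ {φ : ℝ → ℝ}, IsTest a b φ →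
        Integrable fun t => kernel μ lam t * src lam φ (x - t) := fun h =>
      (h.hasCompactSupport_src lam).convolutionExists_right (ContinuousLinearMap.mul ℝ ℝ)
        (kernel_locallyIntegrable hμ hlam) (h.continuous_src lam) x
    simp only [lineDeriv_of_lt hμ]
    rw [← integral_sub (hc h) (hc h')]
    simp only [hsrc, mul_sub]
  · simp only [lineDeriv_of_not_lt hμ, hsrc]

/-- The Fourier transform of a real function. -/
def ft (φ : ℝ → ℝ) : ℝ → ℂ := 𝓕 (fun x : ℝ => (φ x : ℂ))

theorem ft_deriv (h : IsTest a b φ) (ξ : ℝ) :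
    ft (deriv φ) ξ = 2 * Real.pi * Complex.I * ξ * ft φ ξ := by
  have hd : ∀ x, HasDerivAt (fun x => (φ x : ℂ)) ((deriv φ x : ℝ) : ℂ) x := fun x =>
    (h.differentiable x).hasDerivAt.ofReal_comp
  have hd' : deriv (fun x => (φ x : ℂ)) = fun x => ((deriv φ x : ℝ) : ℂ) := funext fun x => (hd x).deriv
  have := Real.fourier_deriv (f := fun x => (φ x : ℂ)) h.integrable.ofReal (fun x => (hd x).differentiableAt)
    (by rw [hd']; exact h.integrable_deriv.ofReal)
  rw [hd'] at this
  rw [ft, this, ft]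
  simp only [smul_eq_mul]

theorem ft_add {f g : ℝ → ℝ} (hf : Integrable f) (hg : Integrable g) (ξ : ℝ) :
    ft (fun x => f x + g x) ξ = ft f ξ + ft g ξ := by
  simp only [ft, Real.fourier_eq, Complex.ofReal_add, smul_add]
  exact integral_add ((Real.fourierIntegral_convergent_iff ξ).2 hf.ofReal)
    ((Real.fourierIntegral_convergent_iff ξ).2 hg.ofReal)

theorem ft_const_mul (c : ℝ) (f : ℝ → ℝ) (ξ : ℝ) : ft (fun x => c * f x) ξ = c * ft f ξ := by
  simp only [ft, Real.fourier_real_eq_integral_exp_smul]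
  rw [← integral_const_mul]
  congr 1
  ext t
  simp only [smul_eq_mul, Complex.ofReal_mul]
  ring

theorem ft_src (h : IsTest a b φ) (ξ : ℝ) : ft (src lam φ) ξ = symbol lam ξ * ft φ ξ := by
  have := ft_add h.integrable_deriv (h.integrable.const_mul lam) ξ
  rw [ft_deriv h, ft_const_mul, ← add_mul, add_comm] at this
  exact this

/-- The kernel contributes the power μ - 1 of the symbol and φ' + λφ contributes one more factor of
it. -/
theorem ft_lineDeriv (h : IsTest a b φ) (hlam : 0 < lam) (hμ1 : μ ≤ 1) (ξ : ℝ) :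
    ft (lineDeriv μ lam φ) ξ = symbol lam ξ ^ (μ : ℂ) * ft φ ξ := by
  by_cases hμ : μ < 1
  · have h1 : (fun x => (lineDeriv μ lam φ x : ℂ)) = convolution (fun t => (kernel μ lam t : ℂ))
        (fun x => (src lam φ x : ℂ)) (ContinuousLinearMap.lsmul ℂ ℂ) volume := by
      ext x
      rw [lineDeriv_of_lt hμ, convolution_def, ← integral_complex_ofReal]
      simp
    have h2 := ft_src (lam := lam) h ξ
    rw [ft] at h2
    have hk : Integrable fun t => (kernel μ lam t : ℂ) := (kernel_integrable hμ hlam).ofReal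
    have hs : Integrable fun x => (src lam φ x : ℂ) := (h.integrable_src lam).ofReal
    rw [ft, h1, Real.fourier_smul_convolution_eq hk hs, fourier_kernel hμ hlam, smul_eq_mul, h2, ← mul_assoc]
    congr 1
    push_cast
    rw [Complex.cpow_sub _ _ (symbol_ne_zero hlam ξ), Complex.cpow_one,
      div_mul_cancel₀ _ (symbol_ne_zero hlam ξ)]
  · have : μ = 1 := le_antisymm hμ1 (not_lt.1 hμ)
    rw [lineDeriv_of_not_lt hμ, ft_src h, this]
    simp

/-! ### Bounds uniform in λ and the limit λ → 0+ -/

theorem exists_lineDeriv_bound (h : IsTest a b φ) :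
    ∃ M : ℝ, ∀ lam ∈ Icc (0 : ℝ) 1, ∀ x ∈ Ioo a b, |lineDeriv μ lam φ x| ≤ M := by
  obtain ⟨M, hM⟩ := h.exists_src_bound
  by_cases hμ : μ < 1
  -- For x in Ω and t ≥ b - a the point x - t lies left of a, so only a bounded range of the kernel
  -- contributes, where the untempered kernel is integrable.
  · refine ⟨∫ t in Iio (b - a), kernel μ 0 t * M, fun lam hl x hx => ?_⟩
    rw [lineDeriv_of_lt hμ, ← integral_indicator measurableSet_Iio, ← Real.norm_eq_abs]
    refine norm_integral_le_of_norm_le ((integrable_indicator_iff measurableSet_Iio).2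
      ((kernel_zero_integrableOn hμ _).mul_const M)) (Eventually.of_forall fun t => ?_)
    by_cases ht : t ∈ Iio (b - a)
    · rw [indicator_of_mem ht, norm_mul, Real.norm_of_nonneg (kernel_nonneg hμ _ _)]
      exact mul_le_mul (kernel_le_kernel_zero hμ hl.1 t) (hM lam hl _) (norm_nonneg _)
        (kernel_nonneg hμ _ _)
    · have : x - t ∉ Ioo a b := fun h' => ht (by simp only [mem_Iio]; linarith [h'.1, hx.2])
      simp [indicator_of_notMem ht, h.src_eq_zero lam this]
  · exact ⟨M, fun lam hl x _ => by rw [lineDeriv_of_not_lt hμ]; exact hM lam hl x⟩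

theorem tendsto_lineDeriv_zero (h : IsTest a b φ) (x : ℝ) :
    Tendsto (fun lam => lineDeriv μ lam φ x) (𝓝[>] 0) (𝓝 (lineDeriv μ 0 φ x)) := by
  obtain ⟨M, hM⟩ := h.exists_src_bound
  have hsrc : ∀ y, Tendsto (fun lam => src lam φ y) (𝓝[>] 0) (𝓝 (src 0 φ y)) := fun y =>
    tendsto_nhdsWithin_of_tendsto_nhds
      ((by unfold src; fun_prop : Continuous fun lam => src lam φ y).tendsto 0)
  by_cases hμ : μ < 1
  · simp only [lineDeriv_of_lt hμ]
    refine tendsto_integral_filter_of_dominated_convergence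
      ((Iio (x - a)).indicator fun t => kernel μ 0 t * M) ?_ ?_ ?_ ?_
    · exact Eventually.of_forall fun lam => (measurable_kernel μ lam).aestronglyMeasurable.mul
        ((h.continuous_src lam).comp (continuous_const.sub continuous_id)).aestronglyMeasurable
    · filter_upwards [Ioc_mem_nhdsGT (zero_lt_one' ℝ)] with lam hl
      refine Eventually.of_forall fun t => ?_
      by_cases ht : t ∈ Iio (x - a)
      · rw [indicator_of_mem ht, norm_mul, Real.norm_of_nonneg (kernel_nonneg hμ _ _)]
        exact mul_le_mul (kernel_le_kernel_zero hμ hl.1.le t) (hM lam ⟨hl.1.le, hl.2⟩ _)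
          (norm_nonneg _) (kernel_nonneg hμ _ _)
      · have : x - t ∉ Ioo a b := fun h' => ht (by simp only [mem_Iio]; linarith [h'.1])
        simp [indicator_of_notMem ht, h.src_eq_zero lam this]
    · exact (integrable_indicator_iff measurableSet_Iio).2
        ((kernel_zero_integrableOn hμ _).mul_const M)
    · refine Eventually.of_forall fun t => Tendsto.mul ?_ (hsrc _)
      rcases le_or_gt t 0 with ht | ht
      · simp [kernel_of_nonpos _ _ ht]
      · simp only [kernel_of_pos _ _ ht]
        exact tendsto_nhdsWithin_of_tendsto_nhds
          ((by fun_prop : Continuous fun lam : ℝ =>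
            t ^ (-μ) * Real.exp (-lam * t) / Real.Gamma (1 - μ)).tendsto 0)
  · simp only [lineDeriv_of_not_lt hμ]
    exact hsrc x

/-! ### Comparison with the classical formulas -/

theorem hasDerivAt_exp_mul (h : IsTest a b φ) (x : ℝ) :
    HasDerivAt (fun x => Real.exp (lam * x) * φ x) (Real.exp (lam * x) * src lam φ x) x := by
  have h1 : HasDerivAt (fun x => Real.exp (lam * x)) (Real.exp (lam * x) * (lam * 1)) x :=
    ((hasDerivAt_id x).const_mul lam).exp
  refine (h1.mul (h.differentiable x).hasDerivAt).congr_deriv ?_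
  simp only [src]
  ring

/-- Substitute t = y - ξ. The cut-off at ξ = a is invisible because the function vanishes outside
(a, b). -/
theorem intervalIntegral_eq_convolution (hμ : μ < 1) (h : IsTest a b φ) {y : ℝ} (hy : a < y) :
    ∫ ξ in a..y, φ ξ / (y - ξ) ^ μ = Real.Gamma (1 - μ) *
      convolution (kernel μ 0) φ (ContinuousLinearMap.mul ℝ ℝ) volume y := by
  have hG := Real.Gamma_pos_of_pos (sub_pos.2 hμ)
  have h1 := intervalIntegral.integral_comp_sub_left (a := 0) (b := y - a)
    (fun ξ => φ ξ / (y - ξ) ^ μ) y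
  simp only [sub_sub_cancel, sub_zero] at h1
  rw [← h1, intervalIntegral.integral_of_le (by linarith), convolution_def, ← integral_const_mul,
    ← integral_indicator measurableSet_Ioc]
  congr 1
  ext t
  simp only [ContinuousLinearMap.mul_apply']
  by_cases ht : t ∈ Ioc 0 (y - a)
  · rw [indicator_of_mem ht, kernel_of_pos _ _ ht.1, Real.rpow_neg ht.1.le]
    simp only [neg_zero, zero_mul, Real.exp_zero, mul_one]
    field_simp
  · rw [indicator_of_notMem ht]
    rcases le_or_gt t 0 with ht0 | ht0
    · simp [kernel_of_nonpos _ _ ht0]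
    · have : y - t ∉ Ioo a b := fun h' => ht ⟨ht0, by linarith [h'.1]⟩
      simp [h.eq_zero this]

/-- The derivative of the convolution falls on the smooth factor e^{λx}φ, giving e^{λx}(φ' + λφ),
and the prefactor e^{-λx} then turns the kernel t^{-μ} into t^{-μ}e^{-λt}. -/
theorem leftClassical_eq (h : IsTest a b φ) (hμ0 : 0 < μ) (hμ1 : μ ≤ 1) {x : ℝ} (hx : a < x) :
    leftClassical μ lam a φ x = lineDeriv μ lam φ x := by
  have hnhds : Ioi a ∈ 𝓝 x := Ioi_mem_nhds hx
  have hψ := h.exp_mul lam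
  by_cases hμ : μ < 1
  · have hn : ⌊μ⌋₊ = 0 := Nat.floor_eq_zero.2 hμ
    have hG := Real.Gamma_pos_of_pos (sub_pos.2 hμ)
    simp only [leftClassical, hn, zero_add, Nat.cast_one, iteratedDeriv_one, sub_add_cancel]
    have h1 : (fun y => ∫ ξ in a..y, Real.exp (lam * ξ) * φ ξ / (y - ξ) ^ μ) =ᶠ[𝓝 x]
        fun y => Real.Gamma (1 - μ) * convolution (kernel μ 0) (fun x => Real.exp (lam * x) * φ x)
          (ContinuousLinearMap.mul ℝ ℝ) volume y := by
      filter_upwards [hnhds] with y hy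
      exact intervalIntegral_eq_convolution hμ hψ hy
    rw [h1.deriv_eq]
    have h2 := (hψ.hasCompactSupport.hasDerivAt_convolution_right (ContinuousLinearMap.mul ℝ ℝ)
      (kernel_locallyIntegrable hμ le_rfl) (hψ.contDiff.of_le (by simp)) x).const_mul
      (Real.Gamma (1 - μ))
    rw [h2.deriv, lineDeriv_of_lt hμ, convolution_def, ← mul_assoc, div_mul_cancel₀ _ hG.ne',
      ← integral_const_mul]
    congr 1
    ext t
    rw [(hasDerivAt_exp_mul h (x - t)).deriv]
    rcases le_or_gt t 0 with ht0 | ht0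
    · simp [kernel_of_nonpos _ _ ht0]
    · simp only [kernel_of_pos _ _ ht0, ContinuousLinearMap.mul_apply', neg_zero, zero_mul,
        Real.exp_zero, mul_one]
      have : Real.exp (-lam * t) = Real.exp (-lam * x) * Real.exp (lam * (x - t)) := by
        rw [← Real.exp_add]; ring_nf
      rw [this]
      ring
  · have hμ' : μ = 1 := le_antisymm hμ1 (not_lt.1 hμ)
    subst hμ'
    rw [lineDeriv_of_not_lt hμ]
    -- At μ = 1 the order is n = 2, so the kernel exponent μ - n + 1 is 0, Γ(n - μ) = 1, and the
    -- formula is the second derivative of a plain primitive.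
    simp only [leftClassical, Nat.floor_one]
    norm_num
    rw [iteratedDeriv_succ, iteratedDeriv_one]
    have h1 : deriv (fun y => ∫ ξ in a..y, Real.exp (lam * ξ) * φ ξ) =
        fun y => Real.exp (lam * y) * φ y := by
      ext y
      exact (hψ.continuous.integral_hasStrictDerivAt a y).hasDerivAt.deriv
    rw [h1, (hasDerivAt_exp_mul h x).deriv, ← mul_assoc, ← Real.exp_add]
    simp

/-- Tempering is conjugation by e^{λx}. This is what later transfers an L² lower bound from λ = 0 to
λ > 0. -/
theorem leftClassical_eq_exp_mul (μ lam a : ℝ) (φ : ℝ → ℝ) (x : ℝ) :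
    leftClassical μ lam a φ x =
      Real.exp (-lam * x) * leftClassical μ 0 a (fun x => Real.exp (lam * x) * φ x) x := by
  simp only [leftClassical, zero_mul, neg_zero, Real.exp_zero, one_mul]
  ring

/-- Reflection x ↦ -x exchanges the two derivatives. The n derivatives of the reflected function
produce (-1)^n, which cancels the sign in the right derivative. -/
theorem rightClassical_eq (μ lam b : ℝ) (φ : ℝ → ℝ) (x : ℝ) :
    rightClassical μ lam b φ x = leftClassical μ lam (-b) (fun x => φ (-x)) (-x) := by
  simp only [rightClassical, leftClassical]
  set n := ⌊μ⌋₊ + 1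
  have h1 : (fun y => ∫ ξ in y..b, Real.exp (-lam * ξ) * φ ξ / (ξ - y) ^ (μ - n + 1)) =
      fun y => (fun y => ∫ ξ in (-b)..y, Real.exp (lam * ξ) * φ (-ξ) / (y - ξ) ^ (μ - n + 1))
        (-y) := by
    ext y
    have := intervalIntegral.integral_comp_neg (a := -b) (b := -y)
      (fun ξ => Real.exp (-lam * ξ) * φ ξ / (ξ - y) ^ (μ - n + 1))
    simp only [neg_neg] at this
    rw [← this]
    refine intervalIntegral.integral_congr fun ξ _ => ?_
    simp only [mul_neg, neg_mul, neg_neg]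
    ring_nf
  rw [h1, iteratedDeriv_comp_neg n (fun y => ∫ ξ in (-b)..y,
    Real.exp (lam * ξ) * φ (-ξ) / (y - ξ) ^ (μ - n + 1)) x, smul_eq_mul, mul_assoc, ← mul_assoc ((-1 : ℝ) ^ n), ← mul_pow]
  simp

end

/-! ### Parseval's identity for continuous functions with integrable transform -/

theorem conj_ft (f : ℝ → ℝ) (ξ : ℝ) : conj (ft f ξ) = ft f (-ξ) := by
  simp only [ft, Real.fourier_real_eq_integral_exp_smul]
  rw [← integral_conj]
  congr 1
  ext t
  simp only [smul_eq_mul, map_mul, ← Complex.exp_conj, Complex.conj_ofReal, Complex.conj_I]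
  congr 2
  push_cast
  ring

theorem ft_comp_neg (f : ℝ → ℝ) (ξ : ℝ) : ft (fun x => f (-x)) ξ = ft f (-ξ) := by
  simp only [ft, Real.fourier_real_eq_integral_exp_smul]
  rw [← integral_neg_eq_self]
  congr 1
  ext t
  simp

theorem fourierInv_ft {g : ℝ → ℝ} (hc : Continuous g) (hg : Integrable g)
    (hg' : Integrable (ft g)) (x : ℝ) : 𝓕⁻ (ft g) x = g x := by
  have hgc : Integrable fun x => (g x : ℂ) := hg.ofReal
  have := Continuous.fourierInv_fourier_eq (f := fun x => (g x : ℂ)) (by fun_prop) hgc hg'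
  exact congrFun this x

/-- The multiplication formula moves the transform from f onto ξ ↦ ĝ(-ξ), whose transform is g by
Fourier inversion. The reflection is complex conjugation, as g is real. -/
theorem parseval {f g : ℝ → ℝ} (hf : Integrable f) (hc : Continuous g) (hg : Integrable g)
    (hg' : Integrable (ft g)) :
    ((∫ x, f x * g x : ℝ) : ℂ) = ∫ ξ, ft f ξ * conj (ft g ξ) := by
  have hfc : Integrable fun x => (f x : ℂ) := hf.ofReal
  have h1 : Integrable fun ξ => ft g (-ξ) := hg'.comp_neg
  have h2 := VectorFourier.integral_bilin_fourierIntegral_eq_flip (ContinuousLinearMap.mul ℂ ℂ)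
    (L := innerₗ ℝ) Real.continuous_fourierChar continuous_inner hfc h1
  have h3 : ∀ x, 𝓕 (fun ξ => ft g (-ξ)) x = g x := fun x => by
    rw [← Real.fourierInv_eq_fourier_comp_neg, fourierInv_ft hc hg hg']
  have h4 : ∫ ξ, ft f ξ * ft g (-ξ) = ∫ x, (f x : ℂ) * 𝓕 (fun ξ => ft g (-ξ)) x := by
    simpa using! h2
  simp only [conj_ft, h4, h3, ← Complex.ofReal_mul]
  exact integral_complex_ofReal.symm

theorem abs_le_of_integrable_ft {g : ℝ → ℝ} (hc : Continuous g) (hg : Integrable g)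
    (hg' : Integrable (ft g)) (x : ℝ) : |g x| ≤ ∫ ξ, ‖ft g ξ‖ := by
  have h1 : ‖(g x : ℂ)‖ = |g x| := Complex.norm_real _
  rw [← h1, ← fourierInv_ft hc hg hg', Real.fourierInv_eq]
  refine (norm_integral_le_integral_norm _).trans (le_of_eq ?_)
  simp

theorem integral_sq_eq {g : ℝ → ℝ} (hc : Continuous g) (hg : Integrable g)
    (hg' : Integrable (ft g)) : ∫ x, g x ^ 2 = ∫ ξ, ‖ft g ξ‖ ^ 2 := by
  have := parseval hg hc hg hg'
  simp only [Complex.mul_conj, Complex.normSq_eq_norm_sq] at this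
  rw [integral_complex_ofReal] at this
  simpa only [sq] using Complex.ofReal_injective this

theorem integrable_sq {g : ℝ → ℝ} (hc : Continuous g) (hg : Integrable g)
    (hg' : Integrable (ft g)) : Integrable fun x => g x ^ 2 := by
  refine (hg.const_mul (∫ ξ, ‖ft g ξ‖)).mono (by fun_prop) (Eventually.of_forall fun x => ?_)
  have h := abs_le_of_integrable_ft hc hg hg' x
  have h0 : 0 ≤ ∫ ξ, ‖ft g ξ‖ := integral_nonneg fun _ => norm_nonneg _
  rw [norm_pow, norm_mul, Real.norm_of_nonneg h0, sq]
  exact mul_le_mul_of_nonneg_right h (norm_nonneg _)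

/-! ### Energies -/

section

variable {a b μ lam : ℝ} {φ ψ : ℝ → ℝ}

/-- The transform of a test function is a Schwartz function. A quadratic weight suffices throughout,
because all symbols occurring have order at most 2. -/
theorem integrable_weight_mul_norm_ft (h : IsTest a b φ) (C : ℝ) :
    Integrable fun ξ => (C + (2 * Real.pi * ξ) ^ 2) * ‖ft φ ξ‖ := by
  have hcs : HasCompactSupport fun x => (φ x : ℂ) :=
    h.hasCompactSupport.comp_left (g := fun x : ℝ => (x : ℂ)) Complex.ofReal_zero
  have hcd : ContDiff ℝ (⊤ : ℕ∞) fun x => (φ x : ℂ) :=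
    Complex.ofRealCLM.contDiff.comp h.contDiff
  set S := 𝓕 (hcs.toSchwartzMap hcd) with hS
  have hSft : ∀ ξ, S ξ = ft φ ξ := fun ξ => rfl
  have h1 := (S.integrable_pow_mul volume 0).const_mul C
  have h2 := (S.integrable_pow_mul volume 2).const_mul ((2 * Real.pi) ^ 2)
  refine (h1.add h2).congr (Eventually.of_forall fun ξ => ?_)
  simp only [Pi.add_apply, hSft, Real.norm_eq_abs, sq_abs, pow_zero]
  ring

theorem continuous_ft (hf : Integrable φ) : Continuous (ft φ) := by
  have hfc : Integrable fun x => (φ x : ℂ) := hf.ofReal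
  exact VectorFourier.fourierIntegral_continuous Real.continuous_fourierChar
    (by exact continuous_inner) hfc

theorem norm_ft_le (φ : ℝ → ℝ) (ξ : ℝ) : ‖ft φ ξ‖ ≤ ∫ x, |φ x| := by
  rw [ft, Real.fourier_eq]
  refine (norm_integral_le_integral_norm _).trans (le_of_eq ?_)
  simp

theorem integrable_weight_mul_norm_ft_sq (h : IsTest a b φ) {C : ℝ} (hC : 0 ≤ C) :
    Integrable fun ξ => (C + (2 * Real.pi * ξ) ^ 2) * ‖ft φ ξ‖ ^ 2 := by
  have hcont := continuous_ft h.integrable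
  refine ((integrable_weight_mul_norm_ft h C).const_mul (∫ x, |φ x|)).mono
    (Continuous.aestronglyMeasurable (by fun_prop)) (Eventually.of_forall fun ξ => ?_)
  have h0 := norm_ft_le φ ξ
  have h1 : 0 ≤ ∫ x, |φ x| := integral_nonneg fun _ => abs_nonneg _
  rw [Real.norm_of_nonneg (by positivity), Real.norm_of_nonneg (by positivity)]
  have h2 : 0 ≤ (C + (2 * Real.pi * ξ) ^ 2) * ‖ft φ ξ‖ := by positivity
  nlinarith [mul_le_mul_of_nonneg_left h0 h2]

theorem norm_symbol_rpow_le {p : ℝ} (hp0 : 0 ≤ p) (hp2 : p ≤ 2) (ξ : ℝ) :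
    ‖symbol lam ξ‖ ^ p ≤ 1 + lam ^ 2 + (2 * Real.pi * ξ) ^ 2 := by
  rw [add_assoc, ← norm_symbol_sq]
  rcases le_total ‖symbol lam ξ‖ 1 with h | h
  · exact (Real.rpow_le_one (norm_nonneg _) h hp0).trans (by nlinarith [norm_nonneg (symbol lam ξ)])
  · have := Real.rpow_le_rpow_of_exponent_le h hp2
    rw [Real.rpow_two] at this
    linarith

theorem continuous_symbol (lam : ℝ) : Continuous (symbol lam) := by
  unfold symbol; fun_prop

theorem continuous_norm_symbol_rpow {p : ℝ} (hp0 : 0 ≤ p) :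
    Continuous fun ξ => ‖symbol lam ξ‖ ^ p :=
  (continuous_symbol lam).norm.rpow_const fun _ => Or.inr hp0

/-- `∫ (λ² + ω²)^μ |φ̂|²`. -/
def energy (μ lam : ℝ) (φ : ℝ → ℝ) : ℝ := ∫ ξ, ‖symbol lam ξ‖ ^ (2 * μ) * ‖ft φ ξ‖ ^ 2

/-- `∫ Re (λ + iω)^{2μ} |φ̂|²`. -/
def pairing (μ lam : ℝ) (φ : ℝ → ℝ) : ℝ :=
  ∫ ξ, (symbol lam ξ ^ ((2 * μ : ℝ) : ℂ)).re * ‖ft φ ξ‖ ^ 2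

theorem energy_nonneg (μ lam : ℝ) (φ : ℝ → ℝ) : 0 ≤ energy μ lam φ :=
  integral_nonneg fun _ => by positivity

theorem integrable_energy (h : IsTest a b φ) (hμ0 : 0 ≤ μ) (hμ1 : μ ≤ 1) :
    Integrable fun ξ => ‖symbol lam ξ‖ ^ (2 * μ) * ‖ft φ ξ‖ ^ 2 := by
  have hcont := continuous_ft h.integrable
  have hs := continuous_norm_symbol_rpow (lam := lam) (p := 2 * μ) (by positivity)
  refine (integrable_weight_mul_norm_ft_sq h (C := 1 + lam ^ 2) (by positivity)).mono
    (Continuous.aestronglyMeasurable (by fun_prop)) (Eventually.of_forall fun ξ => ?_)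
  rw [Real.norm_of_nonneg (by positivity), Real.norm_of_nonneg (by positivity)]
  exact mul_le_mul_of_nonneg_right
    (norm_symbol_rpow_le (by positivity) (by linarith) ξ) (by positivity)

theorem measurable_symbol_cpow (lam : ℝ) (p : ℂ) : Measurable fun ξ => symbol lam ξ ^ p :=
  (continuous_symbol lam).measurable.pow_const p

theorem norm_symbol_cpow_le {p : ℝ} (hp : 0 < p) (ξ : ℝ) :
    ‖symbol lam ξ ^ (p : ℂ)‖ ≤ ‖symbol lam ξ‖ ^ p := by
  rcases eq_or_ne (symbol lam ξ) 0 with h | h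
  · have h0 : (p : ℂ) ≠ 0 := by exact_mod_cast hp.ne'
    simp [h, Complex.zero_cpow h0, Real.zero_rpow hp.ne']
  · rw [Complex.norm_cpow_of_ne_zero h]; simp

theorem integrable_pairing (h : IsTest a b φ) (hμ0 : 0 < μ) (hμ1 : μ ≤ 1) :
    Integrable fun ξ => (symbol lam ξ ^ ((2 * μ : ℝ) : ℂ)).re * ‖ft φ ξ‖ ^ 2 := by
  have hcont := continuous_ft h.integrable
  refine (integrable_energy (lam := lam) h hμ0.le hμ1).mono
    (((Complex.measurable_re.comp (measurable_symbol_cpow lam _)).mul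
      (by fun_prop)).aestronglyMeasurable) (Eventually.of_forall fun ξ => ?_)
  rw [norm_mul, norm_mul]
  refine mul_le_mul_of_nonneg_right ?_ (norm_nonneg _)
  refine (Complex.abs_re_le_norm _).trans ((norm_symbol_cpow_le (by positivity) ξ).trans ?_)
  exact le_abs_self _

theorem norm_ft_lineDeriv (h : IsTest a b φ) (hlam : 0 < lam) (hμ1 : μ ≤ 1) (ξ : ℝ) :
    ‖ft (lineDeriv μ lam φ) ξ‖ ^ 2 = ‖symbol lam ξ‖ ^ (2 * μ) * ‖ft φ ξ‖ ^ 2 := by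
  rw [ft_lineDeriv h hlam hμ1, norm_mul, Complex.norm_cpow_of_ne_zero (symbol_ne_zero hlam ξ),
    mul_pow]
  congr 1
  simp only [Complex.ofReal_re, Complex.ofReal_im, mul_zero, Real.exp_zero, div_one]
  rw [← Real.rpow_natCast, ← Real.rpow_mul (norm_nonneg _)]
  congr 1
  push_cast
  ring

theorem integrable_ft_lineDeriv (h : IsTest a b φ) (hlam : 0 < lam) (hμ0 : 0 < μ) (hμ1 : μ ≤ 1) :
    Integrable (ft (lineDeriv μ lam φ)) := by
  have hcont := continuous_ft h.integrable
  refine (integrable_weight_mul_norm_ft h (1 + lam ^ 2)).mono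
    (continuous_ft (integrable_lineDeriv h hlam)).aestronglyMeasurable
    (Eventually.of_forall fun ξ => ?_)
  rw [ft_lineDeriv h hlam hμ1, Real.norm_of_nonneg (by positivity), norm_mul]
  refine mul_le_mul_of_nonneg_right ((norm_symbol_cpow_le hμ0 ξ).trans ?_) (norm_nonneg _)
  exact norm_symbol_rpow_le hμ0.le (by linarith) ξ

/-- The right tempered derivative of a test function on the line, by reflection. -/
def lineDerivRight (μ lam : ℝ) (φ : ℝ → ℝ) (x : ℝ) : ℝ := lineDeriv μ lam (fun x => φ (-x)) (-x)

/-- Reflection replaces ξ by -ξ, hence the symbol by its conjugate. The principal power commutes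
with conjugation since λ > 0 keeps the symbol off the negative axis. -/
theorem ft_lineDerivRight (h : IsTest a b φ) (hlam : 0 < lam) (hμ1 : μ ≤ 1) (ξ : ℝ) :
    ft (lineDerivRight μ lam φ) ξ = conj (symbol lam ξ ^ (μ : ℂ)) * ft φ ξ := by
  have h1 := ft_comp_neg (lineDeriv μ lam (fun x => φ (-x))) ξ
  have h3 := ft_lineDeriv h.comp_neg hlam hμ1 (-ξ)
  rw [ft_comp_neg φ, neg_neg] at h3
  rw [h3] at h1
  have h2 : symbol lam (-ξ) = conj (symbol lam ξ) := by
    apply Complex.ext <;> simp [symbol_re, symbol_im]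
  rw [h2, Complex.conj_cpow _ _ (Complex.slitPlane_arg_ne_pi (symbol_mem_slitPlane hlam ξ)),
    Complex.conj_ofReal] at h1
  exact h1

theorem continuous_lineDerivRight (h : IsTest a b φ) (hlam : 0 ≤ lam) :
    Continuous (lineDerivRight μ lam φ) :=
  (continuous_lineDeriv h.comp_neg hlam).comp continuous_neg

theorem lineDerivRight_eq_zero (h : IsTest a b φ) {x : ℝ} (hx : b ≤ x) :
    lineDerivRight μ lam φ x = 0 :=
  lineDeriv_eq_zero h.comp_neg (by linarith)

theorem rightClassical_eq_line (h : IsTest a b φ) (hμ0 : 0 < μ) (hμ1 : μ ≤ 1) {x : ℝ}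
    (hx : x < b) : rightClassical μ lam b φ x = lineDerivRight μ lam φ x := by
  rw [rightClassical_eq, leftClassical_eq h.comp_neg hμ0 hμ1 (by linarith), lineDerivRight]

theorem exists_lineDerivRight_bound (h : IsTest a b φ) :
    ∃ M : ℝ, ∀ lam ∈ Icc (0 : ℝ) 1, ∀ x ∈ Ioo a b, |lineDerivRight μ lam φ x| ≤ M := by
  obtain ⟨M, hM⟩ := exists_lineDeriv_bound (μ := μ) h.comp_neg
  exact ⟨M, fun lam hl x hx => hM lam hl _ ⟨by linarith [hx.2], by linarith [hx.1]⟩⟩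

theorem tendsto_lineDerivRight_zero (h : IsTest a b φ) (x : ℝ) :
    Tendsto (fun lam => lineDerivRight μ lam φ x) (𝓝[>] 0) (𝓝 (lineDerivRight μ 0 φ x)) :=
  tendsto_lineDeriv_zero h.comp_neg _

/-! ### Limits as `λ → 0` -/

theorem tendsto_symbol (ξ : ℝ) : Tendsto (fun lam => symbol lam ξ) (𝓝[>] 0) (𝓝 (symbol 0 ξ)) :=
  tendsto_nhdsWithin_of_tendsto_nhds
    ((by unfold symbol; fun_prop : Continuous fun lam => symbol lam ξ).tendsto 0)

theorem tendsto_energy (h : IsTest a b φ) (hμ0 : 0 < μ) (hμ1 : μ ≤ 1) :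
    Tendsto (fun lam => energy μ lam φ) (𝓝[>] 0) (𝓝 (energy μ 0 φ)) := by
  refine tendsto_integral_filter_of_dominated_convergence
    (fun ξ => (2 + (2 * Real.pi * ξ) ^ 2) * ‖ft φ ξ‖ ^ 2) ?_ ?_
    (integrable_weight_mul_norm_ft_sq h (by norm_num)) ?_
  · exact Eventually.of_forall fun lam => (integrable_energy h hμ0.le hμ1).aestronglyMeasurable
  · filter_upwards [Ioc_mem_nhdsGT (zero_lt_one' ℝ)] with lam hl
    refine Eventually.of_forall fun ξ => ?_
    rw [Real.norm_of_nonneg (by positivity)]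
    refine mul_le_mul_of_nonneg_right ?_ (by positivity)
    refine (norm_symbol_rpow_le (by positivity) (by linarith) ξ).trans ?_
    nlinarith [hl.1, hl.2]
  · refine Eventually.of_forall fun ξ => Tendsto.mul_const _ ?_
    exact (tendsto_symbol ξ).norm.rpow_const (Or.inr (by positivity))

theorem tendsto_pairing (h : IsTest a b φ) (hμ0 : 0 < μ) (hμ1 : μ ≤ 1) :
    Tendsto (fun lam => pairing μ lam φ) (𝓝[>] 0) (𝓝 (pairing μ 0 φ)) := by
  refine tendsto_integral_filter_of_dominated_convergence
    (fun ξ => (2 + (2 * Real.pi * ξ) ^ 2) * ‖ft φ ξ‖ ^ 2) ?_ ?_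
    (integrable_weight_mul_norm_ft_sq h (by norm_num)) ?_
  · exact Eventually.of_forall fun lam => (integrable_pairing h hμ0 hμ1).aestronglyMeasurable
  · filter_upwards [Ioc_mem_nhdsGT (zero_lt_one' ℝ)] with lam hl
    refine Eventually.of_forall fun ξ => ?_
    rw [norm_mul, Real.norm_of_nonneg (by positivity : 0 ≤ ‖ft φ ξ‖ ^ 2)]
    refine mul_le_mul_of_nonneg_right ?_ (by positivity)
    refine (Complex.abs_re_le_norm _).trans ((norm_symbol_cpow_le (by positivity) ξ).trans ?_)
    refine (norm_symbol_rpow_le (by positivity) (by linarith) ξ).trans ?_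
    nlinarith [hl.1, hl.2]
  -- At ξ = 0 the limiting symbol is 0, outside the slit plane. Elsewhere it is purely imaginary and
  -- nonzero, where the complex power is continuous.
  · have h0 : ∀ᵐ ξ : ℝ, ξ ≠ 0 := by simp [ae_iff]
    filter_upwards [h0] with ξ hξ
    refine Tendsto.mul_const _ (Complex.continuous_re.continuousAt.tendsto.comp ?_)
    refine ContinuousAt.tendsto (x := symbol 0 ξ) (f := fun z : ℂ => z ^ ((2 * μ : ℝ) : ℂ)) ?_
      |>.comp (tendsto_symbol ξ)
    refine (continuousAt_id).cpow continuousAt_const (Or.inr ?_)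
    simp only [id, symbol_im]
    have := Real.pi_pos
    positivity

theorem tendsto_setIntegral_mul {F G : ℝ → ℝ → ℝ} (hF : ∀ lam, 0 ≤ lam → Continuous (F lam))
    (hG : ∀ lam, 0 ≤ lam → Continuous (G lam))
    (hFb : ∃ M : ℝ, ∀ lam ∈ Icc (0 : ℝ) 1, ∀ x ∈ Ioo a b, |F lam x| ≤ M)
    (hGb : ∃ M : ℝ, ∀ lam ∈ Icc (0 : ℝ) 1, ∀ x ∈ Ioo a b, |G lam x| ≤ M)
    (hFt : ∀ x, Tendsto (fun lam => F lam x) (𝓝[>] 0) (𝓝 (F 0 x)))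
    (hGt : ∀ x, Tendsto (fun lam => G lam x) (𝓝[>] 0) (𝓝 (G 0 x))) :
    Tendsto (fun lam => ∫ x in Ioo a b, F lam x * G lam x) (𝓝[>] 0)
      (𝓝 (∫ x in Ioo a b, F 0 x * G 0 x)) := by
  obtain ⟨M, hM⟩ := hFb
  obtain ⟨M', hM'⟩ := hGb
  refine tendsto_integral_filter_of_dominated_convergence (fun _ => M * M') ?_ ?_
    (integrable_const _) (Eventually.of_forall fun x => (hFt x).mul (hGt x))
  · filter_upwards [self_mem_nhdsWithin] with lam hl
    exact ((hF lam (le_of_lt hl)).mul (hG lam (le_of_lt hl))).aestronglyMeasurable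
  · filter_upwards [Ioc_mem_nhdsGT (zero_lt_one' ℝ)] with lam hl
    filter_upwards [ae_restrict_mem measurableSet_Ioo] with x hx
    have h1 := hM lam ⟨hl.1.le, hl.2⟩ x hx
    have h2 := hM' lam ⟨hl.1.le, hl.2⟩ x hx
    rw [norm_mul]
    exact mul_le_mul h1 h2 (norm_nonneg _) ((abs_nonneg _).trans h1)

/-! ### Energy identities on the interval -/

/-- Parseval conjugates the multiplier of the right derivative, which is already a conjugate, so the
two factors combine to z^{2μ} rather than |z|^{2μ}. Passing from Ω to ℝ costs nothing, because
outside Ω one of the two derivatives vanishes. -/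
theorem setIntegral_lineDeriv_mul (h : IsTest a b φ) (hlam : 0 ≤ lam) (hμ0 : 0 < μ) (hμ1 : μ ≤ 1) :
    ∫ x in Ioo a b, lineDeriv μ lam φ x * lineDerivRight μ lam φ x = pairing μ lam φ := by
  have key : ∀ lam > 0, ∫ x in Ioo a b, lineDeriv μ lam φ x * lineDerivRight μ lam φ x =
      pairing μ lam φ := by
    intro lam hlam
    rw [setIntegral_eq_integral_of_forall_compl_eq_zero]
    · have hi : Integrable (lineDerivRight μ lam φ) :=
        (integrable_lineDeriv h.comp_neg hlam).comp_neg
      have hi' : Integrable (ft (lineDerivRight μ lam φ)) := by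
        refine (integrable_ft_lineDeriv h.comp_neg hlam hμ0 hμ1).comp_neg.congr
          (Eventually.of_forall fun ξ => ?_)
        exact (ft_comp_neg _ _).symm
      have hp := parseval (integrable_lineDeriv (μ := μ) h hlam)
        (continuous_lineDerivRight h hlam.le) hi hi'
      have hpt : ∀ ξ, ft (lineDeriv μ lam φ) ξ * conj (ft (lineDerivRight μ lam φ) ξ) =
          symbol lam ξ ^ ((2 * μ : ℝ) : ℂ) * ((‖ft φ ξ‖ ^ 2 : ℝ) : ℂ) := by
        intro ξ
        have : symbol lam ξ ^ ((2 * μ : ℝ) : ℂ) =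
            symbol lam ξ ^ (μ : ℂ) * symbol lam ξ ^ (μ : ℂ) := by
          rw [← Complex.cpow_add _ _ (symbol_ne_zero hlam ξ)]
          push_cast
          ring_nf
        rw [ft_lineDeriv h hlam hμ1, ft_lineDerivRight h hlam hμ1, this,
          ← Complex.normSq_eq_norm_sq, ← Complex.mul_conj, map_mul, Complex.conj_conj]
        ring
      simp only [hpt] at hp
      have hint : Integrable fun ξ =>
          symbol lam ξ ^ ((2 * μ : ℝ) : ℂ) * ((‖ft φ ξ‖ ^ 2 : ℝ) : ℂ) := by
        have hcont := continuous_ft h.integrable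
        refine (integrable_energy (lam := lam) h hμ0.le hμ1).mono
          ((measurable_symbol_cpow lam _).mul (by fun_prop)).aestronglyMeasurable
          (Eventually.of_forall fun ξ => ?_)
        rw [norm_mul, norm_mul, Complex.norm_real]
        refine mul_le_mul_of_nonneg_right ?_ (norm_nonneg _)
        exact (norm_symbol_cpow_le (by positivity) ξ).trans (le_abs_self _)
      have hre := congrArg Complex.re hp
      rw [Complex.ofReal_re] at hre
      rw [hre, pairing, ← RCLike.re_eq_complex_re, ← integral_re hint]
      simp only [RCLike.re_eq_complex_re, Complex.re_mul_ofReal]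
    · intro x hx
      by_cases hxa : x ≤ a
      · rw [lineDeriv_eq_zero h hxa, zero_mul]
      · rw [lineDerivRight_eq_zero h (not_lt.1 fun hxb => hx ⟨not_le.1 hxa, hxb⟩), mul_zero]
  rcases hlam.eq_or_lt with rfl | hlam
  · refine tendsto_nhds_unique (tendsto_setIntegral_mul
      (fun _ hl => continuous_lineDeriv h hl) (fun _ hl => continuous_lineDerivRight h hl)
      (exists_lineDeriv_bound h) (exists_lineDerivRight_bound h) (tendsto_lineDeriv_zero h)
      (tendsto_lineDerivRight_zero h)) ((tendsto_pairing h hμ0 hμ1).congr' ?_)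
    filter_upwards [self_mem_nhdsWithin] with lam hl
    exact (key lam hl).symm
  · exact key lam hlam

/-- Only an inequality: the left derivative of a test function generally has a tail to the right of
b, which Plancherel counts and the integral over Ω does not. -/
theorem setIntegral_lineDeriv_sq_le (h : IsTest a b φ) (hlam : 0 ≤ lam) (hμ0 : 0 < μ)
    (hμ1 : μ ≤ 1) : ∫ x in Ioo a b, lineDeriv μ lam φ x ^ 2 ≤ energy μ lam φ := by
  have key : ∀ lam > 0, ∫ x in Ioo a b, lineDeriv μ lam φ x ^ 2 ≤ energy μ lam φ := by
    intro lam hlam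
    have hc := continuous_lineDeriv (μ := μ) h hlam.le
    have hi := integrable_lineDeriv (μ := μ) h hlam
    have hi' := integrable_ft_lineDeriv h hlam hμ0 hμ1
    refine (setIntegral_le_integral (integrable_sq hc hi hi')
      (Eventually.of_forall fun x => sq_nonneg _)).trans (le_of_eq ?_)
    rw [integral_sq_eq hc hi hi']
    simp only [norm_ft_lineDeriv h hlam hμ1, energy]
  rcases hlam.eq_or_lt with rfl | hlam
  · have ht := tendsto_setIntegral_mul
      (fun _ hl => continuous_lineDeriv (μ := μ) h hl)
      (fun _ hl => continuous_lineDeriv (μ := μ) h hl)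
      (exists_lineDeriv_bound h) (exists_lineDeriv_bound h) (tendsto_lineDeriv_zero h)
      (tendsto_lineDeriv_zero h)
    simp only [← sq] at ht
    refine le_of_tendsto_of_tendsto ht (tendsto_energy h hμ0 hμ1) ?_
    filter_upwards [self_mem_nhdsWithin] with lam hl
    exact key lam hl
  · exact key lam hlam

theorem setIntegral_comp_neg (f : ℝ → ℝ) :
    ∫ x in Ioo a b, f (-x) = ∫ x in Ioo (-b) (-a), f x := by
  rw [← integral_indicator measurableSet_Ioo, ← integral_indicator measurableSet_Ioo,
    ← integral_neg_eq_self]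
  congr 1
  ext x
  have : -x ∈ Ioo a b ↔ x ∈ Ioo (-b) (-a) := by
    simp only [mem_Ioo]; constructor <;> rintro ⟨h1, h2⟩ <;> constructor <;> linarith
  by_cases hx : x ∈ Ioo (-b) (-a)
  · rw [indicator_of_mem hx, indicator_of_mem (this.2 hx), neg_neg]
  · rw [indicator_of_notMem hx, indicator_of_notMem (fun h => hx (this.1 h))]

theorem energy_comp_neg (μ lam : ℝ) (φ : ℝ → ℝ) :
    energy μ lam (fun x => φ (-x)) = energy μ lam φ := by
  rw [energy, energy, ← integral_neg_eq_self]
  congr 1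
  ext ξ
  have h2 : symbol lam (-ξ) = conj (symbol lam ξ) := by
    apply Complex.ext <;> simp [symbol_re, symbol_im]
  rw [ft_comp_neg, neg_neg, h2, Complex.norm_conj]

theorem setIntegral_lineDerivRight_sq_le (h : IsTest a b φ) (hlam : 0 ≤ lam) (hμ0 : 0 < μ)
    (hμ1 : μ ≤ 1) : ∫ x in Ioo a b, lineDerivRight μ lam φ x ^ 2 ≤ energy μ lam φ := by
  have := setIntegral_lineDeriv_sq_le h.comp_neg hlam hμ0 hμ1
  rw [energy_comp_neg] at this
  refine le_of_eq_of_le ?_ this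
  exact setIntegral_comp_neg (fun x => lineDeriv μ lam (fun x => φ (-x)) x ^ 2)

/-! ### Coercivity -/

theorem integral_sq_eq_energy (h : IsTest a b φ) : ∫ x, φ x ^ 2 = ∫ ξ, ‖ft φ ξ‖ ^ 2 := by
  refine integral_sq_eq h.continuous h.integrable ?_
  refine (integrable_weight_mul_norm_ft h 1).mono
    (continuous_ft h.integrable).aestronglyMeasurable (Eventually.of_forall fun ξ => ?_)
  rw [Real.norm_of_nonneg (by positivity)]
  nlinarith [norm_nonneg (ft φ ξ), sq_nonneg (2 * Real.pi * ξ)]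

theorem integrable_norm_ft_sq (h : IsTest a b φ) : Integrable fun ξ => ‖ft φ ξ‖ ^ 2 := by
  have hcont := continuous_ft h.integrable
  refine (integrable_weight_mul_norm_ft_sq h (C := 1) zero_le_one).mono
    (Continuous.aestronglyMeasurable (by fun_prop)) (Eventually.of_forall fun ξ => ?_)
  rw [Real.norm_of_nonneg (by positivity), Real.norm_of_nonneg (by positivity)]
  nlinarith [sq_nonneg ‖ft φ ξ‖, sq_nonneg (2 * Real.pi * ξ)]

theorem energy_le_pairing_of_lt_half (h : IsTest a b φ) (hμ0 : 0 < μ) (hμ : μ < 1 / 2)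
    (hlam : 0 ≤ lam) : Real.cos (Real.pi * μ) * energy μ lam φ ≤ pairing μ lam φ := by
  rw [energy, ← integral_const_mul]
  refine integral_mono ((integrable_energy h hμ0.le (by linarith)).const_mul _)
    (integrable_pairing h hμ0 (by linarith)) fun ξ => ?_
  have := re_cpow_ge_of_lt_half hμ0 hμ (z := symbol lam ξ) (by rwa [symbol_re])
  simp only
  rw [← mul_assoc]
  exact mul_le_mul_of_nonneg_right this (by positivity)

/-- The symbol has real part λ at every frequency, so the term (Re z)^{2μ} of the pointwise bound
integrates to λ^{2μ} times the squared L² norm. -/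
theorem exists_energy_le_pairing {c₀ : ℝ} (hμ0 : 1 / 2 < μ) (hμ1 : μ ≤ 1) (hc₀ : 0 < c₀) :
    ∃ c : ℝ, 0 < c ∧ ∀ lam, 0 ≤ lam → ∀ φ, IsTest a b φ →
      c * energy μ lam φ ≤ (1 + c₀) * lam ^ (2 * μ) * (∫ x, φ x ^ 2) - pairing μ lam φ := by
  obtain ⟨c, hc, hz⟩ := exists_symbol_lower_bound hμ0 hμ1 hc₀
  refine ⟨c, hc, fun lam hlam φ h => ?_⟩
  have hi := (integrable_norm_ft_sq h).const_mul ((1 + c₀) * lam ^ (2 * μ))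
  have hp := integrable_pairing (lam := lam) (μ := μ) h (by linarith) hμ1
  rw [integral_sq_eq_energy h, energy, pairing, ← integral_const_mul, ← integral_const_mul,
    ← integral_sub hi hp]
  refine integral_mono ((integrable_energy h (by linarith) hμ1).const_mul _) (hi.sub hp) fun ξ => ?_
  have := hz (symbol lam ξ) (by rwa [symbol_re])
  rw [symbol_re] at this
  have h2 := mul_le_mul_of_nonneg_right this (sq_nonneg ‖ft φ ξ‖)
  simp only
  linarith

theorem integral_sq_eq_setIntegral (h : IsTest a b φ) :
    ∫ x, φ x ^ 2 = ∫ x in Ioo a b, φ x ^ 2 :=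
  (setIntegral_eq_integral_of_forall_compl_eq_zero fun x hx => by rw [h.eq_zero hx]; simp).symm

/-- The Poincaré inequality for test functions. -/
theorem exists_poincare (hab : a < b) (hμ0 : 0 < μ) (hμ1 : μ ≤ 1) :
    ∃ C : ℝ, 0 < C ∧ ∀ φ, IsTest a b φ → ∫ x, φ x ^ 2 ≤ C * energy μ 0 φ := by
  have hba : 0 < b - a := sub_pos.2 hab
  -- The frequency is cut at r. Below it |φ̂|² ≤ ‖φ‖₁² ≤ (b - a)‖φ‖₂² contributes at most 2r(b - a)
  -- = 1/2 of the squared L² norm, which is absorbed. Above it the weight is at least (2πr)^{2μ}.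
  set r : ℝ := 1 / (4 * (b - a)) with hr
  have hr0 : 0 < r := by positivity
  have hR : 0 < (2 * Real.pi * r) ^ (2 * μ) := by positivity
  refine ⟨2 * ((2 * Real.pi * r) ^ (2 * μ))⁻¹, by positivity, fun φ h => ?_⟩
  set I := ∫ x, φ x ^ 2 with hI
  have hcs : (∫ x, |φ x|) ^ 2 ≤ (b - a) * I := by
    have e1 : ∫ x, |φ x| = ∫ x in Ioo a b, |φ x| :=
      (setIntegral_eq_integral_of_forall_compl_eq_zero fun x hx => by
        rw [h.eq_zero hx, abs_zero]).symm
    rw [e1, hI, integral_sq_eq_setIntegral h]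
    set m := ∫ x in Ioo a b, |φ x|
    have hi1 : IntegrableOn (fun x => |φ x|) (Ioo a b) := h.integrable.abs.integrableOn
    have hi2 : IntegrableOn (fun x => φ x ^ 2) (Ioo a b) :=
      (((h.continuous.pow 2).integrable_of_hasCompactSupport
        (by simpa [sq] using h.hasCompactSupport.mul_left (f := φ)))).integrableOn
    have hvol : volume.real (Ioo a b) = b - a := by simp [Measure.real, hba.le]
    -- Cauchy–Schwarz against the constant 1, as nonnegativity of the variance of |φ| on Ω.
    have h0 : 0 ≤ ∫ x in Ioo a b, (|φ x| - m / (b - a)) ^ 2 :=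
      integral_nonneg fun _ => sq_nonneg _
    have h1 : ∫ x in Ioo a b, (|φ x| - m / (b - a)) ^ 2 =
        (∫ x in Ioo a b, φ x ^ 2) - 2 * (m / (b - a)) * m + (b - a) * (m / (b - a)) ^ 2 := by
      have : ∀ x, (|φ x| - m / (b - a)) ^ 2 =
          φ x ^ 2 - 2 * (m / (b - a)) * |φ x| + (m / (b - a)) ^ 2 := fun x => by
        rw [sub_sq, sq_abs]; ring
      simp only [this]
      have hi3 : IntegrableOn (fun x => 2 * (m / (b - a)) * |φ x|) (Ioo a b) := hi1.const_mul _
      have hi4 : IntegrableOn (fun x => φ x ^ 2 - 2 * (m / (b - a)) * |φ x|) (Ioo a b) :=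
        hi2.sub hi3
      rw [integral_add hi4 (integrable_const _), integral_sub hi2 hi3, integral_const_mul, integral_const,
        measureReal_restrict_apply_univ, hvol, smul_eq_mul]
    rw [h1] at h0
    have h2 : (b - a) * ((∫ x in Ioo a b, φ x ^ 2) - 2 * (m / (b - a)) * m +
        (b - a) * (m / (b - a)) ^ 2) = (b - a) * (∫ x in Ioo a b, φ x ^ 2) - m ^ 2 := by
      field_simp
      ring
    nlinarith [mul_nonneg hba.le h0]
  have hsplit : I ≤ (∫ ξ in Ioo (-r) r, ‖ft φ ξ‖ ^ 2) +
      ((2 * Real.pi * r) ^ (2 * μ))⁻¹ * energy μ 0 φ := by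
    rw [hI, integral_sq_eq_energy h, energy, ← integral_const_mul,
      ← integral_indicator measurableSet_Ioo, ← integral_add
        ((integrable_norm_ft_sq h).indicator measurableSet_Ioo)
        ((integrable_energy h hμ0.le hμ1).const_mul _)]
    refine integral_mono (integrable_norm_ft_sq h)
      (((integrable_norm_ft_sq h).indicator measurableSet_Ioo).add
        ((integrable_energy h hμ0.le hμ1).const_mul _)) fun ξ => ?_
    simp only
    by_cases hξ : ξ ∈ Ioo (-r) r
    · rw [indicator_of_mem hξ]
      have : 0 ≤ ((2 * Real.pi * r) ^ (2 * μ))⁻¹ * (‖symbol 0 ξ‖ ^ (2 * μ) * ‖ft φ ξ‖ ^ 2) := by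
        positivity
      linarith
    · rw [indicator_of_notMem hξ, zero_add, ← mul_assoc]
      refine le_mul_of_one_le_left (by positivity) ?_
      rw [inv_mul_eq_div, one_le_div hR]
      refine Real.rpow_le_rpow (by positivity) ?_ (by positivity)
      have hξ' : r ≤ |ξ| := by
        by_contra hlt
        exact hξ (abs_lt.1 (not_le.1 hlt))
      have : ‖symbol 0 ξ‖ = 2 * Real.pi * |ξ| := by
        simp [symbol, abs_of_pos Real.pi_pos]
      rw [this]
      gcongr
  have hlow : ∫ ξ in Ioo (-r) r, ‖ft φ ξ‖ ^ 2 ≤ I / 2 := by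
    have h1 : ∫ ξ in Ioo (-r) r, ‖ft φ ξ‖ ^ 2 ≤ ∫ ξ in Ioo (-r) r, (b - a) * I := by
      refine setIntegral_mono (integrable_norm_ft_sq h).integrableOn
        (integrable_const _) fun ξ => ?_
      exact (pow_le_pow_left₀ (norm_nonneg _) (norm_ft_le φ ξ) 2).trans hcs
    rw [setIntegral_const, smul_eq_mul] at h1
    have h2 : volume.real (Ioo (-r) r) = 2 * r := by
      simp [Measure.real, hr0.le]; ring
    rw [h2, hr] at h1
    refine h1.trans (le_of_eq ?_)
    field_simp
    norm_num
  linarith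

end

/-! ### Square functions as lower integrals -/

theorem lintegral_enorm_sq {α E : Type*} [MeasurableSpace α] [NormedAddCommGroup E]
    (f : α → E) (ν : Measure α) : ∫⁻ x, ‖f x‖ₑ ^ 2 ∂ν = eLpNorm f 2 ν ^ 2 := by
  have := eLpNorm_nnreal_pow_eq_lintegral (f := f) (μ := ν) (p := 2) two_ne_zero
  simp only [NNReal.coe_ofNat, ENNReal.rpow_ofNat, ENNReal.coe_ofNat] at this
  exact this.symm

theorem Lp_enorm_sq {α E : Type*} [MeasurableSpace α] [NormedAddCommGroup E] {ν : Measure α}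
    (f : Lp E 2 ν) : ‖f‖ₑ ^ 2 = ∫⁻ x, ‖f x‖ₑ ^ 2 ∂ν := by
  rw [lintegral_enorm_sq, Lp.enorm_def]

theorem lintegral_comp_mul_left (G : ℝ → ℝ≥0∞) {c : ℝ} (hc : c ≠ 0) :
    ENNReal.ofReal |c| * ∫⁻ x, G (c * x) = ∫⁻ x, G x := by
  have h1 := lintegral_map_equiv (μ := volume) G (Homeomorph.mulLeft₀ c hc).toMeasurableEquiv
  have h2 : ENNReal.ofReal |c| • Measure.map (c * ·) volume = volume :=
    Real.smul_map_volume_mul_left hc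
  conv_rhs => rw [← h2, lintegral_smul_measure, smul_eq_mul]
  congr 1
  exact h1.symm

/-! ### Translations and the Fourier transform on `L²` -/

theorem measurePreserving_sub_const (h : ℝ) : MeasurePreserving (fun x : ℝ => x - h) volume volume :=
  measurePreserving_sub_right volume h

/-- Translation by `h` on `L²(ℝ)`. -/
def translate (h : ℝ) (F : Lp ℂ 2 (volume : Measure ℝ)) : Lp ℂ 2 (volume : Measure ℝ) :=
  Lp.compMeasurePreserving (fun x => x - h) (measurePreserving_sub_const h) F

/-- The modulation `e^{-2πihξ}`. -/
def modulation (h ξ : ℝ) : ℂ := Complex.exp (((-2 * Real.pi * h * ξ : ℝ) : ℂ) * Complex.I)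

theorem norm_modulation (h ξ : ℝ) : ‖modulation h ξ‖ = 1 := Complex.norm_exp_ofReal_mul_I _

theorem continuous_modulation (h : ℝ) : Continuous (modulation h) := by
  unfold modulation; fun_prop

theorem memLp_modulation (h : ℝ) : MemLp (modulation h) ∞ (volume : Measure ℝ) :=
  memLp_top_of_bound (continuous_modulation h).aestronglyMeasurable 1
    (Eventually.of_forall fun ξ => (norm_modulation h ξ).le)

/-- Multiplication by the modulation on `L²(ℝ)`. -/
def modulateCLM (h : ℝ) : Lp ℂ 2 (volume : Measure ℝ) →L[ℂ] Lp ℂ 2 (volume : Measure ℝ) :=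
  (ContinuousLinearMap.mul ℂ ℂ).holderL volume ∞ 2 2 (memLp_modulation h).toLp

theorem coeFn_modulateCLM (h : ℝ) (F : Lp ℂ 2 (volume : Measure ℝ)) :
    modulateCLM h F =ᵐ[volume] fun ξ => modulation h ξ * F ξ := by
  have h1 := (ContinuousLinearMap.mul ℂ ℂ).coeFn_holder (r := 2) (memLp_modulation h).toLp F
  filter_upwards [h1, (memLp_modulation h).coeFn_toLp] with ξ h2 h3
  rw [h3] at h2
  exact h2

theorem fourier_comp_sub (h : ℝ) (g : ℝ → ℂ) (ξ : ℝ) :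
    𝓕 (fun x => g (x - h)) ξ = modulation h ξ * 𝓕 g ξ := by
  simp only [Real.fourier_real_eq_integral_exp_smul]
  rw [← integral_add_right_eq_self _ h, ← integral_const_mul]
  congr 1
  ext x
  simp only [add_sub_cancel_right, smul_eq_mul, modulation]
  rw [← mul_assoc, ← Complex.exp_add]
  congr 2
  push_cast
  ring

/-- Both sides are continuous in F, so it is enough to check the identity on the dense subspace of
Schwartz functions. -/
theorem fourier_translate (h : ℝ) (F : Lp ℂ 2 (volume : Measure ℝ)) :
    𝓕 (translate h F) = modulateCLM h (𝓕 F) := by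
  have hcont : Continuous (translate h) :=
    (Lp.isometry_compMeasurePreserving (measurePreserving_sub_const h)).continuous
  have hF : Continuous fun F : Lp ℂ 2 (volume : Measure ℝ) => 𝓕 F :=
    FourierTransform.continuous_fourier
  refine congrFun (DenseRange.equalizer (f := SchwartzMap.toLpCLM ℝ ℂ 2 (volume : Measure ℝ))
    (SchwartzMap.denseRange_toLpCLM ENNReal.ofNat_ne_top) (hF.comp hcont)
    ((modulateCLM h).continuous.comp hF) ?_) F
  ext1 S
  simp only [Function.comp_apply, SchwartzMap.toLpCLM_apply]
  have h1 : translate h (S.toLp 2) = (SchwartzMap.compSubConstCLM ℝ h S).toLp 2 := by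
    apply Lp.ext
    have e1 := Lp.coeFn_compMeasurePreserving (S.toLp 2 volume) (measurePreserving_sub_const h)
    have e2 := (measurePreserving_sub_const h).quasiMeasurePreserving.ae_eq_comp
      (S.coeFn_toLp 2 volume)
    have e3 := (SchwartzMap.compSubConstCLM ℝ h S).coeFn_toLp 2 volume
    refine e1.trans (e2.trans ?_)
    filter_upwards [e3] with x hx
    rw [hx]
    rfl
  rw [h1, SchwartzMap.toLp_fourier_eq, SchwartzMap.toLp_fourier_eq]
  apply Lp.ext
  have e1 := (𝓕 (SchwartzMap.compSubConstCLM ℝ h S)).coeFn_toLp 2 volume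
  have e2 := coeFn_modulateCLM h ((𝓕 S).toLp 2)
  have e3 := (𝓕 S).coeFn_toLp 2 volume
  filter_upwards [e1, e2, e3] with ξ h1 h2 h3
  rw [h1, h2, h3]
  exact fourier_comp_sub h S ξ

/-- The complexification of a real `L²` function. -/
def complexify (f : Lp ℝ 2 (volume : Measure ℝ)) : Lp ℂ 2 (volume : Measure ℝ) :=
  Complex.ofRealCLM.compLp f

theorem coeFn_complexify (f : Lp ℝ 2 (volume : Measure ℝ)) :
    complexify f =ᵐ[volume] fun x => (f x : ℂ) :=
  ContinuousLinearMap.coeFn_compLp _ f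

/-- Plancherel for a difference of translates. It serves both the Gagliardo seminorm (μ < 1) and the
difference quotients (μ = 1). -/
theorem lintegral_translate_sub (f : Lp ℝ 2 (volume : Measure ℝ)) (h : ℝ) :
    ∫⁻ x, ‖f (x - h) - f x‖ₑ ^ 2 =
      ∫⁻ ξ, ‖modulation h ξ - 1‖ₑ ^ 2 * ‖(𝓕 (complexify f) : Lp ℂ 2 (volume : Measure ℝ)) ξ‖ₑ ^ 2 := by
  set F := complexify f
  have h1 : ∫⁻ x, ‖f (x - h) - f x‖ₑ ^ 2 = ‖translate h F - F‖ₑ ^ 2 := by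
    rw [Lp_enorm_sq]
    refine lintegral_congr_ae ?_
    have e1 := Lp.coeFn_compMeasurePreserving F (measurePreserving_sub_const h)
    have e2 := (measurePreserving_sub_const h).quasiMeasurePreserving.ae_eq_comp
      (coeFn_complexify f)
    filter_upwards [e1.trans e2, coeFn_complexify f, Lp.coeFn_sub (translate h F) F]
      with x hx hx2 hx3
    have hx4 : translate h F x = (f (x - h) : ℂ) := hx
    rw [hx3, Pi.sub_apply, hx4, hx2, ← Complex.ofReal_sub, ← ofReal_norm, ← ofReal_norm,
      Complex.norm_real]
  have h2 : ‖translate h F - F‖ₑ = ‖modulateCLM h (𝓕 F) - 𝓕 F‖ₑ := by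
    rw [← fourier_translate, sub_eq_add_neg, sub_eq_add_neg,
      ← FourierTransform.fourier_neg, ← FourierTransform.fourier_add, ← ofReal_norm, ← ofReal_norm,
      Lp.norm_fourier_eq]
  rw [h1, h2, Lp_enorm_sq]
  refine lintegral_congr_ae ?_
  filter_upwards [coeFn_modulateCLM h (𝓕 F), Lp.coeFn_sub (modulateCLM h (𝓕 F)) (𝓕 F)]
    with ξ h3 h4
  rw [h4, Pi.sub_apply, h3, ← mul_pow, ← enorm_mul, sub_mul, one_mul]

/-- The seminorm of `H^μ(ℝ)` in terms of Mathlib's frequency. -/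
theorem lineSeminormSq_eq (μ : ℝ) (f : Lp ℝ 2 (volume : Measure ℝ)) :
    lineSeminormSq μ f = ENNReal.ofReal (2 * Real.pi) * ∫⁻ ξ : ℝ,
      ENNReal.ofReal (|2 * Real.pi * ξ| ^ (2 * μ)) *
        ‖(𝓕 (complexify f) : Lp ℂ 2 (volume : Measure ℝ)) ξ‖ₑ ^ 2 := by
  have hpi := Real.pi_pos
  have h0 : (2 * Real.pi) ≠ 0 := by positivity
  rw [lineSeminormSq, ← lintegral_comp_mul_left _ h0, abs_of_pos (by positivity)]
  congr 1
  refine lintegral_congr fun ξ => ?_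
  rw [angularFourier, mul_div_cancel_left₀ _ h0, ENNReal.ofReal_mul (by positivity),
    ENNReal.ofReal_pow (norm_nonneg _), ofReal_norm]
  rfl

/-! ### The Gagliardo seminorm -/

/-- The Gagliardo kernel `|h|^{-1-2μ}`. -/
def gagKernel (μ h : ℝ) : ℝ≥0∞ := ENNReal.ofReal (|h| ^ (-(1 + 2 * μ)))

theorem measurable_gagKernel (μ : ℝ) : Measurable (gagKernel μ) := by
  unfold gagKernel; fun_prop

theorem gagKernel_ne_top (μ h : ℝ) : gagKernel μ h ≠ ∞ := ENNReal.ofReal_ne_top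

theorem gagKernel_neg (μ h : ℝ) : gagKernel μ (-h) = gagKernel μ h := by simp [gagKernel]

/-- `∬ |f(x) - f(y)|² / |x - y|^{1+2μ}` over `S × S`. -/
def gagliardo (μ : ℝ) (S : Set ℝ) (f : ℝ → ℝ) : ℝ≥0∞ :=
  ∫⁻ x in S, ∫⁻ y in S, ‖f y - f x‖ₑ ^ 2 * gagKernel μ (x - y)

/-- The constant relating the Gagliardo and the Fourier seminorms. -/
def gagConst (μ : ℝ) : ℝ≥0∞ :=
  ∫⁻ s : ℝ, ‖Complex.exp ((s : ℂ) * Complex.I) - 1‖ₑ ^ 2 * gagKernel μ s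

/-- The substitution s = -2πξh extracts |2πξ|^{2μ} from the homogeneous kernel and leaves an
integral independent of ξ. -/
theorem lintegral_modulation_sub_one (μ : ℝ) {ξ : ℝ} (hξ : ξ ≠ 0) :
    ∫⁻ h, ‖modulation h ξ - 1‖ₑ ^ 2 * gagKernel μ h =
      gagConst μ * ENNReal.ofReal (|2 * Real.pi * ξ| ^ (2 * μ)) := by
  have hpi := Real.pi_pos
  have hc : (-2 * Real.pi * ξ) ≠ 0 := mul_ne_zero (by simp [hpi.ne']) hξ
  have habs : |-2 * Real.pi * ξ| = |2 * Real.pi * ξ| := by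
    rw [show -2 * Real.pi * ξ = -(2 * Real.pi * ξ) by ring, abs_neg]
  have hpos : 0 < |2 * Real.pi * ξ| := by rw [← habs]; exact abs_pos.2 hc
  have h1 := lintegral_comp_mul_left
    (fun s : ℝ => ‖Complex.exp ((s : ℂ) * Complex.I) - 1‖ₑ ^ 2 * gagKernel μ s) hc
  rw [gagConst, ← h1, habs, mul_right_comm, ← ENNReal.ofReal_mul hpos.le,
    ← lintegral_const_mul' _ _ ENNReal.ofReal_ne_top]
  refine lintegral_congr fun h => ?_
  rw [mul_left_comm]
  congr 1
  · rw [modulation]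
    congr 4
    push_cast
    ring
  · rw [gagKernel, gagKernel, abs_mul (-2 * Real.pi * ξ) h, habs]
    set r := |2 * Real.pi * ξ|
    rw [← ENNReal.ofReal_mul (by positivity),
      Real.mul_rpow hpos.le (abs_nonneg _), ← mul_assoc, mul_assoc r,
      ← Real.rpow_add hpos, mul_comm r, ← Real.rpow_add_one hpos.ne']
    rw [show 2 * μ + -(1 + 2 * μ) + 1 = 0 by ring, Real.rpow_zero, one_mul]

/-- Write y = x - h, apply Plancherel in x for each fixed h, and integrate in h first by Tonelli.
The identity holds in [0, ∞] without assuming either side finite. -/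
theorem gagliardo_univ_eq (μ : ℝ) (f : Lp ℝ 2 (volume : Measure ℝ)) :
    gagliardo μ univ f = gagConst μ * ∫⁻ ξ : ℝ,
      ENNReal.ofReal (|2 * Real.pi * ξ| ^ (2 * μ)) *
        ‖(𝓕 (complexify f) : Lp ℂ 2 (volume : Measure ℝ)) ξ‖ₑ ^ 2 := by
  have hf : Measurable f := (Lp.stronglyMeasurable f).measurable
  have hF : Measurable (𝓕 (complexify f) : Lp ℂ 2 (volume : Measure ℝ)) :=
    (Lp.stronglyMeasurable _).measurable
  have hk := measurable_gagKernel μ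
  have hm : Measurable fun p : ℝ × ℝ => modulation p.1 p.2 :=
    (by unfold modulation; fun_prop : Continuous fun p : ℝ × ℝ => modulation p.1 p.2).measurable
  have h1 : gagliardo μ univ f = ∫⁻ x, ∫⁻ h, ‖f (x - h) - f x‖ₑ ^ 2 * gagKernel μ h := by
    simp only [gagliardo, Measure.restrict_univ]
    refine lintegral_congr fun x => ?_
    rw [← lintegral_sub_left_eq_self _ x]
    simp
  rw [h1, lintegral_lintegral_swap (by fun_prop)]
  have h2 : ∀ h, ∫⁻ x, ‖f (x - h) - f x‖ₑ ^ 2 * gagKernel μ h =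
      ∫⁻ ξ, (‖modulation h ξ - 1‖ₑ ^ 2 *
        ‖(𝓕 (complexify f) : Lp ℂ 2 (volume : Measure ℝ)) ξ‖ₑ ^ 2) * gagKernel μ h := by
    intro h
    rw [lintegral_mul_const' _ _ (gagKernel_ne_top μ h),
      lintegral_mul_const' _ _ (gagKernel_ne_top μ h), lintegral_translate_sub]
  simp only [h2]
  rw [lintegral_lintegral_swap (by fun_prop), ← lintegral_const_mul _ (by fun_prop)]
  have h0 : ∀ᵐ ξ : ℝ, ξ ≠ 0 := by simp [ae_iff]
  refine lintegral_congr_ae ?_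
  filter_upwards [h0] with ξ hξ
  rw [← mul_assoc, ← lintegral_modulation_sub_one μ hξ, ← lintegral_mul_const _ ?_]
  · refine lintegral_congr fun h => ?_
    ring
  · have : Measurable fun h => modulation h ξ :=
      (by unfold modulation; fun_prop : Continuous fun h => modulation h ξ).measurable
    fun_prop

/-- On (1, 2) the integrand is positive, since sin s > 0 there. -/
theorem gagConst_ne_zero (μ : ℝ) : gagConst μ ≠ 0 := by
  have hk := measurable_gagKernel μ
  rw [gagConst, ne_eq, lintegral_eq_zero_iff (by fun_prop)]
  intro h
  have h1 : ∀ᵐ s : ℝ, s ∉ Ioo (1 : ℝ) 2 := by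
    filter_upwards [h] with s hs hmem
    have h2 : Complex.exp ((s : ℂ) * Complex.I) - 1 ≠ 0 := by
      intro h3
      have h4 := congrArg Complex.im h3
      simp only [Complex.sub_im, Complex.exp_ofReal_mul_I_im, Complex.one_im, Complex.zero_im,
        sub_zero] at h4
      exact (Real.sin_pos_of_pos_of_lt_pi (by linarith [hmem.1])
        (by linarith [hmem.2, Real.pi_gt_three])).ne' h4
    have h3 : gagKernel μ s ≠ 0 := by
      rw [gagKernel, ne_eq, ENNReal.ofReal_eq_zero, not_le]
      have : 0 < |s| := abs_pos.2 (by linarith [hmem.1])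
      positivity
    have h4 : ‖Complex.exp ((s : ℂ) * Complex.I) - 1‖ₑ ^ 2 ≠ 0 :=
      pow_ne_zero _ (enorm_ne_zero.2 h2)
    exact mul_ne_zero h4 h3 hs
  rw [← measure_eq_zero_iff_ae_notMem, Real.volume_Ioo] at h1
  norm_num at h1

/-- Near 0 the bound |e^{is} - 1| ≤ |s| leaves s^{1-2μ}, integrable because μ < 1. At infinity
|e^{is} - 1| ≤ 2 leaves 4s^{-1-2μ}, integrable because μ > 0. At μ = 1 the integral diverges, which
is why that case is handled separately. -/
theorem gagConst_ne_top {μ : ℝ} (h0 : 0 < μ) (h1 : μ < 1) : gagConst μ ≠ ∞ := by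
  set g : ℝ → ℝ≥0∞ := fun s => if s < 1 then ENNReal.ofReal (|s| ^ (1 - 2 * μ))
    else 4 * gagKernel μ s with hg
  have hsymm : gagConst μ ≤ 2 * ∫⁻ s in Ioi (0 : ℝ), g s := by
    have hle : ∀ s : ℝ, 0 < s →
        ‖Complex.exp ((s : ℂ) * Complex.I) - 1‖ₑ ^ 2 * gagKernel μ s ≤ g s := by
      intro s hs
      rw [hg]
      dsimp only
      split_ifs with hs1
      · have h2 : ‖Complex.exp ((s : ℂ) * Complex.I) - 1‖ ≤ s := by
          have := Real.norm_exp_I_mul_ofReal_sub_one_le (x := s)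
          rw [mul_comm, Real.norm_of_nonneg hs.le] at this
          exact this
        rw [← ofReal_norm, ← ENNReal.ofReal_pow (norm_nonneg _), gagKernel,
          ← ENNReal.ofReal_mul (by positivity)]
        refine ENNReal.ofReal_le_ofReal ?_
        have h3 : |s| ^ (1 - 2 * μ) = s ^ 2 * |s| ^ (-(1 + 2 * μ)) := by
          rw [abs_of_pos hs, ← Real.rpow_natCast, ← Real.rpow_add hs]
          congr 1
          push_cast
          ring
        rw [h3]
        gcongr
      · have h2 : ‖Complex.exp ((s : ℂ) * Complex.I) - 1‖ ≤ 2 := by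
          refine (norm_sub_le _ _).trans ?_
          rw [Complex.norm_exp_ofReal_mul_I, norm_one]
          norm_num
        gcongr
        rw [← ofReal_norm, ← ENNReal.ofReal_pow (norm_nonneg _)]
        have : (4 : ℝ≥0∞) = ENNReal.ofReal 4 := by norm_num
        rw [this]
        refine ENNReal.ofReal_le_ofReal ((pow_le_pow_left₀ (norm_nonneg _) h2 2).trans ?_)
        norm_num
    have hcompl : (Ioi (0 : ℝ))ᶜ = Iic 0 := compl_Ioi
    rw [gagConst, ← lintegral_add_compl _ (measurableSet_Ioi (a := (0 : ℝ))), two_mul]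
    refine add_le_add (setLIntegral_mono' measurableSet_Ioi fun s hs => hle s hs) ?_
    rw [hcompl, setLIntegral_congr (Iio_ae_eq_Iic (a := (0 : ℝ))).symm,
      ← lintegral_indicator measurableSet_Iio, ← lintegral_indicator measurableSet_Ioi,
      ← lintegral_neg_eq_self]
    refine lintegral_mono fun s => ?_
    by_cases hs : 0 < s
    · rw [indicator_of_mem (by simpa using hs), indicator_of_mem (by simpa using hs)]
      refine le_trans (le_of_eq ?_) (hle s hs)
      rw [gagKernel_neg, ← ofReal_norm, ← ofReal_norm]
      congr 3
      rw [← Complex.norm_conj]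
      simp [← Complex.exp_conj]
    · rw [indicator_of_notMem (by simpa using hs)]
      exact zero_le
  refine ne_top_of_le_ne_top (ENNReal.mul_ne_top (by norm_num) ?_) hsymm
  have hun : Ioi (0 : ℝ) = Ioo 0 1 ∪ Ici 1 := by
    rw [Ioo_union_Ici_eq_Ioi zero_lt_one]
  have hi1 : ∫⁻ s in Ioo (0 : ℝ) 1, g s ≠ ∞ := by
    have e : ∫⁻ s in Ioo (0 : ℝ) 1, g s = ∫⁻ s in Ioo (0 : ℝ) 1, ENNReal.ofReal (s ^ (1 - 2 * μ)) :=
      setLIntegral_congr_fun measurableSet_Ioo fun s hs => by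
        simp only [hg, hs.2, if_true, abs_of_pos hs.1]
    rw [e]
    exact ((intervalIntegral.integrableOn_Ioo_rpow_iff zero_lt_one).2
      (by linarith)).lintegral_lt_top.ne
  have hi2 : ∫⁻ s in Ici (1 : ℝ), g s ≠ ∞ := by
    have e : ∫⁻ s in Ici (1 : ℝ), g s =
        ∫⁻ s in Ici (1 : ℝ), 4 * ENNReal.ofReal (s ^ (-(1 + 2 * μ))) :=
      setLIntegral_congr_fun measurableSet_Ici fun s hs => by
        have hs1 : (1 : ℝ) ≤ s := hs
        simp only [hg, not_lt.2 hs1, if_false, gagKernel, abs_of_nonneg (zero_le_one.trans hs1)]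
    rw [e, lintegral_const_mul' _ _ (by norm_num), setLIntegral_congr Ioi_ae_eq_Ici.symm]
    exact ENNReal.mul_ne_top (by norm_num)
      (integrableOn_Ioi_rpow_of_lt (by linarith) zero_lt_one).lintegral_lt_top.ne
  rw [hun]
  exact ne_top_of_le_ne_top (ENNReal.add_ne_top.2 ⟨hi1, hi2⟩) (lintegral_union_le _ _ _)

/-! ### A fractional Hardy inequality -/

theorem enorm_sq_le {ε : ℝ} (hε : 0 < ε) (x y : ℝ) :
    ‖x‖ₑ ^ 2 ≤ ENNReal.ofReal (1 + ε) * ‖y‖ₑ ^ 2 + ENNReal.ofReal (1 + ε⁻¹) * ‖x - y‖ₑ ^ 2 := by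
  simp only [Real.enorm_eq_ofReal_abs, ← ENNReal.ofReal_pow (abs_nonneg _), sq_abs]
  rw [← ENNReal.ofReal_mul (by positivity), ← ENNReal.ofReal_mul (by positivity),
    ← ENNReal.ofReal_add (by positivity) (by positivity)]
  refine ENNReal.ofReal_le_ofReal ?_
  have h1 : 0 ≤ ε * (y - ε⁻¹ * (x - y)) ^ 2 := by positivity
  have h2 : ε * (y - ε⁻¹ * (x - y)) ^ 2 = ε * y ^ 2 - 2 * y * (x - y) + ε⁻¹ * (x - y) ^ 2 := by
    field_simp
    ring
  nlinarith

/-- Absorption. Finiteness of `W` is essential, since `W = ∞` satisfies the last hypothesis for p >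
0. -/
theorem le_of_le_mul_self_add {W X : ℝ≥0∞} {p : ℝ} (hW : W ≠ ∞) (hp0 : 0 ≤ p) (hp : p < 1)
    (h : W ≤ ENNReal.ofReal p * W + X) : W ≤ ENNReal.ofReal (1 - p)⁻¹ * X := by
  have h1p : 0 < 1 - p := by linarith
  rcases eq_or_ne X ∞ with rfl | hX
  · rw [ENNReal.mul_top (by simpa using h1p)]
    exact le_top
  lift W to NNReal using hW
  lift X to NNReal using hX
  rw [← ENNReal.ofReal_coe_nnreal, ← ENNReal.ofReal_coe_nnreal, ← ENNReal.ofReal_mul hp0,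
    ← ENNReal.ofReal_add (by positivity) (by positivity),
    ENNReal.ofReal_le_ofReal_iff (by positivity)] at h
  rw [← ENNReal.ofReal_coe_nnreal, ← ENNReal.ofReal_coe_nnreal, ← ENNReal.ofReal_mul (by positivity)]
  refine ENNReal.ofReal_le_ofReal ?_
  rw [inv_mul_eq_div, le_div_iff₀ h1p]
  linarith

/-- The Hardy weight. -/
def hardyWeight (μ s : ℝ) : ℝ≥0∞ := ENNReal.ofReal (s ^ (-(2 * μ)))

theorem measurable_hardyWeight (μ : ℝ) : Measurable (hardyWeight μ) := by
  unfold hardyWeight; fun_prop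

/-- `∫₀ᴸ |g|² s^{-2μ} ds`. -/
def hardy (μ L : ℝ) (g : ℝ → ℝ) : ℝ≥0∞ := ∫⁻ s in Ioo 0 L, hardyWeight μ s * ‖g s‖ₑ ^ 2

/-- `∫₀^{L/t} |g(ts) - g(s)|² s^{-2μ} ds`. -/
def hardyDiff (μ L : ℝ) (g : ℝ → ℝ) (t : ℝ) : ℝ≥0∞ :=
  ∫⁻ s in Ioo 0 (L / t), hardyWeight μ s * ‖g (t * s) - g s‖ₑ ^ 2

theorem mul_mem_Ioo_iff {t s L : ℝ} (ht : 0 < t) : t * s ∈ Ioo 0 L ↔ s ∈ Ioo 0 (L / t) := by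
  simp only [mem_Ioo, mul_pos_iff_of_pos_left ht, lt_div_iff₀' ht]

/-- The dilation factor t^{2μ-1} differs from 1 exactly when μ ≠ 1/2. The Hardy inequality rests on
this gap. -/
theorem setLIntegral_hardy_dilate (μ L : ℝ) (g : ℝ → ℝ) {t : ℝ} (ht : 0 < t) :
    ∫⁻ s in Ioo 0 (L / t), hardyWeight μ s * ‖g (t * s)‖ₑ ^ 2 =
      ENNReal.ofReal (t ^ (2 * μ - 1)) * hardy μ L g := by
  rw [hardy, ← lintegral_indicator measurableSet_Ioo, ← lintegral_indicator measurableSet_Ioo,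
    ← lintegral_comp_mul_left ((Ioo 0 L).indicator fun s => hardyWeight μ s * ‖g s‖ₑ ^ 2) ht.ne',
    abs_of_pos ht, ← mul_assoc,
    ← ENNReal.ofReal_mul (by positivity), ← lintegral_const_mul' _ _ ENNReal.ofReal_ne_top]
  refine lintegral_congr fun s => ?_
  by_cases hs : s ∈ Ioo 0 (L / t)
  · rw [indicator_of_mem hs, indicator_of_mem ((mul_mem_Ioo_iff ht).2 hs), ← mul_assoc,
      hardyWeight, hardyWeight, ← ENNReal.ofReal_mul (by positivity)]
    congr 2
    rw [Real.mul_rpow ht.le hs.1.le, ← Real.rpow_add_one ht.ne', ← mul_assoc, ← Real.rpow_add ht]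
    ring_nf
    simp
  · rw [indicator_of_notMem hs, indicator_of_notMem fun h => hs ((mul_mem_Ioo_iff ht).1 h),
      mul_zero]

/-- For fixed s put y = ts. With t in (2, 3) one has |y - s| = s(t - 1) ≤ 2s, so s^{-2μ} dt is at
most 2^{1+2μ} |s - y|^{-1-2μ} dy. -/
theorem lintegral_hardyDiff_le {μ L : ℝ} (hμ : 0 < μ) {g : ℝ → ℝ} (hg : Measurable g) :
    ∫⁻ t in Ioo 2 3, hardyDiff μ L g t ≤
      ENNReal.ofReal (2 ^ (1 + 2 * μ)) * gagliardo μ (Ioo 0 L) g := by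
  set F : ℝ → ℝ → ℝ≥0∞ := fun t s => (Iio L).indicator
    (fun _ => hardyWeight μ s * ‖g (t * s) - g s‖ₑ ^ 2) (t * s) with hF
  have hw := measurable_hardyWeight μ
  have hk := measurable_gagKernel μ
  have hFm : Measurable (Function.uncurry F) := by
    have h1 : Function.uncurry F = {p : ℝ × ℝ | p.1 * p.2 < L}.indicator
        fun p => hardyWeight μ p.2 * ‖g (p.1 * p.2) - g p.2‖ₑ ^ 2 := by
      ext p
      by_cases hp : p.1 * p.2 < L
      · rw [indicator_of_mem (by exact hp)]
        simp [F, Function.uncurry, hp]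
      · rw [indicator_of_notMem (by exact hp)]
        simp [F, Function.uncurry, hp]
    rw [h1]
    exact Measurable.indicator (by fun_prop)
      (measurableSet_lt (measurable_fst.mul measurable_snd) measurable_const)
  have h1 : ∀ t ∈ Ioo (2 : ℝ) 3, hardyDiff μ L g t = ∫⁻ s in Ioo 0 L, F t s := by
    intro t ht
    have ht0 : 0 < t := by linarith [ht.1]
    rw [hardyDiff, ← lintegral_indicator measurableSet_Ioo, ← lintegral_indicator measurableSet_Ioo]
    refine lintegral_congr fun s => ?_
    by_cases hs : s ∈ Ioo 0 (L / t)
    · have h2 := (mul_mem_Ioo_iff ht0).2 hs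
      have hs' : s ∈ Ioo 0 L := ⟨hs.1, by nlinarith [h2.2, hs.1, ht.1]⟩
      rw [indicator_of_mem hs, indicator_of_mem hs', hF]
      simp only
      rw [indicator_of_mem (by exact h2.2)]
    · rw [indicator_of_notMem hs]
      by_cases hs' : s ∈ Ioo 0 L
      · rw [indicator_of_mem hs', hF]
        simp only
        rw [indicator_of_notMem]
        exact fun h => hs ((mul_mem_Ioo_iff ht0).1 ⟨mul_pos ht0 hs'.1, h⟩)
      · rw [indicator_of_notMem hs']
  rw [setLIntegral_congr_fun measurableSet_Ioo h1, lintegral_lintegral_swap hFm.aemeasurable,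
    gagliardo, ← lintegral_const_mul' _ _ ENNReal.ofReal_ne_top]
  refine setLIntegral_mono' measurableSet_Ioo fun s hs => ?_
  have hs0 := hs.1
  rw [← lintegral_indicator measurableSet_Ioo, ← lintegral_indicator measurableSet_Ioo,
    ← lintegral_comp_mul_left
      ((Ioo 0 L).indicator fun y => ‖g y - g s‖ₑ ^ 2 * gagKernel μ (s - y)) hs0.ne',
    ← mul_assoc, abs_of_pos hs0,
    ← ENNReal.ofReal_mul (by positivity), ← lintegral_const_mul' _ _ ENNReal.ofReal_ne_top]
  refine lintegral_mono fun t => ?_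
  by_cases ht : t ∈ Ioo (2 : ℝ) 3
  swap
  · rw [indicator_of_notMem ht]; exact zero_le
  rw [indicator_of_mem ht, hF]
  simp only
  by_cases hts : t * s ∈ Iio L
  swap
  · rw [indicator_of_notMem hts]; exact zero_le
  have hst : s * t ∈ Ioo 0 L := ⟨by have := ht.1; positivity, by rw [mul_comm]; exact hts⟩
  rw [indicator_of_mem hts, indicator_of_mem hst, mul_comm t s, mul_left_comm, mul_comm]
  refine mul_le_mul_right ?_ _
  rw [hardyWeight, gagKernel, ← ENNReal.ofReal_mul (by positivity)]
  refine ENNReal.ofReal_le_ofReal ?_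
  have habs : |s - s * t| = s * (t - 1) := by
    rw [abs_sub_comm, abs_of_nonneg] <;> nlinarith [ht.1]
  have ht1 : 0 < t - 1 := by linarith [ht.1]
  have h5 : (2 * s) ^ (-(1 + 2 * μ)) ≤ |s - s * t| ^ (-(1 + 2 * μ)) := by
    rw [habs]
    refine Real.rpow_le_rpow_of_nonpos (by positivity) ?_ (by linarith)
    nlinarith [ht.2]
  have h6 : s ^ (-(2 * μ)) = 2 ^ (1 + 2 * μ) * s * (2 * s) ^ (-(1 + 2 * μ)) := by
    rw [Real.mul_rpow zero_le_two hs0.le, mul_mul_mul_comm, ← Real.rpow_add two_pos,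
      add_neg_cancel, Real.rpow_zero, one_mul, mul_comm s, ← Real.rpow_add_one hs0.ne']
    ring_nf
  rw [h6]
  exact mul_le_mul_of_nonneg_left h5 (by positivity)

/-- The function is compared with its dilate g(t·) on (0, L/t), where the weighted integral changes
by the factor t^{2μ-1}. Depending on the sign of 2μ - 1, either g is bounded by g(t·) or g(t·) by g.
In both cases the Hardy integral returns with a factor less than 1 and is absorbed. -/
theorem hardy_le_of_mem {μ L q : ℝ} (hL : 0 < L) (hμ0 : 0 < μ) (hμ : μ ≠ 1 / 2)
    (hq : q = 2 ^ (-|2 * μ - 1|)) {g : ℝ → ℝ} (hg : Measurable g) (hW : hardy μ L g ≠ ∞) {t : ℝ}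
    (ht : t ∈ Ioo (2 : ℝ) 3) :
    hardy μ L g ≤ ENNReal.ofReal (1 - (1 + q) / 2)⁻¹ *
      (ENNReal.ofReal (1 + ((1 - q) / (2 * q))⁻¹) * hardyDiff μ L g t +
        ENNReal.ofReal ((L / 3) ^ (-(2 * μ))) * ∫⁻ s in Ioo 0 L, ‖g s‖ₑ ^ 2) := by
  have hμ' : 2 * μ - 1 ≠ 0 := fun h => hμ (by linarith)
  have hq0 : 0 < q := by rw [hq]; positivity
  have hq1 : q < 1 := by
    rw [hq]
    exact Real.rpow_lt_one_of_one_lt_of_neg one_lt_two (neg_neg_of_pos (abs_pos.2 hμ'))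
  -- With this ε, Young's loss 1 + ε still leaves q(1 + ε) = (1 + q)/2 < 1.
  set ε := (1 - q) / (2 * q) with hε
  have hε0 : 0 < ε := div_pos (by linarith) (by linarith)
  have hεq : q * (1 + ε) = (1 + q) / 2 := by rw [hε]; field_simp; ring
  have ht0 : 0 < t := by linarith [ht.1]
  have hw := measurable_hardyWeight μ
  set W := hardy μ L g with hWdef
  set D := hardyDiff μ L g t with hDdef
  set Q := ∫⁻ s in Ioo 0 L, ‖g s‖ₑ ^ 2 with hQ
  set B := ∫⁻ s in Ioo 0 (L / t), hardyWeight μ s * ‖g s‖ₑ ^ 2 with hB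
  have hsub : Ioo 0 (L / t) ⊆ Ioo 0 L := by
    refine Ioo_subset_Ioo_right ?_
    rw [div_le_iff₀ ht0]
    nlinarith [ht.1]
  have hBW : B ≤ W := lintegral_mono_set hsub
  have hcomp : ∀ u v : ℝ → ℝ, Measurable u → Measurable v →
      (∀ s, ‖u s - v s‖ₑ = ‖g (t * s) - g s‖ₑ) →
      ∫⁻ s in Ioo 0 (L / t), hardyWeight μ s * ‖u s‖ₑ ^ 2 ≤
        ENNReal.ofReal (1 + ε) * (∫⁻ s in Ioo 0 (L / t), hardyWeight μ s * ‖v s‖ₑ ^ 2) +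
          ENNReal.ofReal (1 + ε⁻¹) * D := by
    intro u v hu hv huv
    rw [hDdef, hardyDiff, ← lintegral_const_mul' _ _ ENNReal.ofReal_ne_top,
      ← lintegral_const_mul' _ _ ENNReal.ofReal_ne_top, ← lintegral_add_left (by fun_prop)]
    refine lintegral_mono fun s => ?_
    rw [← huv s, mul_left_comm _ (hardyWeight μ s), mul_left_comm _ (hardyWeight μ s), ← mul_add]
    exact mul_le_mul_right (enorm_sq_le hε0 (u s) (v s)) _
  have hgt : Measurable fun s => g (t * s) := by fun_prop
  have key : W ≤ ENNReal.ofReal ((1 + q) / 2) * W +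
      (ENNReal.ofReal (1 + ε⁻¹) * D + ENNReal.ofReal ((L / 3) ^ (-(2 * μ))) * Q) := by
    rw [← hεq, ENNReal.ofReal_mul hq0.le]
    -- If μ < 1/2 dilation shrinks the integral, but only the part over (0, L/t) is compared. On the
    -- rest s ≥ L/3, so the weight is bounded and gives the L² term. If μ > 1/2 the dilated integral
    -- already represents all of (0, L).
    rcases lt_or_gt_of_ne hμ' with hneg | hpos
    · have hA := setLIntegral_hardy_dilate μ L g ht0
      have h1 := hcomp g (fun s => g (t * s)) hg hgt fun s => by
        rw [← enorm_neg]; congr 1; ring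
      rw [hA, ← hB] at h1
      have htq : ENNReal.ofReal (t ^ (2 * μ - 1)) ≤ ENNReal.ofReal q := by
        refine ENNReal.ofReal_le_ofReal ?_
        rw [hq, abs_of_neg hneg, neg_neg]
        exact Real.rpow_le_rpow_of_nonpos two_pos ht.1.le hneg.le
      have h2 : W ≤ B + ENNReal.ofReal ((L / 3) ^ (-(2 * μ))) * Q := by
        rw [hWdef, hardy, hB, hQ, ← lintegral_const_mul' _ _ ENNReal.ofReal_ne_top,
          ← lintegral_indicator measurableSet_Ioo, ← lintegral_indicator measurableSet_Ioo,
          ← lintegral_indicator measurableSet_Ioo, ← lintegral_add_left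
            (Measurable.indicator (by fun_prop) measurableSet_Ioo)]
        refine lintegral_mono fun s => ?_
        by_cases hs : s ∈ Ioo 0 L
        swap
        · rw [indicator_of_notMem hs]; exact zero_le
        rw [indicator_of_mem hs, indicator_of_mem hs]
        by_cases hs' : s ∈ Ioo 0 (L / t)
        · rw [indicator_of_mem hs']; exact le_self_add
        · rw [indicator_of_notMem hs', zero_add]
          refine mul_le_mul_left ?_ _
          refine ENNReal.ofReal_le_ofReal
            (Real.rpow_le_rpow_of_nonpos (by positivity) ?_ (by linarith))
          have h3 : L / t ≤ s := not_lt.1 fun h => hs' ⟨hs.1, h⟩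
          refine le_trans ?_ h3
          exact div_le_div_of_nonneg_left hL.le ht0 ht.2.le
      calc W ≤ B + ENNReal.ofReal ((L / 3) ^ (-(2 * μ))) * Q := h2
        _ ≤ (ENNReal.ofReal (1 + ε) * (ENNReal.ofReal (t ^ (2 * μ - 1)) * W) +
            ENNReal.ofReal (1 + ε⁻¹) * D) + ENNReal.ofReal ((L / 3) ^ (-(2 * μ))) * Q := by
          gcongr
        _ ≤ (ENNReal.ofReal (1 + ε) * (ENNReal.ofReal q * W) +
            ENNReal.ofReal (1 + ε⁻¹) * D) + ENNReal.ofReal ((L / 3) ^ (-(2 * μ))) * Q := by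
          gcongr
        _ = _ := by ring
    · have hA := setLIntegral_hardy_dilate μ L g ht0
      have h1 := hcomp (fun s => g (t * s)) g hgt hg fun s => rfl
      rw [hA, ← hB] at h1
      have htq : ENNReal.ofReal (t ^ (-(2 * μ - 1))) ≤ ENNReal.ofReal q := by
        refine ENNReal.ofReal_le_ofReal ?_
        rw [hq, abs_of_pos hpos]
        exact Real.rpow_le_rpow_of_nonpos two_pos ht.1.le (by linarith)
      have h2 : W = ENNReal.ofReal (t ^ (-(2 * μ - 1))) *
          (ENNReal.ofReal (t ^ (2 * μ - 1)) * W) := by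
        rw [← mul_assoc, ← ENNReal.ofReal_mul (by positivity), ← Real.rpow_add ht0,
          neg_add_cancel, Real.rpow_zero, ENNReal.ofReal_one, one_mul]
      have hq1' : ENNReal.ofReal q ≤ 1 := by
        rw [← ENNReal.ofReal_one]; exact ENNReal.ofReal_le_ofReal hq1.le
      calc W = ENNReal.ofReal (t ^ (-(2 * μ - 1))) *
          (ENNReal.ofReal (t ^ (2 * μ - 1)) * W) := h2
        _ ≤ ENNReal.ofReal q *
            (ENNReal.ofReal (1 + ε) * B + ENNReal.ofReal (1 + ε⁻¹) * D) := by gcongr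
        _ ≤ ENNReal.ofReal q * (ENNReal.ofReal (1 + ε) * W) +
            1 * (ENNReal.ofReal (1 + ε⁻¹) * D) := by rw [mul_add]; gcongr
        _ ≤ _ := by
          rw [one_mul, ← mul_assoc]
          gcongr
          exact le_self_add
  exact le_of_le_mul_self_add hW (by positivity) (by linarith) key

/-- The inequality for each dilation t is averaged over the unit-length interval (2, 3), which turns
`hardyDiff` into `gagliardo`. Finiteness of the left side must be assumed: for μ > 1/2 a nonzero
constant g has infinite Hardy integral and a finite right side. -/
theorem exists_hardy {μ L : ℝ} (hL : 0 < L) (hμ0 : 0 < μ) (hμ : μ ≠ 1 / 2) :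
    ∃ C : ℝ≥0∞, C ≠ ∞ ∧ ∀ g : ℝ → ℝ, Measurable g → hardy μ L g ≠ ∞ →
      hardy μ L g ≤ C * (gagliardo μ (Ioo 0 L) g + ∫⁻ s in Ioo 0 L, ‖g s‖ₑ ^ 2) := by
  obtain ⟨q, hq⟩ : ∃ q : ℝ, q = 2 ^ (-|2 * μ - 1|) := ⟨_, rfl⟩
  set c₁ := ENNReal.ofReal (1 - (1 + q) / 2)⁻¹
  set c₂ := ENNReal.ofReal (1 + ((1 - q) / (2 * q))⁻¹)
  set c₃ := ENNReal.ofReal ((L / 3) ^ (-(2 * μ)))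
  set c₄ := ENNReal.ofReal (2 ^ (1 + 2 * μ))
  have h1 : c₁ ≠ ∞ := ENNReal.ofReal_ne_top
  have h2 : c₂ ≠ ∞ := ENNReal.ofReal_ne_top
  have h3 : c₃ ≠ ∞ := ENNReal.ofReal_ne_top
  have h4 : c₄ ≠ ∞ := ENNReal.ofReal_ne_top
  refine ⟨c₁ * (c₂ * c₄ + c₃), by finiteness, fun g hg hW => ?_⟩
  have hvol : volume (Ioo (2 : ℝ) 3) = 1 := by rw [Real.volume_Ioo]; norm_num
  set Q := ∫⁻ s in Ioo 0 L, ‖g s‖ₑ ^ 2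
  have hint : hardy μ L g ≤ c₁ * (c₂ * (∫⁻ t in Ioo (2 : ℝ) 3, hardyDiff μ L g t) + c₃ * Q) := by
    calc hardy μ L g = ∫⁻ _ in Ioo (2 : ℝ) 3, hardy μ L g := by
          rw [setLIntegral_const, hvol, mul_one]
      _ ≤ ∫⁻ t in Ioo (2 : ℝ) 3, c₁ * (c₂ * hardyDiff μ L g t + c₃ * Q) :=
          setLIntegral_mono' measurableSet_Ioo fun t ht =>
            hardy_le_of_mem hL hμ0 hμ hq hg hW ht
      _ = _ := by
          rw [lintegral_const_mul' _ _ h1, lintegral_add_right _ measurable_const,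
            lintegral_const_mul' _ _ h2, setLIntegral_const, hvol, mul_one]
  refine hint.trans ?_
  rw [mul_assoc]
  refine mul_le_mul_right ?_ _
  calc c₂ * (∫⁻ t in Ioo (2 : ℝ) 3, hardyDiff μ L g t) + c₃ * Q
      ≤ c₂ * (c₄ * gagliardo μ (Ioo 0 L) g) + c₃ * Q := by
        gcongr
        exact lintegral_hardyDiff_le hμ0 hg
    _ ≤ (c₂ * c₄ * gagliardo μ (Ioo 0 L) g + c₂ * c₄ * Q) +
        (c₃ * gagliardo μ (Ioo 0 L) g + c₃ * Q) := by
        rw [← mul_assoc]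
        gcongr
        · exact le_self_add
        · exact le_add_self
    _ = _ := by ring

/-! ### Extension by zero -/

section

variable {a b μ : ℝ} {φ : ℝ → ℝ}

theorem IsTest.exists_margin (h : IsTest a b φ) :
    ∃ δ : ℝ, 0 < δ ∧ ∀ x, x ≤ a + δ ∨ b - δ ≤ x → φ x = 0 := by
  obtain ⟨δ, hδ, hsub⟩ := h.hasCompactSupport.exists_thickening_subset_open isOpen_Ioo
    h.tsupport_subset
  refine ⟨δ / 2, half_pos hδ, fun x hx => ?_⟩
  by_contra hne
  have hx' : x ∈ tsupport φ := subset_tsupport φ hne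
  rcases hx with hx | hx
  · have : x - δ / 2 ∈ Ioo a b := hsub (Metric.mem_thickening_iff.2 ⟨x, hx', by
      rw [Real.dist_eq, sub_sub_cancel_left, abs_neg, abs_of_pos (half_pos hδ)]; linarith⟩)
    linarith [this.1]
  · have : x + δ / 2 ∈ Ioo a b := hsub (Metric.mem_thickening_iff.2 ⟨x, hx', by
      rw [Real.dist_eq, add_sub_cancel_left, abs_of_pos (half_pos hδ)]; linarith⟩)
    linarith [this.2]

theorem IsTest.memLp (h : IsTest a b φ) (ν : Measure ℝ) [IsFiniteMeasureOnCompacts ν] :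
    MemLp φ 2 ν :=
  h.continuous.memLp_of_hasCompactSupport h.hasCompactSupport

theorem IsTest.lintegral_ne_top (h : IsTest a b φ) (S : Set ℝ) : ∫⁻ x in S, ‖φ x‖ₑ ^ 2 ≠ ∞ := by
  rw [lintegral_enorm_sq]
  exact ENNReal.pow_ne_top ((h.memLp volume).restrict S).eLpNorm_ne_top

theorem IsTest.ofReal_integral_sq (h : IsTest a b φ) :
    ENNReal.ofReal (∫ x in Ioo a b, φ x ^ 2) = ∫⁻ x in Ioo a b, ‖φ x‖ₑ ^ 2 := by
  have hi : IntegrableOn (fun x => φ x ^ 2) (Ioo a b) :=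
    (((h.continuous.pow 2).integrable_of_hasCompactSupport
      (by simpa [sq] using h.hasCompactSupport.mul_left (f := φ)))).integrableOn
  rw [ofReal_integral_eq_lintegral_ofReal hi (Eventually.of_forall fun x => sq_nonneg _)]
  refine lintegral_congr fun x => ?_
  rw [Real.enorm_eq_ofReal_abs, ← ENNReal.ofReal_pow (abs_nonneg _), sq_abs]

theorem setLIntegral_add_left (F : ℝ → ℝ≥0∞) (a b : ℝ) :
    ∫⁻ s in Ioo 0 (b - a), F (a + s) = ∫⁻ x in Ioo a b, F x := by
  rw [← lintegral_indicator measurableSet_Ioo, ← lintegral_indicator measurableSet_Ioo,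
    ← lintegral_add_left_eq_self ((Ioo a b).indicator F) a]
  refine lintegral_congr fun s => ?_
  have : a + s ∈ Ioo a b ↔ s ∈ Ioo 0 (b - a) := by
    simp only [mem_Ioo]; constructor <;> rintro ⟨h1, h2⟩ <;> constructor <;> linarith
  by_cases hs : s ∈ Ioo 0 (b - a)
  · rw [indicator_of_mem hs, indicator_of_mem (this.2 hs)]
  · rw [indicator_of_notMem hs, indicator_of_notMem (fun h => hs (this.1 h))]

theorem setLIntegral_sub_left (F : ℝ → ℝ≥0∞) (a b : ℝ) :
    ∫⁻ s in Ioo 0 (b - a), F (b - s) = ∫⁻ x in Ioo a b, F x := by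
  rw [← lintegral_indicator measurableSet_Ioo, ← lintegral_indicator measurableSet_Ioo,
    ← lintegral_sub_left_eq_self ((Ioo a b).indicator F) b]
  refine lintegral_congr fun s => ?_
  have : b - s ∈ Ioo a b ↔ s ∈ Ioo 0 (b - a) := by
    simp only [mem_Ioo]; constructor <;> rintro ⟨h1, h2⟩ <;> constructor <;> linarith
  by_cases hs : s ∈ Ioo 0 (b - a)
  · rw [indicator_of_mem hs, indicator_of_mem (this.2 hs)]
  · rw [indicator_of_notMem hs, indicator_of_notMem (fun h => hs (this.1 h))]

theorem gagliardo_add_left (μ : ℝ) (φ : ℝ → ℝ) (a b : ℝ) :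
    gagliardo μ (Ioo 0 (b - a)) (fun s => φ (a + s)) = gagliardo μ (Ioo a b) φ := by
  rw [gagliardo, gagliardo, ← setLIntegral_add_left _ a b]
  refine lintegral_congr fun x => ?_
  rw [← setLIntegral_add_left _ a b]
  refine lintegral_congr fun y => ?_
  rw [add_sub_add_left_eq_sub]

theorem gagliardo_sub_left (μ : ℝ) (φ : ℝ → ℝ) (a b : ℝ) :
    gagliardo μ (Ioo 0 (b - a)) (fun s => φ (b - s)) = gagliardo μ (Ioo a b) φ := by
  rw [gagliardo, gagliardo, ← setLIntegral_sub_left _ a b]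
  refine lintegral_congr fun x => ?_
  rw [← setLIntegral_sub_left _ a b]
  refine lintegral_congr fun y => ?_
  rw [sub_sub_sub_cancel_left, ← gagKernel_neg, neg_sub]

/-- Vanishing near 0 keeps the weight bounded. Test functions qualify at both endpoints by
`IsTest.exists_margin`. -/
theorem hardy_ne_top {μ L δ : ℝ} {g : ℝ → ℝ} (hμ : 0 ≤ μ) (hδ : 0 < δ) (hg : ∀ s ≤ δ, g s = 0)
    (hQ : ∫⁻ s in Ioo 0 L, ‖g s‖ₑ ^ 2 ≠ ∞) : hardy μ L g ≠ ∞ := by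
  refine ne_top_of_le_ne_top (ENNReal.mul_ne_top
    (ENNReal.ofReal_ne_top (r := δ ^ (-(2 * μ)))) hQ) ?_
  rw [hardy, ← lintegral_const_mul' _ _ ENNReal.ofReal_ne_top]
  refine lintegral_mono fun s => ?_
  rcases le_or_gt s δ with h | h
  · simp [hg s h]
  · refine mul_le_mul_left (ENNReal.ofReal_le_ofReal ?_) _
    exact Real.rpow_le_rpow_of_nonpos hδ h.le (by linarith)

theorem lintegral_gagKernel_Ioi {c : ℝ} (hμ : 0 < μ) (hc : 0 < c) :
    ∫⁻ u in Ioi c, gagKernel μ u = ENNReal.ofReal (2 * μ)⁻¹ * hardyWeight μ c := by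
  have h1 : ∫⁻ u in Ioi c, gagKernel μ u = ∫⁻ u in Ioi c, ENNReal.ofReal (u ^ (-(1 + 2 * μ))) :=
    setLIntegral_congr_fun measurableSet_Ioi fun u hu => by
      simp only [gagKernel, abs_of_pos (hc.trans hu)]
  have hi := integrableOn_Ioi_rpow_of_lt (a := -(1 + 2 * μ)) (by linarith) hc
  rw [h1, ← ofReal_integral_eq_lintegral_ofReal hi, integral_Ioi_rpow_of_lt (by linarith) hc,
    hardyWeight, ← ENNReal.ofReal_mul (by positivity)]
  · congr 1
    rw [show -(1 + 2 * μ) + 1 = -(2 * μ) by ring, neg_div_neg_eq]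
    field_simp
  · filter_upwards [ae_restrict_mem measurableSet_Ioi] with u hu
    exact Real.rpow_nonneg (hc.trans hu).le _

/-- The complement of Ω consists of two half-lines at distances x - a and b - x from x. Integrating
the kernel over each gives a Hardy weight at the corresponding endpoint. -/
theorem lintegral_gagKernel_compl_le {x : ℝ} (hμ : 0 < μ) (hx : x ∈ Ioo a b) :
    ∫⁻ y in (Ioo a b)ᶜ, gagKernel μ (x - y) ≤
      ENNReal.ofReal (2 * μ)⁻¹ * (hardyWeight μ (x - a) + hardyWeight μ (b - x)) := by
  have hsub : (Ioo a b)ᶜ ⊆ Iic a ∪ Ici b := by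
    intro y hy
    by_cases h : y ≤ a
    · exact Or.inl h
    · exact Or.inr (not_lt.1 fun h' => hy ⟨not_le.1 h, h'⟩)
  refine (lintegral_mono_set hsub).trans ((lintegral_union_le _ _ _).trans ?_)
  rw [mul_add, ← lintegral_gagKernel_Ioi hμ (sub_pos.2 hx.1),
    ← lintegral_gagKernel_Ioi hμ (sub_pos.2 hx.2), setLIntegral_congr Iio_ae_eq_Iic.symm,
    setLIntegral_congr Ioi_ae_eq_Ici.symm]
  refine add_le_add (le_of_eq ?_) (le_of_eq ?_)
  · rw [← lintegral_indicator measurableSet_Iio, ← lintegral_indicator measurableSet_Ioi,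
      ← lintegral_sub_left_eq_self _ x]
    refine lintegral_congr fun y => ?_
    by_cases hy : x - a < y
    · rw [indicator_of_mem (by simp only [mem_Iio]; linarith), indicator_of_mem (mem_Ioi.2 hy),
        sub_sub_cancel]
    · rw [indicator_of_notMem (by simp only [mem_Iio]; linarith),
        indicator_of_notMem (by simpa using hy)]
  · rw [← lintegral_indicator measurableSet_Ioi, ← lintegral_indicator measurableSet_Ioi,
      ← lintegral_add_left_eq_self _ x]
    refine lintegral_congr fun y => ?_
    by_cases hy : b - x < y
    · rw [indicator_of_mem (by simp only [mem_Ioi]; linarith), indicator_of_mem (mem_Ioi.2 hy),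
        sub_add_cancel_left, gagKernel_neg]
    · rw [indicator_of_notMem (by simp only [mem_Ioi]; linarith),
        indicator_of_notMem (by simpa using hy)]

/-- Split ℝ × ℝ by Ω and its complement. The block outside Ω on both sides vanishes, the two mixed
blocks agree by symmetry, and in a mixed block one value is 0, so integrating out the exterior
variable leaves the Hardy integrals at a and b. -/
theorem gagliardo_univ_le (h : IsTest a b φ) (hμ : 0 < μ) :
    gagliardo μ univ φ ≤ gagliardo μ (Ioo a b) φ + 2 * (ENNReal.ofReal (2 * μ)⁻¹ *
      (hardy μ (b - a) (fun s => φ (a + s)) + hardy μ (b - a) (fun s => φ (b - s)))) := by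
  have hk := measurable_gagKernel μ
  have hw := measurable_hardyWeight μ
  have hφ : Measurable φ := h.continuous.measurable
  set S := Ioo a b
  have hS : MeasurableSet S := measurableSet_Ioo
  have hcross : ∫⁻ x in S, ∫⁻ y in Sᶜ, ‖φ y - φ x‖ₑ ^ 2 * gagKernel μ (x - y) ≤
      ENNReal.ofReal (2 * μ)⁻¹ * (hardy μ (b - a) (fun s => φ (a + s)) +
        hardy μ (b - a) (fun s => φ (b - s))) := by
    have h1 : hardy μ (b - a) (fun s => φ (a + s)) =
        ∫⁻ x in S, hardyWeight μ (x - a) * ‖φ x‖ₑ ^ 2 := by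
      rw [hardy, ← setLIntegral_add_left _ a b]
      simp
    have h2 : hardy μ (b - a) (fun s => φ (b - s)) =
        ∫⁻ x in S, hardyWeight μ (b - x) * ‖φ x‖ₑ ^ 2 := by
      rw [hardy, ← setLIntegral_sub_left _ a b]
      simp
    rw [h1, h2, ← lintegral_add_left (by fun_prop),
      ← lintegral_const_mul' _ _ ENNReal.ofReal_ne_top]
    refine setLIntegral_mono' hS fun x hx => ?_
    have h3 : ∫⁻ y in Sᶜ, ‖φ y - φ x‖ₑ ^ 2 * gagKernel μ (x - y) =
        ‖φ x‖ₑ ^ 2 * ∫⁻ y in Sᶜ, gagKernel μ (x - y) := by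
      rw [← lintegral_const_mul' _ _ (by finiteness)]
      refine setLIntegral_congr_fun hS.compl fun y hy => ?_
      rw [h.eq_zero hy, zero_sub, enorm_neg]
    rw [h3, ← add_mul, ← mul_assoc, mul_comm]
    exact mul_le_mul_left (lintegral_gagKernel_compl_le hμ hx) _
  have hK : Measurable fun p : ℝ × ℝ => ‖φ p.2 - φ p.1‖ₑ ^ 2 * gagKernel μ (p.1 - p.2) := by
    fun_prop
  have hzero : ∫⁻ x in Sᶜ, ∫⁻ y in Sᶜ, ‖φ y - φ x‖ₑ ^ 2 * gagKernel μ (x - y) = 0 := by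
    have h0 : ∀ x ∈ Sᶜ, ∫⁻ y in Sᶜ, ‖φ y - φ x‖ₑ ^ 2 * gagKernel μ (x - y) = 0 := fun x hx => by
      have h1 : ∀ y ∈ Sᶜ, ‖φ y - φ x‖ₑ ^ 2 * gagKernel μ (x - y) = 0 := fun y hy => by
        simp [h.eq_zero hx, h.eq_zero hy]
      rw [setLIntegral_congr_fun hS.compl h1, lintegral_zero]
    rw [setLIntegral_congr_fun hS.compl h0, lintegral_zero]
  have hswap : ∫⁻ x in Sᶜ, ∫⁻ y in S, ‖φ y - φ x‖ₑ ^ 2 * gagKernel μ (x - y) =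
      ∫⁻ x in S, ∫⁻ y in Sᶜ, ‖φ y - φ x‖ₑ ^ 2 * gagKernel μ (x - y) := by
    rw [lintegral_lintegral_swap hK.aemeasurable]
    refine lintegral_congr fun x => lintegral_congr fun y => ?_
    rw [← gagKernel_neg, neg_sub, ← enorm_neg, neg_sub]
  have hinner : ∀ T : Set ℝ, Measurable fun x =>
      ∫⁻ y in T, ‖φ y - φ x‖ₑ ^ 2 * gagKernel μ (x - y) := fun T => hK.lintegral_prod_right'
  have hsplit : gagliardo μ univ φ = (∫⁻ x in S, ∫⁻ y in S, ‖φ y - φ x‖ₑ ^ 2 * gagKernel μ (x - y)) +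
      (∫⁻ x in S, ∫⁻ y in Sᶜ, ‖φ y - φ x‖ₑ ^ 2 * gagKernel μ (x - y)) +
      ((∫⁻ x in Sᶜ, ∫⁻ y in S, ‖φ y - φ x‖ₑ ^ 2 * gagKernel μ (x - y)) +
      (∫⁻ x in Sᶜ, ∫⁻ y in Sᶜ, ‖φ y - φ x‖ₑ ^ 2 * gagKernel μ (x - y))) := by
    rw [← lintegral_add_left (hinner S), ← lintegral_add_left (hinner S)]
    simp only [lintegral_add_compl _ hS, gagliardo, Measure.restrict_univ]
  rw [hsplit, hzero, hswap, add_zero, add_assoc, ← two_mul]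
  exact add_le_add le_rfl (mul_le_mul_right hcross 2)

theorem exists_gagliardo_univ_le (hab : a < b) (hμ0 : 0 < μ) (hμ : μ ≠ 1 / 2) :
    ∃ C : ℝ≥0∞, C ≠ ∞ ∧ ∀ φ, IsTest a b φ → gagliardo μ univ φ ≤
      C * (gagliardo μ (Ioo a b) φ + ∫⁻ x in Ioo a b, ‖φ x‖ₑ ^ 2) := by
  obtain ⟨C, hC, hH⟩ := exists_hardy (sub_pos.2 hab) hμ0 hμ
  set k := ENNReal.ofReal (2 * μ)⁻¹
  have hk : k ≠ ∞ := ENNReal.ofReal_ne_top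
  refine ⟨1 + 2 * (k * (C + C)), by finiteness, fun φ h => ?_⟩
  obtain ⟨δ, hδ, hz⟩ := h.exists_margin
  have hφ : Measurable φ := h.continuous.measurable
  have e1 := setLIntegral_add_left (fun x => ‖φ x‖ₑ ^ 2) a b
  have e2 := setLIntegral_sub_left (fun x => ‖φ x‖ₑ ^ 2) a b
  have h1 := hH (fun s => φ (a + s)) (by fun_prop) (hardy_ne_top hμ0.le hδ
    (fun s hs => hz _ (Or.inl (by linarith))) (by rw [e1]; exact h.lintegral_ne_top _))
  have h2 := hH (fun s => φ (b - s)) (by fun_prop) (hardy_ne_top hμ0.le hδ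
    (fun s hs => hz _ (Or.inr (by linarith))) (by rw [e2]; exact h.lintegral_ne_top _))
  rw [gagliardo_add_left, e1] at h1
  rw [gagliardo_sub_left, e2] at h2
  refine (gagliardo_univ_le h hμ0).trans ?_
  set G := gagliardo μ (Ioo a b) φ
  set Q := ∫⁻ x in Ioo a b, ‖φ x‖ₑ ^ 2
  calc G + 2 * (k * (_ + _)) ≤ (G + Q) + 2 * (k * (C * (G + Q) + C * (G + Q))) := by
        gcongr
        exact le_self_add
    _ = _ := by ring

/-- The double integral over Ω × Ω sees only the restriction, so it is a lower bound common to all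
extensions, as the infimum in `seminormSq` requires. -/
theorem gagliardo_le_of_ae_eq (f : Lp ℝ 2 (volume : Measure ℝ))
    (hf : f =ᵐ[volume.restrict (Ioo a b)] φ) :
    gagliardo μ (Ioo a b) φ ≤ gagliardo μ univ f := by
  have h1 : gagliardo μ (Ioo a b) φ = gagliardo μ (Ioo a b) f := by
    refine lintegral_congr_ae ?_
    filter_upwards [hf] with x hx
    refine lintegral_congr_ae ?_
    filter_upwards [hf] with y hy
    rw [hx, hy]
  rw [h1, gagliardo, gagliardo]
  exact (lintegral_mono_set (subset_univ _)).trans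
    (lintegral_mono fun x => lintegral_mono_set (subset_univ _))

/-- Extension by zero of a test function, in `L²(ℝ)`. -/
def IsTest.toLine (h : IsTest a b φ) : Lp ℝ 2 (volume : Measure ℝ) := (h.memLp volume).toLp φ

theorem IsTest.coeFn_toLine (h : IsTest a b φ) : h.toLine =ᵐ[volume] φ := MemLp.coeFn_toLp _

theorem IsTest.fourier_toLine (h : IsTest a b φ) :
    (𝓕 (complexify h.toLine) : Lp ℂ 2 (volume : Measure ℝ)) =ᵐ[volume] ft φ := by
  have hcs : HasCompactSupport fun x => (φ x : ℂ) :=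
    h.hasCompactSupport.comp_left (g := fun x : ℝ => (x : ℂ)) Complex.ofReal_zero
  have hcd : ContDiff ℝ (⊤ : ℕ∞) fun x => (φ x : ℂ) :=
    Complex.ofRealCLM.contDiff.comp h.contDiff
  set S := hcs.toSchwartzMap hcd with hS
  have h1 : complexify h.toLine = S.toLp 2 := by
    apply Lp.ext
    filter_upwards [coeFn_complexify h.toLine, h.coeFn_toLine, S.coeFn_toLp 2 volume]
      with x h1 h2 h3
    rw [h1, h2, h3]
    rfl
  rw [h1, SchwartzMap.toLp_fourier_eq]
  exact (𝓕 S).coeFn_toLp 2 volume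

theorem ofReal_energy_zero (h : IsTest a b φ) (hμ0 : 0 ≤ μ) (hμ1 : μ ≤ 1) :
    ENNReal.ofReal (energy μ 0 φ) =
      ∫⁻ ξ : ℝ, ENNReal.ofReal (|2 * Real.pi * ξ| ^ (2 * μ)) * ‖ft φ ξ‖ₑ ^ 2 := by
  rw [energy, ofReal_integral_eq_lintegral_ofReal (integrable_energy h hμ0 hμ1)
    (Eventually.of_forall fun ξ => by positivity)]
  refine lintegral_congr fun ξ => ?_
  rw [ENNReal.ofReal_mul (by positivity), ENNReal.ofReal_pow (norm_nonneg _), ofReal_norm]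
  congr 4
  simp [symbol]

/-- The factor 2π is the Jacobian of ω = 2πξ. -/
theorem lineSeminormSq_toLine (h : IsTest a b φ) (hμ0 : 0 ≤ μ) (hμ1 : μ ≤ 1) :
    lineSeminormSq μ h.toLine = ENNReal.ofReal (2 * Real.pi * energy μ 0 φ) := by
  have hpi := Real.pi_pos
  rw [lineSeminormSq_eq, ENNReal.ofReal_mul (p := 2 * Real.pi) (by positivity),
    ofReal_energy_zero h hμ0 hμ1]
  congr 1
  refine lintegral_congr_ae ?_
  filter_upwards [h.fourier_toLine] with ξ hξ
  rw [hξ]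

theorem gagliardo_univ_test (h : IsTest a b φ) (hμ0 : 0 ≤ μ) (hμ1 : μ ≤ 1) :
    gagliardo μ univ φ = gagConst μ * ENNReal.ofReal (energy μ 0 φ) := by
  have h1 : gagliardo μ univ φ = gagliardo μ univ h.toLine := by
    have h2 : ∀ᵐ x ∂volume.restrict univ, h.toLine x = φ x := by
      rw [Measure.restrict_univ]; exact h.coeFn_toLine
    refine lintegral_congr_ae ?_
    filter_upwards [h2] with x hx
    refine lintegral_congr_ae ?_
    filter_upwards [h2] with y hy
    rw [hx, hy]
  rw [h1, gagliardo_univ_eq, ofReal_energy_zero h hμ0 hμ1]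
  congr 1
  refine lintegral_congr_ae ?_
  filter_upwards [h.fourier_toLine] with ξ hξ
  rw [hξ]

theorem lintegral_weight_le_lineSeminormSq (μ : ℝ) (f : Lp ℝ 2 (volume : Measure ℝ)) :
    ∫⁻ ξ : ℝ, ENNReal.ofReal (|2 * Real.pi * ξ| ^ (2 * μ)) *
        ‖(𝓕 (complexify f) : Lp ℂ 2 (volume : Measure ℝ)) ξ‖ₑ ^ 2 ≤ lineSeminormSq μ f := by
  rw [lineSeminormSq_eq]
  refine le_mul_of_one_le_left zero_le ?_
  rw [← ENNReal.ofReal_one]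
  exact ENNReal.ofReal_le_ofReal (by linarith [Real.pi_gt_three])

theorem exists_energy_le_of_lt_one (hab : a < b) (hμ0 : 0 < μ) (hμ1 : μ < 1) (hμ : μ ≠ 1 / 2) :
    ∃ C : ℝ≥0∞, C ≠ ∞ ∧ ∀ φ, IsTest a b φ → ∀ f : Lp ℝ 2 (volume : Measure ℝ),
      f =ᵐ[volume.restrict (Ioo a b)] φ → ENNReal.ofReal (energy μ 0 φ) ≤
        C * ((∫⁻ x in Ioo a b, ‖φ x‖ₑ ^ 2) + lineSeminormSq μ f) := by
  obtain ⟨C, hC, hG⟩ := exists_gagliardo_univ_le hab hμ0 hμ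
  have hk0 := gagConst_ne_zero μ
  have hk1 := gagConst_ne_top hμ0 hμ1
  have hki : (gagConst μ)⁻¹ ≠ ∞ := ENNReal.inv_ne_top.2 hk0
  refine ⟨(gagConst μ)⁻¹ * (C * (gagConst μ + 1)), by finiteness, fun φ h f hf => ?_⟩
  have h1 := hG φ h
  rw [gagliardo_univ_test h hμ0.le hμ1.le] at h1
  have h2 : gagliardo μ (Ioo a b) φ ≤ gagConst μ * lineSeminormSq μ f := by
    refine (gagliardo_le_of_ae_eq f hf).trans ?_
    rw [gagliardo_univ_eq]
    exact mul_le_mul_right (lintegral_weight_le_lineSeminormSq μ f) _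
  set Q := ∫⁻ x in Ioo a b, ‖φ x‖ₑ ^ 2
  calc ENNReal.ofReal (energy μ 0 φ)
      = (gagConst μ)⁻¹ * (gagConst μ * ENNReal.ofReal (energy μ 0 φ)) := by
        rw [← mul_assoc, ENNReal.inv_mul_cancel hk0 hk1, one_mul]
    _ ≤ (gagConst μ)⁻¹ * (C * (gagConst μ * lineSeminormSq μ f + Q)) := by
        exact mul_le_mul_right (h1.trans (by gcongr)) _
    _ ≤ (gagConst μ)⁻¹ * (C * (gagConst μ * lineSeminormSq μ f + Q) +
        C * (lineSeminormSq μ f + gagConst μ * Q)) := by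
        gcongr
        exact le_self_add
    _ = _ := by ring

/-! ### The case μ = 1 by difference quotients -/

theorem norm_modulation_sub_one_le (h ξ : ℝ) : ‖modulation h ξ - 1‖ ≤ |h| * |2 * Real.pi * ξ| := by
  have := Real.norm_exp_I_mul_ofReal_sub_one_le (x := -2 * Real.pi * h * ξ)
  rw [mul_comm] at this
  refine this.trans (le_of_eq ?_)
  rw [Real.norm_eq_abs, show -2 * Real.pi * h * ξ = -(h * (2 * Real.pi * ξ)) by ring, abs_neg,
    abs_mul]

theorem tendsto_modulation_sub_one (ξ : ℝ) :
    Tendsto (fun n : ℕ => ((n : ℝ) + 1) * ‖modulation (1 / ((n : ℝ) + 1)) ξ - 1‖) atTop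
      (𝓝 |2 * Real.pi * ξ|) := by
  have hd : HasDerivAt (fun h : ℝ => modulation h ξ) (-(2 * Real.pi * ξ : ℝ) * Complex.I : ℂ) 0 := by
    have h1 : HasDerivAt (fun h : ℝ => ((-2 * Real.pi * h * ξ : ℝ) : ℂ) * Complex.I)
        (((-2 * Real.pi * 1 * ξ : ℝ) : ℂ) * Complex.I) 0 :=
      (((hasDerivAt_id (0 : ℝ)).const_mul (-2 * Real.pi)).mul_const ξ).ofReal_comp.mul_const _
    have h2 := h1.cexp
    refine h2.congr_deriv ?_
    simp
  have h3 := hd.tendsto_slope_zero_right.comp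
    (tendsto_nhdsWithin_iff.2 ⟨tendsto_one_div_add_atTop_nhds_zero_nat (𝕜 := ℝ),
      Eventually.of_forall fun n => by simp only [mem_Ioi]; positivity⟩)
  have h4 := h3.norm
  have h5 : ‖(-(2 * Real.pi * ξ : ℝ) * Complex.I : ℂ)‖ = |2 * Real.pi * ξ| := by
    rw [norm_mul, norm_neg, Complex.norm_real, Complex.norm_I, mul_one, Real.norm_eq_abs]
  rw [h5] at h4
  refine h4.congr fun n => ?_
  have h6 : modulation 0 ξ = 1 := by simp [modulation]
  simp only [Function.comp_apply, zero_add, h6, norm_smul]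
  rw [Real.norm_of_nonneg (by positivity)]
  simp

/-- A translate by less than the margin between the support and the endpoints gives a difference
quotient of φ dominated pointwise by that of any extension f. By Plancherel the latter is at most
the seminorm of f, and Fatou's lemma recovers the energy as the step tends to 0. -/
theorem exists_energy_one_le :
    ∀ φ, IsTest a b φ → ∀ f : Lp ℝ 2 (volume : Measure ℝ),
      f =ᵐ[volume.restrict (Ioo a b)] φ → ENNReal.ofReal (energy 1 0 φ) ≤ lineSeminormSq 1 f := by
  intro φ h f hf
  obtain ⟨δ, hδ, hz⟩ := h.exists_margin
  have hsmall : ∀ t : ℝ, 0 < t → t < δ → ∫⁻ ξ, ‖modulation t ξ - 1‖ₑ ^ 2 * ‖ft φ ξ‖ₑ ^ 2 ≤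
      ENNReal.ofReal (t ^ 2) * lineSeminormSq 1 f := by
    intro t ht0 htδ
    have e1 : ∫⁻ ξ, ‖modulation t ξ - 1‖ₑ ^ 2 * ‖ft φ ξ‖ₑ ^ 2 =
        ∫⁻ x, ‖h.toLine (x - t) - h.toLine x‖ₑ ^ 2 := by
      rw [lintegral_translate_sub]
      refine lintegral_congr_ae ?_
      filter_upwards [h.fourier_toLine] with ξ hξ
      rw [hξ]
    have e2 : ∫⁻ x, ‖h.toLine (x - t) - h.toLine x‖ₑ ^ 2 ≤ ∫⁻ x, ‖f (x - t) - f x‖ₑ ^ 2 := by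
      have hf' : ∀ᵐ x, x ∈ Ioo a b → f x = φ x := (ae_restrict_iff' measurableSet_Ioo).1 hf
      have hq := (measurePreserving_sub_const t).quasiMeasurePreserving
      refine lintegral_mono_ae ?_
      filter_upwards [hf', hq.ae hf', h.coeFn_toLine, hq.ae_eq_comp h.coeFn_toLine]
        with x h1 h2 h3 h4
      have h4' : h.toLine (x - t) = φ (x - t) := h4
      rw [h3, h4']
      -- If one of the points leaves Ω, both lie within t < δ of an endpoint or beyond it, where φ
      -- is zero. Otherwise f and φ agree at both.
      by_cases hx : x ∈ Ioo a b ∧ x - t ∈ Ioo a b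
      · rw [h1 hx.1, h2 hx.2]
      · have hφ : φ (x - t) = 0 ∧ φ x = 0 := by
          constructor
          · apply hz
            by_contra hcon
            push Not at hcon
            exact hx ⟨⟨by linarith, by linarith⟩, ⟨by linarith, by linarith⟩⟩
          · apply hz
            by_contra hcon
            push Not at hcon
            exact hx ⟨⟨by linarith, by linarith⟩, ⟨by linarith, by linarith⟩⟩
        simp [hφ.1, hφ.2]
    rw [e1]
    refine e2.trans ?_
    rw [lintegral_translate_sub]
    refine le_trans ?_ (mul_le_mul_right (lintegral_weight_le_lineSeminormSq 1 f) _)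
    rw [← lintegral_const_mul' _ _ ENNReal.ofReal_ne_top]
    refine lintegral_mono fun ξ => ?_
    rw [← mul_assoc, ← ENNReal.ofReal_mul (by positivity)]
    refine mul_le_mul_left ?_ _
    rw [← ofReal_norm, ← ENNReal.ofReal_pow (norm_nonneg _)]
    refine ENNReal.ofReal_le_ofReal ?_
    have h5 := pow_le_pow_left₀ (norm_nonneg _) (norm_modulation_sub_one_le t ξ) 2
    rw [mul_pow, sq_abs] at h5
    rw [mul_one, Real.rpow_two]
    exact h5
  have hcont := continuous_ft h.integrable
  set F : ℕ → ℝ → ℝ≥0∞ := fun n ξ =>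
    ENNReal.ofReal ((((n : ℝ) + 1) * ‖modulation (1 / ((n : ℝ) + 1)) ξ - 1‖) ^ 2) * ‖ft φ ξ‖ₑ ^ 2
    with hF
  have hlim : ∀ ξ, Tendsto (fun n => F n ξ) atTop
      (𝓝 (ENNReal.ofReal (|2 * Real.pi * ξ| ^ 2) * ‖ft φ ξ‖ₑ ^ 2)) := fun ξ =>
    ENNReal.Tendsto.mul_const (ENNReal.tendsto_ofReal ((tendsto_modulation_sub_one ξ).pow 2))
      (Or.inr (by finiteness))
  rw [ofReal_energy_zero h zero_le_one le_rfl]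
  simp only [mul_one, Real.rpow_two]
  have hFm : ∀ n, Measurable (F n) := by
    intro n
    have := (continuous_modulation (1 / ((n : ℝ) + 1))).measurable
    fun_prop
  calc ∫⁻ ξ, ENNReal.ofReal (|2 * Real.pi * ξ| ^ 2) * ‖ft φ ξ‖ₑ ^ 2
      = ∫⁻ ξ, liminf (fun n => F n ξ) atTop := lintegral_congr fun ξ => (hlim ξ).liminf_eq.symm
    _ ≤ liminf (fun n => ∫⁻ ξ, F n ξ) atTop := lintegral_liminf_le hFm
    _ ≤ lineSeminormSq 1 f := by
      refine liminf_le_of_frequently_le' (Eventually.frequently ?_)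
      have h0 : ∀ᶠ n : ℕ in atTop, 1 / ((n : ℝ) + 1) < δ :=
        (tendsto_one_div_add_atTop_nhds_zero_nat (𝕜 := ℝ)).eventually_lt_const hδ
      filter_upwards [h0] with n hn
      have hn1 : (0 : ℝ) < (n : ℝ) + 1 := by positivity
      have h1 := hsmall _ (by positivity) hn
      have h2 : ∫⁻ ξ, F n ξ = ENNReal.ofReal (((n : ℝ) + 1) ^ 2) *
          ∫⁻ ξ, ‖modulation (1 / ((n : ℝ) + 1)) ξ - 1‖ₑ ^ 2 * ‖ft φ ξ‖ₑ ^ 2 := by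
        rw [← lintegral_const_mul' _ _ ENNReal.ofReal_ne_top]
        refine lintegral_congr fun ξ => ?_
        rw [hF]
        simp only
        rw [mul_pow, ENNReal.ofReal_mul (by positivity), ENNReal.ofReal_pow (norm_nonneg _),
          ofReal_norm, mul_assoc]
      rw [h2]
      refine (mul_le_mul_right h1 _).trans (le_of_eq ?_)
      rw [← mul_assoc, ← ENNReal.ofReal_mul (by positivity), ← mul_pow,
        mul_one_div_cancel hn1.ne', one_pow, ENNReal.ofReal_one, one_mul]

theorem exists_energy_le (hab : a < b) (hμ0 : 0 < μ) (hμ1 : μ ≤ 1) (hμ : μ ≠ 1 / 2) :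
    ∃ C : ℝ≥0∞, C ≠ ∞ ∧ ∀ φ, IsTest a b φ → ∀ f : Lp ℝ 2 (volume : Measure ℝ),
      f =ᵐ[volume.restrict (Ioo a b)] φ → ENNReal.ofReal (energy μ 0 φ) ≤
        C * ((∫⁻ x in Ioo a b, ‖φ x‖ₑ ^ 2) + lineSeminormSq μ f) := by
  rcases hμ1.lt_or_eq with h | rfl
  · exact exists_energy_le_of_lt_one hab hμ0 h hμ
  · refine ⟨1, ENNReal.one_ne_top, fun φ h f hf => ?_⟩
    rw [one_mul]
    exact (exists_energy_one_le φ h f hf).trans le_add_self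

end

/-! ### Equivalence of norms on test functions -/

/-- `‖φ‖²_{L²} + |φ|²`, the squared Sobolev norm of the extension by zero. -/
def normSq (μ : ℝ) (φ : ℝ → ℝ) : ℝ := (∫ x, φ x ^ 2) + energy μ 0 φ

section

variable {a b μ lam : ℝ} {φ : ℝ → ℝ}

theorem integral_sq_nonneg (φ : ℝ → ℝ) : 0 ≤ ∫ x, φ x ^ 2 := integral_nonneg fun _ => sq_nonneg _

theorem normSq_nonneg (μ : ℝ) (φ : ℝ → ℝ) : 0 ≤ normSq μ φ :=
  add_nonneg (integral_sq_nonneg φ) (energy_nonneg _ _ _)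

theorem energy_zero_le (h : IsTest a b φ) (hμ0 : 0 ≤ μ) (hμ1 : μ ≤ 1) :
    energy μ 0 φ ≤ energy μ lam φ := by
  refine integral_mono (integrable_energy h hμ0 hμ1) (integrable_energy h hμ0 hμ1) fun ξ => ?_
  refine mul_le_mul_of_nonneg_right ?_ (by positivity)
  refine Real.rpow_le_rpow (norm_nonneg _) ?_ (by positivity)
  refine (sq_le_sq₀ (norm_nonneg _) (norm_nonneg _)).1 ?_
  rw [norm_symbol_sq, norm_symbol_sq]
  nlinarith [sq_nonneg lam]

theorem energy_le (h : IsTest a b φ) (hμ0 : 0 ≤ μ) (hμ1 : μ ≤ 1) (hlam : 0 ≤ lam) :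
    energy μ lam φ ≤ 2 ^ (2 * μ) * (lam ^ (2 * μ) + 1) * normSq μ φ := by
  have hpt : ∀ ξ, ‖symbol lam ξ‖ ^ (2 * μ) ≤
      2 ^ (2 * μ) * (lam ^ (2 * μ) + ‖symbol 0 ξ‖ ^ (2 * μ)) := by
    intro ξ
    -- Using the maximum avoids convexity: the power of a maximum is bounded by the sum of the
    -- powers for every exponent 2μ > 0, including those below 1.
    have h1 : ‖symbol lam ξ‖ ≤ 2 * max lam ‖symbol 0 ξ‖ := by
      have h2 : symbol lam ξ = lam + symbol 0 ξ := by simp [symbol]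
      have h3 : ‖(lam : ℂ)‖ = lam := by rw [Complex.norm_real, Real.norm_of_nonneg hlam]
      have h4 := norm_add_le (lam : ℂ) (symbol 0 ξ)
      rw [← h2, h3] at h4
      linarith [le_max_left lam ‖symbol 0 ξ‖, le_max_right lam ‖symbol 0 ξ‖]
    refine (Real.rpow_le_rpow (norm_nonneg _) h1 (by positivity)).trans ?_
    rw [Real.mul_rpow zero_le_two (le_max_of_le_left hlam)]
    refine mul_le_mul_of_nonneg_left ?_ (by positivity)
    have h5 : 0 ≤ lam ^ (2 * μ) := by positivity
    have h6 : 0 ≤ ‖symbol 0 ξ‖ ^ (2 * μ) := by positivity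
    rcases max_cases lam ‖symbol 0 ξ‖ with h | h <;> rw [h.1] <;> linarith
  have hi1 := (integrable_norm_ft_sq h).const_mul (2 ^ (2 * μ) * lam ^ (2 * μ))
  have hi2 := (integrable_energy (lam := 0) h hμ0 hμ1).const_mul (2 ^ (2 * μ))
  have h1 : energy μ lam φ ≤
      2 ^ (2 * μ) * lam ^ (2 * μ) * (∫ x, φ x ^ 2) + 2 ^ (2 * μ) * energy μ 0 φ := by
    rw [integral_sq_eq_energy h, energy, energy, ← integral_const_mul, ← integral_const_mul,
      ← integral_add hi1 hi2]
    refine integral_mono (integrable_energy h hμ0 hμ1) (hi1.add hi2) fun ξ => ?_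
    have := mul_le_mul_of_nonneg_right (hpt ξ) (sq_nonneg ‖ft φ ξ‖)
    simp only
    linarith
  refine h1.trans ?_
  rw [normSq]
  have e1 := integral_sq_nonneg φ
  have e2 := energy_nonneg μ 0 φ
  have e3 : 0 ≤ (2 : ℝ) ^ (2 * μ) := by positivity
  have e4 : 0 ≤ lam ^ (2 * μ) := by positivity
  have := mul_nonneg e3 e1
  have := mul_nonneg (mul_nonneg e3 e4) e2
  nlinarith

theorem exists_normSq_le_energy (hab : a < b) (hμ0 : 0 < μ) (hμ1 : μ ≤ 1) :
    ∃ C : ℝ, 0 < C ∧ ∀ φ, IsTest a b φ → normSq μ φ ≤ C * energy μ 0 φ := by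
  obtain ⟨C, hC, hP⟩ := exists_poincare hab hμ0 hμ1
  refine ⟨C + 1, by positivity, fun φ h => ?_⟩
  rw [normSq, add_mul, one_mul]
  exact add_le_add (hP φ h) le_rfl

theorem integrableOn_mul_of_continuous {u v : ℝ → ℝ} (hu : Continuous u) (hv : Continuous v) :
    IntegrableOn (fun x => u x * v x) (Ioo a b) :=
  (((hu.mul hv).continuousOn (s := Icc a b)).integrableOn_Icc).mono_set Ioo_subset_Icc_self

/-! ### Lower bounds by a one-sided derivative -/

theorem abs_pairing_le (h : IsTest a b φ) (hlam : 0 ≤ lam) (hμ0 : 0 < μ) (hμ1 : μ ≤ 1) {ε : ℝ}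
    (hε : 0 < ε) : |pairing μ lam φ| ≤ ε⁻¹ * (∫ x in Ioo a b, lineDeriv μ lam φ x ^ 2) +
      ε * ∫ x in Ioo a b, lineDerivRight μ lam φ x ^ 2 := by
  have hl := continuous_lineDeriv (μ := μ) h hlam
  have hr := continuous_lineDerivRight (μ := μ) h hlam
  have hi := integrableOn_mul_of_continuous (a := a) (b := b) hl hr
  have hil := integrableOn_mul_of_continuous (a := a) (b := b) hl hl
  have hir := integrableOn_mul_of_continuous (a := a) (b := b) hr hr
  simp only [← sq] at hil hir
  rw [← setIntegral_lineDeriv_mul h hlam hμ0 hμ1, ← integral_const_mul, ← integral_const_mul,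
    ← integral_add (hil.const_mul _) (hir.const_mul _)]
  refine abs_integral_le_integral_abs.trans (integral_mono hi.abs
    ((hil.const_mul _).add (hir.const_mul _)) fun x => ?_)
  simp only
  set u := lineDeriv μ lam φ x
  set v := lineDerivRight μ lam φ x
  have h1 : 0 ≤ ε⁻¹ * (|u| - ε * |v|) ^ 2 := by positivity
  have h2 : ε⁻¹ * (|u| - ε * |v|) ^ 2 = ε⁻¹ * u ^ 2 - 2 * (|u| * |v|) + ε * v ^ 2 := by
    rw [sub_sq, mul_pow, sq_abs, sq_abs]
    field_simp
  rw [abs_mul]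
  have h3 : 0 ≤ |u| * |v| := by positivity
  linarith

/-- A form of coercivity common to both ranges of μ, taking c₀ = 1 when μ > 1/2. The L² term
disappears at λ = 0. -/
theorem exists_energy_le_abs_pairing (hμ0 : 0 < μ) (hμ1 : μ ≤ 1) (hμ : μ ≠ 1 / 2) :
    ∃ c : ℝ, 0 < c ∧ ∀ lam, 0 ≤ lam → ∀ φ, IsTest a b φ →
      c * energy μ lam φ ≤ |pairing μ lam φ| + 2 * lam ^ (2 * μ) * ∫ x, φ x ^ 2 := by
  rcases lt_or_gt_of_ne hμ with h | h
  · refine ⟨Real.cos (Real.pi * μ), Real.cos_pos_of_mem_Ioo ⟨?_, ?_⟩, fun lam hlam φ ht => ?_⟩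
    · nlinarith [Real.pi_pos]
    · nlinarith [Real.pi_pos]
    · have h1 := energy_le_pairing_of_lt_half ht hμ0 h hlam
      have h2 := le_abs_self (pairing μ lam φ)
      have h3 : 0 ≤ 2 * lam ^ (2 * μ) * ∫ x, φ x ^ 2 := by
        have := integral_sq_nonneg φ
        positivity
      linarith
  · obtain ⟨c, hc, hb⟩ := exists_energy_le_pairing (a := a) (b := b) h hμ1 one_pos
    refine ⟨c, hc, fun lam hlam φ ht => ?_⟩
    have h1 := hb lam hlam φ ht
    have h2 := neg_abs_le (pairing μ lam φ)
    linarith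

/-- At λ = 0 no L² term remains. Young's inequality with ε = c/2, together with the bound of the
right derivative by the energy, allows half of the coercive term to be absorbed. Poincaré finishes.
-/
theorem exists_normSq_le_left_zero (hab : a < b) (hμ0 : 0 < μ) (hμ1 : μ ≤ 1) (hμ : μ ≠ 1 / 2) :
    ∃ C : ℝ, 0 < C ∧ ∀ φ, IsTest a b φ →
      normSq μ φ ≤ C * ∫ x in Ioo a b, lineDeriv μ 0 φ x ^ 2 := by
  obtain ⟨c, hc, hE⟩ := exists_energy_le_abs_pairing (a := a) (b := b) hμ0 hμ1 hμ
  obtain ⟨C, hC, hP⟩ := exists_normSq_le_energy hab hμ0 hμ1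
  refine ⟨C * ((c / 2)⁻¹ * (c / 2)⁻¹), by positivity, fun φ h => ?_⟩
  have h1 := hE 0 le_rfl φ h
  rw [Real.zero_rpow (by positivity), mul_zero, zero_mul, add_zero] at h1
  have h2 := abs_pairing_le h le_rfl hμ0 hμ1 (half_pos hc)
  have h3 := setIntegral_lineDerivRight_sq_le h le_rfl hμ0 hμ1
  have h4 : c / 2 * energy μ 0 φ ≤ (c / 2)⁻¹ * ∫ x in Ioo a b, lineDeriv μ 0 φ x ^ 2 := by
    have := mul_le_mul_of_nonneg_left h3 (half_pos hc).le
    linarith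
  have h5 : energy μ 0 φ ≤ (c / 2)⁻¹ * ((c / 2)⁻¹ * ∫ x in Ioo a b, lineDeriv μ 0 φ x ^ 2) := by
    rwa [inv_mul_eq_div (c / 2) (_ * _), le_div_iff₀' (half_pos hc)]
  refine (hP φ h).trans ?_
  rw [mul_assoc, mul_assoc]
  exact mul_le_mul_of_nonneg_left h5 hC.le

theorem lineDeriv_eq_exp_mul (h : IsTest a b φ) (hμ0 : 0 < μ) (hμ1 : μ ≤ 1) {x : ℝ} (hx : a < x) :
    lineDeriv μ lam φ x =
      Real.exp (-lam * x) * lineDeriv μ 0 (fun x => Real.exp (lam * x) * φ x) x := by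
  rw [← leftClassical_eq h hμ0 hμ1 hx, ← leftClassical_eq (h.exp_mul lam) hμ0 hμ1 hx,
    leftClassical_eq_exp_mul]

/-- Apply the λ = 0 estimate to ψ = e^{λx}φ, whose untempered derivative is e^{λx} times the
tempered derivative of φ. On Ω the factors e^{-λx} and e^{λx} are at most `M` and `m⁻¹`. -/
theorem exists_integral_sq_le_left (hab : a < b) (hμ0 : 0 < μ) (hμ1 : μ ≤ 1) (hμ : μ ≠ 1 / 2)
    (hlam : 0 ≤ lam) :
    ∃ C : ℝ, 0 < C ∧ ∀ φ, IsTest a b φ →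
      ∫ x, φ x ^ 2 ≤ C * ∫ x in Ioo a b, lineDeriv μ lam φ x ^ 2 := by
  obtain ⟨C, hC, hN⟩ := exists_normSq_le_left_zero hab hμ0 hμ1 hμ
  set m := Real.exp (-lam * b) with hm
  set M := Real.exp (-lam * a) with hM
  refine ⟨M ^ 2 * (C * (m⁻¹) ^ 2), by positivity, fun φ h => ?_⟩
  set ψ : ℝ → ℝ := fun x => Real.exp (lam * x) * φ x with hψ
  have hψt : IsTest a b ψ := h.exp_mul lam
  have h1 : ∫ x, φ x ^ 2 ≤ M ^ 2 * ∫ x, ψ x ^ 2 := by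
    rw [integral_sq_eq_setIntegral h, integral_sq_eq_setIntegral hψt, ← integral_const_mul]
    have hi1 := integrableOn_mul_of_continuous (a := a) (b := b) h.continuous h.continuous
    have hi2 := integrableOn_mul_of_continuous (a := a) (b := b) hψt.continuous hψt.continuous
    simp only [← sq] at hi1 hi2
    refine setIntegral_mono_on hi1 (hi2.const_mul _) measurableSet_Ioo fun x hx => ?_
    have e : φ x = Real.exp (-lam * x) * ψ x := by
      rw [hψ]
      simp only
      rw [← mul_assoc, ← Real.exp_add]
      simp
    rw [e, mul_pow]
    refine mul_le_mul_of_nonneg_right (pow_le_pow_left₀ (Real.exp_pos _).le ?_ 2) (sq_nonneg _)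
    exact Real.exp_le_exp.2 (by nlinarith [hx.1])
  have h2 : ∫ x, ψ x ^ 2 ≤ C * ∫ x in Ioo a b, lineDeriv μ 0 ψ x ^ 2 := by
    refine le_trans ?_ (hN ψ hψt)
    rw [normSq]
    linarith [energy_nonneg μ 0 ψ]
  have h3 : ∫ x in Ioo a b, lineDeriv μ 0 ψ x ^ 2 ≤
      (m⁻¹) ^ 2 * ∫ x in Ioo a b, lineDeriv μ lam φ x ^ 2 := by
    rw [← integral_const_mul]
    have hc1 := continuous_lineDeriv (μ := μ) hψt le_rfl
    have hc2 := continuous_lineDeriv (μ := μ) h hlam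
    have hi1 := integrableOn_mul_of_continuous (a := a) (b := b) hc1 hc1
    have hi2 := integrableOn_mul_of_continuous (a := a) (b := b) hc2 hc2
    simp only [← sq] at hi1 hi2
    refine setIntegral_mono_on hi1 (hi2.const_mul _) measurableSet_Ioo fun x hx => ?_
    have e : lineDeriv μ 0 ψ x = Real.exp (lam * x) * lineDeriv μ lam φ x := by
      rw [lineDeriv_eq_exp_mul h hμ0 hμ1 hx.1, ← mul_assoc, ← Real.exp_add]
      simp [hψ]
    rw [e, mul_pow]
    refine mul_le_mul_of_nonneg_right (pow_le_pow_left₀ (Real.exp_pos _).le ?_ 2) (sq_nonneg _)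
    rw [hm, ← Real.exp_neg]
    exact Real.exp_le_exp.2 (by nlinarith [hx.2])
  calc ∫ x, φ x ^ 2 ≤ M ^ 2 * ∫ x, ψ x ^ 2 := h1
    _ ≤ M ^ 2 * (C * ((m⁻¹) ^ 2 * ∫ x in Ioo a b, lineDeriv μ lam φ x ^ 2)) := 
        mul_le_mul_of_nonneg_left (h2.trans (mul_le_mul_of_nonneg_left h3 hC.le)) (by positivity)
    _ = _ := by ring

/-- The absorption argument again, now for λ ≥ 0: the leftover L² term is controlled by
`exists_integral_sq_le_left`, which gives the second summand of `D`. -/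
theorem exists_normSq_le_left (hab : a < b) (hμ0 : 0 < μ) (hμ1 : μ ≤ 1) (hμ : μ ≠ 1 / 2)
    (hlam : 0 ≤ lam) :
    ∃ C : ℝ, 0 < C ∧ ∀ φ, IsTest a b φ →
      normSq μ φ ≤ C * ∫ x in Ioo a b, lineDeriv μ lam φ x ^ 2 := by
  obtain ⟨c, hc, hE⟩ := exists_energy_le_abs_pairing (a := a) (b := b) hμ0 hμ1 hμ
  obtain ⟨C, hC, hP⟩ := exists_normSq_le_energy hab hμ0 hμ1
  obtain ⟨C', hC', hQ⟩ := exists_integral_sq_le_left hab hμ0 hμ1 hμ hlam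
  set D := (c / 2)⁻¹ + 2 * lam ^ (2 * μ) * C' with hD
  have hD0 : 0 < D := by positivity
  refine ⟨C * ((c / 2)⁻¹ * D), by positivity, fun φ h => ?_⟩
  have h1 := hE lam hlam φ h
  have h2 := abs_pairing_le h hlam hμ0 hμ1 (half_pos hc)
  have h3 := mul_le_mul_of_nonneg_left (setIntegral_lineDerivRight_sq_le h hlam hμ0 hμ1)
    (half_pos hc).le
  have h4 := mul_le_mul_of_nonneg_left (hQ φ h) (by positivity : 0 ≤ 2 * lam ^ (2 * μ))
  have h5 : c / 2 * energy μ lam φ ≤ D * ∫ x in Ioo a b, lineDeriv μ lam φ x ^ 2 := by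
    rw [hD]
    linarith
  have h6 : energy μ lam φ ≤ (c / 2)⁻¹ * (D * ∫ x in Ioo a b, lineDeriv μ lam φ x ^ 2) := by
    rwa [inv_mul_eq_div, le_div_iff₀' (half_pos hc)]
  refine (hP φ h).trans ?_
  rw [mul_assoc, mul_assoc]
  exact mul_le_mul_of_nonneg_left ((energy_zero_le h hμ0.le hμ1).trans h6) hC.le

theorem normSq_comp_neg (μ : ℝ) (φ : ℝ → ℝ) : normSq μ (fun x => φ (-x)) = normSq μ φ := by
  rw [normSq, normSq, energy_comp_neg, integral_neg_eq_self (fun x => φ x ^ 2)]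

theorem exists_normSq_le_right (hab : a < b) (hμ0 : 0 < μ) (hμ1 : μ ≤ 1) (hμ : μ ≠ 1 / 2)
    (hlam : 0 ≤ lam) :
    ∃ C : ℝ, 0 < C ∧ ∀ φ, IsTest a b φ →
      normSq μ φ ≤ C * ∫ x in Ioo a b, lineDerivRight μ lam φ x ^ 2 := by
  obtain ⟨C, hC, hL⟩ := exists_normSq_le_left (neg_lt_neg hab) hμ0 hμ1 hμ hlam
  refine ⟨C, hC, fun φ h => ?_⟩
  have h1 := hL _ h.comp_neg
  rw [normSq_comp_neg, ← setIntegral_comp_neg] at h1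
  exact h1

/-- The quadratic form of the theorem on test functions. -/
def testForm (μ lam c₀ : ℝ) (φ : ℝ → ℝ) : ℝ :=
  if μ < 1 / 2 then pairing μ lam φ
  else -pairing μ lam φ + (1 + c₀) * lam ^ (2 * μ) * ∫ x, φ x ^ 2

theorem exists_normSq_le_testForm {c₀ : ℝ} (hab : a < b) (hμ0 : 0 < μ) (hμ1 : μ ≤ 1)
    (hμ : μ ≠ 1 / 2) (hlam : 0 ≤ lam) (hc₀ : 0 < c₀) :
    ∃ C : ℝ, 0 < C ∧ ∀ φ, IsTest a b φ → normSq μ φ ≤ C * testForm μ lam c₀ φ := by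
  obtain ⟨C, hC, hP⟩ := exists_normSq_le_energy hab hμ0 hμ1
  suffices hs : ∃ c : ℝ, 0 < c ∧ ∀ φ, IsTest a b φ → c * energy μ lam φ ≤ testForm μ lam c₀ φ by
    obtain ⟨c, hc, hE⟩ := hs
    refine ⟨C * c⁻¹, by positivity, fun φ h => (hP φ h).trans ?_⟩
    rw [mul_assoc]
    refine mul_le_mul_of_nonneg_left ((energy_zero_le (lam := lam) h hμ0.le hμ1).trans ?_) hC.le
    rw [inv_mul_eq_div, le_div_iff₀' hc]
    exact hE φ h
  rcases lt_or_gt_of_ne hμ with h | h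
  · refine ⟨Real.cos (Real.pi * μ), Real.cos_pos_of_mem_Ioo ⟨?_, ?_⟩, fun φ ht => ?_⟩
    · nlinarith [Real.pi_pos]
    · nlinarith [Real.pi_pos]
    · simp only [testForm, h, if_true]
      exact energy_le_pairing_of_lt_half ht hμ0 h hlam
  · obtain ⟨c, hc, hb⟩ := exists_energy_le_pairing (a := a) (b := b) h hμ1 hc₀
    refine ⟨c, hc, fun φ ht => ?_⟩
    simp only [testForm, not_lt.2 h.le, if_false]
    linarith [hb lam hlam φ ht]

theorem exists_testForm_le {c₀ : ℝ} (hμ0 : 0 < μ) (hμ1 : μ ≤ 1)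
    (hlam : 0 ≤ lam) (hc₀ : 0 < c₀) :
    ∃ C : ℝ, 0 < C ∧ ∀ φ, IsTest a b φ → testForm μ lam c₀ φ ≤ C * normSq μ φ := by
  set K : ℝ := 2 ^ (2 * μ) * (lam ^ (2 * μ) + 1) with hK
  have hK0 : 0 < K := by positivity
  refine ⟨2 * K + (1 + c₀) * lam ^ (2 * μ), by positivity, fun φ h => ?_⟩
  have h1 := abs_pairing_le h hlam hμ0 hμ1 one_pos
  have h2 := setIntegral_lineDeriv_sq_le h hlam hμ0 hμ1
  have h3 := setIntegral_lineDerivRight_sq_le h hlam hμ0 hμ1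
  have h4 := energy_le h hμ0.le hμ1 hlam
  rw [← hK] at h4
  have h5 : |pairing μ lam φ| ≤ 2 * K * normSq μ φ := by
    rw [inv_one, one_mul, one_mul] at h1
    linarith
  have h6 : ∫ x, φ x ^ 2 ≤ normSq μ φ := by
    rw [normSq]; linarith [energy_nonneg μ 0 φ]
  have h7 := mul_le_mul_of_nonneg_left h6 (by positivity : 0 ≤ (1 + c₀) * lam ^ (2 * μ))
  have h8 : 0 ≤ (1 + c₀) * lam ^ (2 * μ) * ∫ x, φ x ^ 2 := by
    have := integral_sq_nonneg φ
    positivity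
  unfold testForm
  split_ifs
  · linarith [le_abs_self (pairing μ lam φ)]
  · linarith [neg_abs_le (pairing μ lam φ)]

end

/-! ### The Sobolev norm satisfies a quasi-triangle inequality -/

theorem enorm_add_sq_le {E : Type*} [NormedAddCommGroup E] (x y : E) :
    ‖x + y‖ₑ ^ 2 ≤ 2 * (‖x‖ₑ ^ 2 + ‖y‖ₑ ^ 2) := by
  refine (pow_le_pow_left' (enorm_add_le x y) 2).trans ?_
  have h := ENNReal.rpow_add_le_mul_rpow_add_rpow ‖x‖ₑ ‖y‖ₑ (p := 2) one_le_two
  simp only [ENNReal.rpow_ofNat] at h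
  refine h.trans (le_of_eq ?_)
  norm_num

theorem complexify_add (f g : Lp ℝ 2 (volume : Measure ℝ)) :
    complexify (f + g) = complexify f + complexify g := by
  apply Lp.ext
  filter_upwards [coeFn_complexify (f + g), coeFn_complexify f, coeFn_complexify g,
    Lp.coeFn_add f g, Lp.coeFn_add (complexify f) (complexify g)] with x h1 h2 h3 h4 h5
  rw [h1, h5, Pi.add_apply, h2, h3, h4, Pi.add_apply, Complex.ofReal_add]

theorem complexify_neg (f : Lp ℝ 2 (volume : Measure ℝ)) : complexify (-f) = -complexify f := by
  apply Lp.ext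
  filter_upwards [coeFn_complexify (-f), coeFn_complexify f, Lp.coeFn_neg f,
    Lp.coeFn_neg (complexify f)] with x h1 h2 h3 h4
  rw [h1, h4, Pi.neg_apply, h2, h3, Pi.neg_apply, Complex.ofReal_neg]

theorem lineSeminormSq_neg (μ : ℝ) (f : Lp ℝ 2 (volume : Measure ℝ)) :
    lineSeminormSq μ (-f) = lineSeminormSq μ f := by
  rw [lineSeminormSq_eq, lineSeminormSq_eq, complexify_neg, FourierTransform.fourier_neg]
  congr 1
  refine lintegral_congr_ae ?_
  filter_upwards [Lp.coeFn_neg (𝓕 (complexify f) : Lp ℂ 2 (volume : Measure ℝ))] with ξ hξ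
  rw [hξ, Pi.neg_apply, enorm_neg]

theorem lineSeminormSq_add_le (μ : ℝ) (f g : Lp ℝ 2 (volume : Measure ℝ)) :
    lineSeminormSq μ (f + g) ≤ 2 * (lineSeminormSq μ f + lineSeminormSq μ g) := by
  have hm : Measurable (𝓕 (complexify f) : Lp ℂ 2 (volume : Measure ℝ)) :=
    (Lp.stronglyMeasurable _).measurable
  rw [lineSeminormSq_eq, lineSeminormSq_eq, lineSeminormSq_eq, complexify_add,
    FourierTransform.fourier_add, ← mul_add, mul_left_comm, ← lintegral_add_left (by fun_prop),
    ← lintegral_const_mul' _ _ ENNReal.ofNat_ne_top]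
  refine mul_le_mul_right (lintegral_mono_ae ?_) _
  filter_upwards [Lp.coeFn_add (𝓕 (complexify f) : Lp ℂ 2 (volume : Measure ℝ))
    (𝓕 (complexify g))] with ξ hξ
  rw [hξ, Pi.add_apply, ← mul_add, mul_left_comm]
  exact mul_le_mul_right (enorm_add_sq_le _ _) _

section

variable {a b μ lam : ℝ}

theorem seminormSq_neg_le (u : L2 a b) : seminormSq μ (-u) ≤ seminormSq μ u := by
  refine le_iInf₂ fun f hf => ?_
  rw [← lineSeminormSq_neg]
  refine iInf₂_le (-f) ?_
  filter_upwards [hf, Lp.coeFn_neg u, ae_restrict_of_ae (Lp.coeFn_neg f)] with x h1 h2 h3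
  rw [h3, h2, Pi.neg_apply, Pi.neg_apply, h1]

theorem seminormSq_add_le (u v : L2 a b) :
    seminormSq μ (u + v) ≤ 2 * (seminormSq μ u + seminormSq μ v) := by
  simp only [seminormSq]
  rw [ENNReal.iInf_add, ENNReal.mul_iInf_of_ne two_ne_zero ENNReal.ofNat_ne_top]
  refine le_iInf fun f => ?_
  rw [ENNReal.iInf_add, ENNReal.mul_iInf_of_ne two_ne_zero ENNReal.ofNat_ne_top]
  refine le_iInf fun hf => ?_
  rw [ENNReal.add_iInf, ENNReal.mul_iInf_of_ne two_ne_zero ENNReal.ofNat_ne_top]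
  refine le_iInf fun g => ?_
  rw [ENNReal.add_iInf, ENNReal.mul_iInf_of_ne two_ne_zero ENNReal.ofNat_ne_top]
  refine le_iInf fun hg => ?_
  refine (iInf₂_le (f + g) ?_).trans (lineSeminormSq_add_le μ f g)
  filter_upwards [hf, hg, Lp.coeFn_add u v, ae_restrict_of_ae (Lp.coeFn_add f g)]
    with x h1 h2 h3 h4
  rw [h3, h4, Pi.add_apply, Pi.add_apply, h1, h2]

theorem enormSq_neg_le (u : L2 a b) : enormSq μ (-u) ≤ enormSq μ u := by
  rw [enormSq, enormSq, enorm_neg]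
  exact add_le_add_right (seminormSq_neg_le u) _

theorem enormSq_add_le (u v : L2 a b) : enormSq μ (u + v) ≤ 2 * (enormSq μ u + enormSq μ v) := by
  refine (add_le_add (enorm_add_sq_le u v) (seminormSq_add_le u v)).trans (le_of_eq ?_)
  simp only [enormSq]
  ring

theorem enormSq_le_sub_add (u v : L2 a b) :
    enormSq μ u ≤ 2 * (enormSq μ (u - v) + enormSq μ v) := by
  have := enormSq_add_le (μ := μ) (u - v) v
  rwa [sub_add_cancel] at this

theorem enormSq_le_sub_add' (u v : L2 a b) :
    enormSq μ v ≤ 2 * (enormSq μ (u - v) + enormSq μ u) := by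
  have h1 := enormSq_add_le (μ := μ) (-(u - v)) u
  rw [neg_sub, sub_add_cancel] at h1
  refine h1.trans ?_
  gcongr
  rw [← neg_sub]
  exact enormSq_neg_le _

theorem enormSq_sub_le_sub_add (u v w : L2 a b) :
    enormSq μ (v - w) ≤ 2 * (enormSq μ (u - v) + enormSq μ (u - w)) := by
  have h1 := enormSq_add_le (μ := μ) (-(u - v)) (u - w)
  rw [neg_sub, sub_add_sub_cancel] at h1
  refine h1.trans ?_
  gcongr
  rw [← neg_sub]
  exact enormSq_neg_le _

/-! ### Test functions in the Sobolev space -/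

theorem coeFn_testToL2 (φ : 𝓓(interval a b, ℝ)) :
    testToL2 φ =ᵐ[volume.restrict (Ioo a b)] φ := MemLp.coeFn_toLp _

theorem testToL2_sub (φ ψ : 𝓓(interval a b, ℝ)) :
    testToL2 (φ - ψ) = testToL2 φ - testToL2 ψ := by
  apply Lp.ext
  filter_upwards [coeFn_testToL2 φ, coeFn_testToL2 ψ, coeFn_testToL2 (φ - ψ),
    Lp.coeFn_sub (testToL2 φ) (testToL2 ψ)] with x h1 h2 h3 h4
  rw [h3, h4, Pi.sub_apply, h1, h2]
  rfl

theorem enorm_testToL2_sq (φ : 𝓓(interval a b, ℝ)) :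
    ‖testToL2 φ‖ₑ ^ 2 = ∫⁻ x in Ioo a b, ‖φ x‖ₑ ^ 2 := by
  rw [Lp_enorm_sq]
  refine lintegral_congr_ae ?_
  filter_upwards [coeFn_testToL2 φ] with x hx
  rw [hx]

theorem ofReal_integral_sq_test (φ : 𝓓(interval a b, ℝ)) :
    ENNReal.ofReal (∫ x, φ x ^ 2) = ‖testToL2 φ‖ₑ ^ 2 := by
  rw [enorm_testToL2_sq, ← (isTest_testFunction φ).ofReal_integral_sq,
    integral_sq_eq_setIntegral (isTest_testFunction φ)]

/-- The zero extension is one competitor in the infimum. -/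
theorem enormSq_testToL2_le (hμ0 : 0 ≤ μ) (hμ1 : μ ≤ 1) (φ : 𝓓(interval a b, ℝ)) :
    enormSq μ (testToL2 φ) ≤ ENNReal.ofReal (2 * Real.pi * normSq μ φ) := by
  have h := isTest_testFunction φ
  have hpi := Real.pi_gt_three
  have h1 : seminormSq μ (testToL2 φ) ≤ ENNReal.ofReal (2 * Real.pi * energy μ 0 φ) := by
    rw [← lineSeminormSq_toLine h hμ0 hμ1]
    have h2 : h.toLine =ᵐ[volume.restrict (Ioo a b)] φ := ae_restrict_of_ae h.coeFn_toLine
    exact iInf₂_le h.toLine (h2.trans (coeFn_testToL2 φ).symm)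
  have h2 := integral_sq_nonneg φ
  rw [enormSq, normSq, mul_add, ENNReal.ofReal_add (by positivity)
    (mul_nonneg (by positivity) (energy_nonneg _ _ _)), ← ofReal_integral_sq_test]
  refine add_le_add (ENNReal.ofReal_le_ofReal ?_) h1
  nlinarith

/-- The converse of `enormSq_testToL2_le`: no extension of a test function does substantially better
than zero. This makes every estimate for the zero extension an estimate in H^μ(Ω). -/
theorem exists_normSq_le_enormSq (hab : a < b) (hμ0 : 0 < μ) (hμ1 : μ ≤ 1) (hμ : μ ≠ 1 / 2) :
    ∃ C : ℝ≥0∞, C ≠ ∞ ∧ ∀ φ : 𝓓(interval a b, ℝ),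
      ENNReal.ofReal (normSq μ φ) ≤ C * enormSq μ (testToL2 φ) := by
  obtain ⟨C, hC, hE⟩ := exists_energy_le hab hμ0 hμ1 hμ
  refine ⟨1 + C, by finiteness, fun φ => ?_⟩
  have h := isTest_testFunction φ
  have h1 : ENNReal.ofReal (energy μ 0 φ) ≤ C * enormSq μ (testToL2 φ) := by
    rw [enormSq, seminormSq]
    -- Multiplication by 0 does not commute with an infimum over an empty family, which is ∞. For C
    -- = 0 a single extension already gives zero energy.
    by_cases hC0 : C = 0
    · have := hE φ h h.toLine (ae_restrict_of_ae h.coeFn_toLine)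
      rw [hC0, zero_mul] at this
      exact this.trans zero_le
    rw [ENNReal.add_iInf, ENNReal.mul_iInf_of_ne hC0 hC]
    refine le_iInf fun f => ?_
    rw [ENNReal.add_iInf, ENNReal.mul_iInf_of_ne hC0 hC]
    refine le_iInf fun hf => ?_
    rw [enorm_testToL2_sq]
    exact hE φ h f (hf.trans (coeFn_testToL2 φ))
  rw [normSq, ENNReal.ofReal_add (integral_sq_nonneg φ) (energy_nonneg _ _ _), add_mul, one_mul]
  refine add_le_add ?_ h1
  rw [ofReal_integral_sq_test, enormSq]
  exact le_self_add

/-! ### Extension by density -/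

theorem tendsto_of_enorm_sub_sq {ι E : Type*} [NormedAddCommGroup E] {l : Filter ι}
    {f g : ι → E} (h : Tendsto (fun i => ‖f i - g i‖ₑ ^ 2) l (𝓝 0)) :
    Tendsto (fun i => ‖f i - g i‖) l (𝓝 0) := by
  have h1 := (ENNReal.tendsto_toReal ENNReal.zero_ne_top).comp h
  have h2 := h1.sqrt
  simp only [ENNReal.toReal_zero, Real.sqrt_zero] at h2
  refine h2.congr fun i => ?_
  simp [ENNReal.toReal_pow, Real.sqrt_sq]

/-- `V` is a linear operator on test functions which is bounded for the Sobolev norm. -/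
structure IsBoundedOnTests (μ : ℝ) {a b : ℝ} (V : 𝓓(interval a b, ℝ) → L2 a b) : Prop where
  map_sub : ∀ φ ψ, V (φ - ψ) = V φ - V ψ
  exists_bound : ∃ C : ℝ, ∀ φ, ‖V φ‖ ^ 2 ≤ C * normSq μ φ

namespace IsBoundedOnTests

variable {V : 𝓓(interval a b, ℝ) → L2 a b}

theorem exists_enorm_sub_le (hV : IsBoundedOnTests μ V) (hab : a < b) (hμ0 : 0 < μ) (hμ1 : μ ≤ 1)
    (hμ : μ ≠ 1 / 2) : ∃ C : ℝ≥0∞, C ≠ ∞ ∧ ∀ u φ ψ, ‖V φ - V ψ‖ₑ ^ 2 ≤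
      C * (enormSq μ (u - testToL2 φ) + enormSq μ (u - testToL2 ψ)) := by
  obtain ⟨K, hK⟩ := hV.exists_bound
  obtain ⟨C, hC, hN⟩ := exists_normSq_le_enormSq hab hμ0 hμ1 hμ
  refine ⟨ENNReal.ofReal K * (C * 2), by finiteness, fun u φ ψ => ?_⟩
  have h1 : ‖V (φ - ψ)‖ₑ ^ 2 ≤ ENNReal.ofReal K * ENNReal.ofReal (normSq μ ⇑(φ - ψ)) := by
    rw [← ofReal_norm, ← ENNReal.ofReal_pow (norm_nonneg _),
      ← ENNReal.ofReal_mul' (normSq_nonneg _ _)]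
    exact ENNReal.ofReal_le_ofReal (hK _)
  rw [← hV.map_sub]
  refine h1.trans ?_
  rw [mul_assoc, mul_assoc]
  refine mul_le_mul_right ((hN _).trans (mul_le_mul_right ?_ _)) _
  rw [testToL2_sub]
  exact enormSq_sub_le_sub_add _ _ _

/-- A bounded operator maps an approximating sequence to a Cauchy sequence in L²(Ω), and the same
bound applied to two sequences with limit u shows that the limit does not depend on the choice. -/
theorem exists_limit (hV : IsBoundedOnTests μ V) (hab : a < b) (hμ0 : 0 < μ) (hμ1 : μ ≤ 1)
    (hμ : μ ≠ 1 / 2) {u : L2 a b} (hu : u ∈ sobolev₀ μ a b) :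
    ∃ w, ∀ φ : ℕ → 𝓓(interval a b, ℝ), TestTendsto μ φ u →
      Tendsto (fun n => V (φ n)) atTop (𝓝 w) := by
  obtain ⟨C, hC, hb⟩ := hV.exists_enorm_sub_le hab hμ0 hμ1 hμ
  obtain ⟨φ, hφ⟩ := hu.2
  have hlim : ∀ {ι : Type} {l : Filter ι} {e e' : ι → ℝ≥0∞}, Tendsto e l (𝓝 0) →
      Tendsto e' l (𝓝 0) → Tendsto (fun i => C * (e i + e' i)) l (𝓝 0) := by
    intro ι l e e' he he'
    have := ENNReal.Tendsto.const_mul (he.add he') (Or.inr hC)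
    simpa using this
  have hC : CauchySeq fun n => V (φ n) := by
    rw [cauchySeq_iff_tendsto, tendsto_uniformity_iff_dist_tendsto_zero]
    simp only [Prod.map_fst, Prod.map_snd, dist_eq_norm]
    refine tendsto_of_enorm_sub_sq (tendsto_of_tendsto_of_tendsto_of_le_of_le tendsto_const_nhds
      (hlim (l := atTop) (hφ.comp ?_) (hφ.comp ?_)) (fun _ => zero_le) fun p => hb u _ _)
    · rw [← prod_atTop_atTop_eq]; exact tendsto_fst
    · rw [← prod_atTop_atTop_eq]; exact tendsto_snd
  obtain ⟨w, hw⟩ := cauchySeq_tendsto_of_complete hC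
  refine ⟨w, fun ψ hψ => ?_⟩
  have h1 : Tendsto (fun n => ‖V (ψ n) - V (φ n)‖) atTop (𝓝 0) :=
    tendsto_of_enorm_sub_sq (tendsto_of_tendsto_of_tendsto_of_le_of_le tendsto_const_nhds
      (hlim hψ hφ) (fun _ => zero_le) fun n => hb u _ _)
  have h2 := (tendsto_zero_iff_norm_tendsto_zero.2 h1).add hw
  simpa using h2

variable {T : (ℝ → ℝ) → ℝ → ℝ}

theorem eLpNorm_sub_eq (hT : ∀ φ : 𝓓(interval a b, ℝ), V φ =ᵐ[volume.restrict (Ioo a b)] T φ)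
    (φ : 𝓓(interval a b, ℝ)) (w : L2 a b) :
    eLpNorm (fun x => T φ x - w x) 2 (volume.restrict (Ioo a b)) = ‖V φ - w‖ₑ := by
  rw [Lp.enorm_def]
  refine eLpNorm_congr_ae ?_
  filter_upwards [hT φ, Lp.coeFn_sub (V φ) w] with x h1 h2
  rw [h2, Pi.sub_apply, h1]

theorem isExtensionValue_iff
    (hT : ∀ φ : 𝓓(interval a b, ℝ), V φ =ᵐ[volume.restrict (Ioo a b)] T φ) {u w : L2 a b} :
    IsExtensionValue μ T u w ↔ ∀ φ : ℕ → 𝓓(interval a b, ℝ), TestTendsto μ φ u →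
      Tendsto (fun n => V (φ n)) atTop (𝓝 w) := by
  simp only [IsExtensionValue, eLpNorm_sub_eq hT]
  refine forall_congr' fun φ => imp_congr_right fun _ => ?_
  rw [tendsto_iff_edist_tendsto_0]
  simp only [edist_eq_enorm_sub]

end IsBoundedOnTests

/-! ### Passage to the limit in inequalities between quadratic forms -/

theorem exists_sobolevNorm_sq_le_of_tendsto (hμ0 : 0 < μ) (hμ1 : μ ≤ 1) :
    ∃ K : ℝ, 0 < K ∧ ∀ (u : L2 a b) (φ : ℕ → 𝓓(interval a b, ℝ)), TestTendsto μ φ u →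
      ∀ (G : ℕ → ℝ) (g c : ℝ), Tendsto G atTop (𝓝 g) → (∀ n, normSq μ (φ n) ≤ c * G n) →
        sobolevNorm μ u ^ 2 ≤ K * (c * g) := by
  have hpi := Real.pi_pos
  -- The quasi-triangle inequality costs 2 and the change of frequency variable 2π.
  refine ⟨4 * Real.pi, by positivity, fun u φ hφ G g c hG hle => ?_⟩
  have h1 : ∀ n, enormSq μ u ≤
      2 * (enormSq μ (u - testToL2 (φ n)) + ENNReal.ofReal (2 * Real.pi * (c * G n))) := by
    intro n
    refine (enormSq_le_sub_add u (testToL2 (φ n))).trans ?_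
    gcongr
    refine (enormSq_testToL2_le hμ0.le hμ1 _).trans (ENNReal.ofReal_le_ofReal ?_)
    exact mul_le_mul_of_nonneg_left (hle n) (by positivity)
  have h2 : Tendsto (fun n => ENNReal.ofReal (2 * Real.pi * (c * G n))) atTop
      (𝓝 (ENNReal.ofReal (2 * Real.pi * (c * g)))) :=
    ENNReal.tendsto_ofReal ((hG.const_mul c).const_mul _)
  have h3 := ENNReal.Tendsto.const_mul (a := 2) (hφ.add h2) (Or.inr ENNReal.ofNat_ne_top)
  have h4 := ge_of_tendsto' h3 h1
  have hcg : 0 ≤ c * g :=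
    ge_of_tendsto' (hG.const_mul c) fun n => (normSq_nonneg _ _).trans (hle n)
  rw [zero_add, show (2 : ℝ≥0∞) = ENNReal.ofReal 2 by norm_num,
    ← ENNReal.ofReal_mul zero_le_two] at h4
  rw [sobolevNorm, Real.sq_sqrt ENNReal.toReal_nonneg]
  refine (ENNReal.toReal_le_of_le_ofReal (by positivity) h4).trans (le_of_eq ?_)
  ring

theorem exists_le_sobolevNorm_sq_of_tendsto (hab : a < b) (hμ0 : 0 < μ) (hμ1 : μ ≤ 1)
    (hμ : μ ≠ 1 / 2) :
    ∃ K : ℝ, 0 < K ∧ ∀ u : L2 a b, u ∈ sobolev₀ μ a b → ∀ φ : ℕ → 𝓓(interval a b, ℝ),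
      TestTendsto μ φ u → ∀ (G : ℕ → ℝ) (g c : ℝ), 0 ≤ c → Tendsto G atTop (𝓝 g) →
        (∀ n, G n ≤ c * normSq μ (φ n)) → g ≤ K * c * sobolevNorm μ u ^ 2 := by
  obtain ⟨C, hC, hN⟩ := exists_normSq_le_enormSq hab hμ0 hμ1 hμ
  -- The 2 comes from the quasi-triangle inequality. The added 1 only keeps the constant positive.
  refine ⟨2 * C.toReal + 1, by positivity, fun u hu φ hφ G g c hc hG hle => ?_⟩
  have hfin : enormSq μ u ≠ ∞ := by
    obtain ⟨f, hf, hlt⟩ := hu.1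
    rw [enormSq]
    exact ENNReal.add_ne_top.2 ⟨by finiteness, ne_top_of_le_ne_top hlt.ne (iInf₂_le f hf)⟩
  have h1 : ∀ n, ENNReal.ofReal (G n) ≤ ENNReal.ofReal c *
      (C * (2 * (enormSq μ (u - testToL2 (φ n)) + enormSq μ u))) := by
    intro n
    refine (ENNReal.ofReal_le_ofReal (hle n)).trans ?_
    rw [ENNReal.ofReal_mul hc]
    exact mul_le_mul_right ((hN _).trans (mul_le_mul_right (enormSq_le_sub_add' _ _) _)) _
  have h2 : Tendsto (fun n => ENNReal.ofReal c *
      (C * (2 * (enormSq μ (u - testToL2 (φ n)) + enormSq μ u)))) atTop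
      (𝓝 (ENNReal.ofReal c * (C * (2 * (0 + enormSq μ u))))) :=
    ENNReal.Tendsto.const_mul (ENNReal.Tendsto.const_mul (ENNReal.Tendsto.const_mul
      (hφ.add tendsto_const_nhds) (Or.inr ENNReal.ofNat_ne_top)) (Or.inr hC))
      (Or.inr ENNReal.ofReal_ne_top)
  have h3 := le_of_tendsto_of_tendsto' (ENNReal.tendsto_ofReal hG) h2 h1
  have h4 := ENNReal.toReal_mono (by finiteness) h3
  rw [zero_add, ENNReal.toReal_mul, ENNReal.toReal_mul, ENNReal.toReal_mul,
    ENNReal.toReal_ofReal hc, ENNReal.toReal_ofNat] at h4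
  rw [sobolevNorm, Real.sq_sqrt ENNReal.toReal_nonneg]
  have h5 : g ≤ (ENNReal.ofReal g).toReal := by
    rw [ENNReal.toReal_ofReal']
    exact le_max_left _ _
  refine (h5.trans h4).trans ?_
  have h6 : 0 ≤ c * (enormSq μ u).toReal := by positivity
  nlinarith

/-! ### The tempered derivatives as operators on test functions -/

theorem memLp_Ioo_of_continuous {f : ℝ → ℝ} (hf : Continuous f) :
    MemLp f 2 (volume.restrict (Ioo a b)) := by
  rw [memLp_two_iff_integrable_sq hf.aestronglyMeasurable]
  have h := integrableOn_mul_of_continuous (a := a) (b := b) hf hf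
  simp only [← sq] at h
  exact h

theorem inner_toLp_Ioo {f g : ℝ → ℝ} (hf : Continuous f) (hg : Continuous g) :
    inner ℝ (memLp_Ioo_of_continuous (a := a) (b := b) hf).toLp
      (memLp_Ioo_of_continuous (a := a) (b := b) hg).toLp = ∫ x in Ioo a b, f x * g x := by
  rw [L2.inner_def]
  refine integral_congr_ae ?_
  filter_upwards [(memLp_Ioo_of_continuous (a := a) (b := b) hf).coeFn_toLp,
    (memLp_Ioo_of_continuous (a := a) (b := b) hg).coeFn_toLp] with x h1 h2
  rw [h1, h2]
  simp [mul_comm]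

theorem norm_toLp_Ioo_sq {f : ℝ → ℝ} (hf : Continuous f) :
    ‖(memLp_Ioo_of_continuous (a := a) (b := b) hf).toLp‖ ^ 2 = ∫ x in Ioo a b, f x ^ 2 := by
  rw [← real_inner_self_eq_norm_sq, inner_toLp_Ioo hf hf]
  simp only [sq]

/-- The left tempered derivative on test functions, with values in `L²(Ω)`. -/
def leftTest (μ : ℝ) {lam : ℝ} (hlam : 0 ≤ lam) (φ : 𝓓(interval a b, ℝ)) : L2 a b :=
  (memLp_Ioo_of_continuous (continuous_lineDeriv (μ := μ) (isTest_testFunction φ) hlam)).toLp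

/-- The right tempered derivative on test functions, with values in `L²(Ω)`. -/
def rightTest (μ : ℝ) {lam : ℝ} (hlam : 0 ≤ lam) (φ : 𝓓(interval a b, ℝ)) : L2 a b :=
  (memLp_Ioo_of_continuous (continuous_lineDerivRight (μ := μ) (isTest_testFunction φ) hlam)).toLp

theorem norm_leftTest_sq (hlam : 0 ≤ lam) (φ : 𝓓(interval a b, ℝ)) :
    ‖leftTest μ hlam φ‖ ^ 2 = ∫ x in Ioo a b, lineDeriv μ lam φ x ^ 2 :=
  norm_toLp_Ioo_sq (continuous_lineDeriv (isTest_testFunction φ) hlam)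

theorem norm_rightTest_sq (hlam : 0 ≤ lam) (φ : 𝓓(interval a b, ℝ)) :
    ‖rightTest μ hlam φ‖ ^ 2 = ∫ x in Ioo a b, lineDerivRight μ lam φ x ^ 2 :=
  norm_toLp_Ioo_sq (continuous_lineDerivRight (isTest_testFunction φ) hlam)

theorem inner_leftTest_rightTest (hlam : 0 ≤ lam) (hμ0 : 0 < μ) (hμ1 : μ ≤ 1)
    (φ : 𝓓(interval a b, ℝ)) :
    inner ℝ (leftTest μ hlam φ) (rightTest μ hlam φ) = pairing μ lam φ := by
  rw [← setIntegral_lineDeriv_mul (isTest_testFunction φ) hlam hμ0 hμ1]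
  exact inner_toLp_Ioo (continuous_lineDeriv (isTest_testFunction φ) hlam)
    (continuous_lineDerivRight (isTest_testFunction φ) hlam)

theorem coeFn_leftTest (hlam : 0 ≤ lam) (hμ0 : 0 < μ) (hμ1 : μ ≤ 1) (φ : 𝓓(interval a b, ℝ)) :
    leftTest μ hlam φ =ᵐ[volume.restrict (Ioo a b)] leftClassical μ lam a φ := by
  refine (MemLp.coeFn_toLp _).trans ?_
  filter_upwards [ae_restrict_mem measurableSet_Ioo] with x hx
  exact (leftClassical_eq (isTest_testFunction φ) hμ0 hμ1 hx.1).symm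

theorem coeFn_rightTest (hlam : 0 ≤ lam) (hμ0 : 0 < μ) (hμ1 : μ ≤ 1) (φ : 𝓓(interval a b, ℝ)) :
    rightTest μ hlam φ =ᵐ[volume.restrict (Ioo a b)] rightClassical μ lam b φ := by
  refine (MemLp.coeFn_toLp _).trans ?_
  filter_upwards [ae_restrict_mem measurableSet_Ioo] with x hx
  exact (rightClassical_eq_line (isTest_testFunction φ) hμ0 hμ1 hx.2).symm

theorem isBoundedOnTests_left (hlam : 0 ≤ lam) (hμ0 : 0 < μ) (hμ1 : μ ≤ 1) :
    IsBoundedOnTests μ (leftTest μ hlam : 𝓓(interval a b, ℝ) → L2 a b) where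
  map_sub φ ψ := by
    apply Lp.ext
    filter_upwards [MemLp.coeFn_toLp (memLp_Ioo_of_continuous (a := a) (b := b)
        (continuous_lineDeriv (μ := μ) (isTest_testFunction φ) hlam)),
      MemLp.coeFn_toLp (memLp_Ioo_of_continuous (a := a) (b := b)
        (continuous_lineDeriv (μ := μ) (isTest_testFunction ψ) hlam)),
      MemLp.coeFn_toLp (memLp_Ioo_of_continuous (a := a) (b := b)
        (continuous_lineDeriv (μ := μ) (isTest_testFunction (φ - ψ)) hlam)),
      Lp.coeFn_sub (leftTest μ hlam φ) (leftTest μ hlam ψ)] with x h1 h2 h3 h4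
    rw [h4, Pi.sub_apply, leftTest, leftTest, leftTest, h1, h2, h3]
    exact lineDeriv_sub (isTest_testFunction φ) (isTest_testFunction ψ) hlam x
  exists_bound := ⟨_, fun φ => by
    rw [norm_leftTest_sq]
    exact (setIntegral_lineDeriv_sq_le (isTest_testFunction φ) hlam hμ0 hμ1).trans
      (energy_le (isTest_testFunction φ) hμ0.le hμ1 hlam)⟩

theorem isBoundedOnTests_right (hlam : 0 ≤ lam) (hμ0 : 0 < μ) (hμ1 : μ ≤ 1) :
    IsBoundedOnTests μ (rightTest μ hlam : 𝓓(interval a b, ℝ) → L2 a b) where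
  map_sub φ ψ := by
    apply Lp.ext
    filter_upwards [MemLp.coeFn_toLp (memLp_Ioo_of_continuous (a := a) (b := b)
        (continuous_lineDerivRight (μ := μ) (isTest_testFunction φ) hlam)),
      MemLp.coeFn_toLp (memLp_Ioo_of_continuous (a := a) (b := b)
        (continuous_lineDerivRight (μ := μ) (isTest_testFunction ψ) hlam)),
      MemLp.coeFn_toLp (memLp_Ioo_of_continuous (a := a) (b := b)
        (continuous_lineDerivRight (μ := μ) (isTest_testFunction (φ - ψ)) hlam)),
      Lp.coeFn_sub (rightTest μ hlam φ) (rightTest μ hlam ψ)] with x h1 h2 h3 h4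
    rw [h4, Pi.sub_apply, rightTest, rightTest, rightTest, h1, h2, h3]
    exact lineDeriv_sub (isTest_testFunction φ).comp_neg (isTest_testFunction ψ).comp_neg hlam (-x)
  exists_bound := ⟨_, fun φ => by
    rw [norm_rightTest_sq]
    exact (setIntegral_lineDerivRight_sq_le (isTest_testFunction φ) hlam hμ0 hμ1).trans
      (energy_le (isTest_testFunction φ) hμ0.le hμ1 hlam)⟩

/-- The chosen value has the defining property as soon as some value has it. Existence is the Cauchy
argument `exists_limit`, since the classical formula agrees on Ω with the bounded operator
`leftTest`. -/
theorem isExtensionValue_leftDeriv (hab : a < b) (hμ0 : 0 < μ) (hμ1 : μ ≤ 1) (hμ : μ ≠ 1 / 2)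
    (hlam : 0 ≤ lam) {u : L2 a b} (hu : u ∈ sobolev₀ μ a b) :
    IsExtensionValue μ (leftClassical μ lam a) u (leftDeriv μ lam u) := by
  refine Classical.epsilon_spec (p := IsExtensionValue μ (leftClassical μ lam a) u) ?_
  simp only [IsBoundedOnTests.isExtensionValue_iff (coeFn_leftTest hlam hμ0 hμ1)]
  exact (isBoundedOnTests_left hlam hμ0 hμ1).exists_limit hab hμ0 hμ1 hμ hu

theorem isExtensionValue_rightDeriv (hab : a < b) (hμ0 : 0 < μ) (hμ1 : μ ≤ 1) (hμ : μ ≠ 1 / 2)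
    (hlam : 0 ≤ lam) {u : L2 a b} (hu : u ∈ sobolev₀ μ a b) :
    IsExtensionValue μ (rightClassical μ lam b) u (rightDeriv μ lam u) := by
  refine Classical.epsilon_spec (p := IsExtensionValue μ (rightClassical μ lam b) u) ?_
  simp only [IsBoundedOnTests.isExtensionValue_iff (coeFn_rightTest hlam hμ0 hμ1)]
  exact (isBoundedOnTests_right hlam hμ0 hμ1).exists_limit hab hμ0 hμ1 hμ hu

theorem tendsto_testToL2 {u : L2 a b} {φ : ℕ → 𝓓(interval a b, ℝ)} (hφ : TestTendsto μ φ u) :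
    Tendsto (fun n => testToL2 (φ n)) atTop (𝓝 u) := by
  have h1 : Tendsto (fun n => ‖u - testToL2 (φ n)‖) atTop (𝓝 0) :=
    tendsto_of_enorm_sub_sq (tendsto_of_tendsto_of_tendsto_of_le_of_le tendsto_const_nhds
      hφ (fun _ => zero_le) fun n => le_self_add)
  have h2 := (tendsto_const_nhds (x := u)).sub (tendsto_zero_iff_norm_tendsto_zero.2 h1)
  simpa using h2

theorem inner_testToL2_self (φ : 𝓓(interval a b, ℝ)) :
    inner ℝ (testToL2 φ) (testToL2 φ) = ∫ x, φ x ^ 2 := by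
  rw [integral_sq_eq_setIntegral (isTest_testFunction φ), ← norm_toLp_Ioo_sq φ.continuous,
    real_inner_self_eq_norm_sq]
  rfl

/-- Both derivatives and the functions themselves converge in L²(Ω), so the inner products converge,
and on test functions these are the Fourier expressions. -/
theorem tendsto_testForm {c₀ : ℝ} (hab : a < b) (hμ0 : 0 < μ) (hμ1 : μ ≤ 1) (hμ : μ ≠ 1 / 2)
    (hlam : 0 ≤ lam) {u : L2 a b} (hu : u ∈ sobolev₀ μ a b) {φ : ℕ → 𝓓(interval a b, ℝ)}
    (hφ : TestTendsto μ φ u) :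
    Tendsto (fun n => testForm μ lam c₀ (φ n)) atTop (𝓝 (formB μ lam c₀ u u)) := by
  have hl := (IsBoundedOnTests.isExtensionValue_iff (coeFn_leftTest hlam hμ0 hμ1)).1
    (isExtensionValue_leftDeriv hab hμ0 hμ1 hμ hlam hu) φ hφ
  have hr := (IsBoundedOnTests.isExtensionValue_iff (coeFn_rightTest hlam hμ0 hμ1)).1
    (isExtensionValue_rightDeriv hab hμ0 hμ1 hμ hlam hu) φ hφ
  have hp := hl.inner (𝕜 := ℝ) hr
  have hi := (tendsto_testToL2 hφ).inner (𝕜 := ℝ) (tendsto_testToL2 hφ)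
  simp only [inner_leftTest_rightTest hlam hμ0 hμ1] at hp
  simp only [inner_testToL2_self] at hi
  unfold testForm formB
  split_ifs
  · exact hp
  · exact hp.neg.add (hi.const_mul _)

/-- A functional on `H₀^μ(Ω)` which is the limit of functionals on test functions equivalent to
the squared Sobolev norm is equivalent to the squared Sobolev norm. -/
theorem equivOn_sobolevNorm_sq (hab : a < b) (hμ0 : 0 < μ) (hμ1 : μ ≤ 1) (hμ : μ ≠ 1 / 2)
    {F : L2 a b → ℝ} {G : (ℝ → ℝ) → ℝ}
    (hF : ∀ u ∈ sobolev₀ μ a b, ∀ φ : ℕ → 𝓓(interval a b, ℝ), TestTendsto μ φ u →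
      Tendsto (fun n => G (φ n)) atTop (𝓝 (F u)))
    (h1 : ∃ C : ℝ, 0 < C ∧ ∀ φ, IsTest a b φ → normSq μ φ ≤ C * G φ)
    (h2 : ∃ C : ℝ, 0 < C ∧ ∀ φ, IsTest a b φ → G φ ≤ C * normSq μ φ) :
    EquivOn (sobolev₀ μ a b) F (fun u => sobolevNorm μ u ^ 2) := by
  obtain ⟨C₁, hC₁, h1⟩ := h1
  obtain ⟨C₂, hC₂, h2⟩ := h2
  obtain ⟨K₁, hK₁, hK1⟩ := exists_sobolevNorm_sq_le_of_tendsto (a := a) (b := b) hμ0 hμ1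
  obtain ⟨K₂, hK₂, hK2⟩ := exists_le_sobolevNorm_sq_of_tendsto hab hμ0 hμ1 hμ
  refine ⟨max (K₁ * C₁) (K₂ * C₂), lt_max_of_lt_left (by positivity), fun u hu => ?_⟩
  obtain ⟨φ, hφ⟩ := hu.2
  have hlim := hF u hu φ hφ
  have e1 := hK1 u φ hφ _ _ C₁ hlim fun n => h1 _ (isTest_testFunction _)
  have e2 := hK2 u hu φ hφ _ _ C₂ hC₂.le hlim fun n => h2 _ (isTest_testFunction _)
  have hs : 0 ≤ sobolevNorm μ u ^ 2 := sq_nonneg _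
  rw [← mul_assoc] at e1
  -- The sign of `F u` is not assumed. It follows from the lower bound and is needed to enlarge the
  -- constant to the common maximum.
  have hFu : 0 ≤ F u := nonneg_of_mul_nonneg_right (hs.trans e1) (by positivity)
  exact ⟨e2.trans (mul_le_mul_of_nonneg_right (le_max_right _ _) hs),
    e1.trans (mul_le_mul_of_nonneg_right (le_max_left _ _) hFu)⟩

theorem equivOn_leftDeriv (hab : a < b) (hμ0 : 0 < μ) (hμ1 : μ ≤ 1) (hμ : μ ≠ 1 / 2)
    (hlam : 0 ≤ lam) :
    EquivOn (sobolev₀ μ a b) (fun u => ‖leftDeriv μ lam u‖ ^ 2)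
      (fun u => sobolevNorm μ u ^ 2) := by
  refine equivOn_sobolevNorm_sq hab hμ0 hμ1 hμ (fun u hu φ hφ => ?_)
    (exists_normSq_le_left hab hμ0 hμ1 hμ hlam)
    ⟨_, by positivity, fun φ h => (setIntegral_lineDeriv_sq_le h hlam hμ0 hμ1).trans
      (energy_le h hμ0.le hμ1 hlam)⟩
  simp only [← norm_leftTest_sq hlam]
  exact ((IsBoundedOnTests.isExtensionValue_iff (coeFn_leftTest hlam hμ0 hμ1)).1
    (isExtensionValue_leftDeriv hab hμ0 hμ1 hμ hlam hu) φ hφ).norm.pow 2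

theorem equivOn_rightDeriv (hab : a < b) (hμ0 : 0 < μ) (hμ1 : μ ≤ 1) (hμ : μ ≠ 1 / 2)
    (hlam : 0 ≤ lam) :
    EquivOn (sobolev₀ μ a b) (fun u => ‖rightDeriv μ lam u‖ ^ 2)
      (fun u => sobolevNorm μ u ^ 2) := by
  refine equivOn_sobolevNorm_sq hab hμ0 hμ1 hμ (fun u hu φ hφ => ?_)
    (exists_normSq_le_right hab hμ0 hμ1 hμ hlam)
    ⟨_, by positivity, fun φ h => (setIntegral_lineDerivRight_sq_le h hlam hμ0 hμ1).trans
      (energy_le h hμ0.le hμ1 hlam)⟩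
  simp only [← norm_rightTest_sq hlam]
  exact ((IsBoundedOnTests.isExtensionValue_iff (coeFn_rightTest hlam hμ0 hμ1)).1
    (isExtensionValue_rightDeriv hab hμ0 hμ1 hμ hlam hu) φ hφ).norm.pow 2

end

theorem EquivOn.symm {α : Type*} {S : Set α} {F G : α → ℝ} (h : EquivOn S F G) :
    EquivOn S G F := by
  obtain ⟨C, hC, h⟩ := h
  exact ⟨C, hC, fun u hu => (h u hu).symm⟩

theorem EquivOn.trans {α : Type*} {S : Set α} {F G H : α → ℝ} (h : EquivOn S F G)
    (h' : EquivOn S G H) : EquivOn S F H := by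
  obtain ⟨C, hC, h⟩ := h
  obtain ⟨C', hC', h'⟩ := h'
  refine ⟨C * C', by positivity, fun u hu => ⟨?_, ?_⟩⟩
  · rw [mul_assoc]
    exact (h u hu).1.trans (mul_le_mul_of_nonneg_left (h' u hu).1 hC.le)
  · rw [mul_comm C, mul_assoc]
    exact (h' u hu).2.trans (mul_le_mul_of_nonneg_left (h u hu).2 hC'.le)

end TemperedFractional

end

theorem theorem2 (a b : ℝ) (hab : a < b) (μ : ℝ) (hμ0 : 0 < μ) (hμ1 : μ ≤ 1)
    (hμ : μ ≠ 1 / 2) (lam : ℝ) (hlam : 0 ≤ lam) (c₀ : ℝ) (hc₀ : 0 < c₀) :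
    (∀ u ∈ TemperedFractional.sobolev₀ μ a b,
      TemperedFractional.IsExtensionValue μ
        (TemperedFractional.leftClassical μ lam a) u (TemperedFractional.leftDeriv μ lam u) ∧
      TemperedFractional.IsExtensionValue μ
        (TemperedFractional.rightClassical μ lam b) u (TemperedFractional.rightDeriv μ lam u)) ∧
    TemperedFractional.EquivOn (TemperedFractional.sobolev₀ μ a b)
      (fun u => TemperedFractional.formB μ lam c₀ u u)
      (fun u => TemperedFractional.sobolevNorm μ u ^ 2) ∧
    TemperedFractional.EquivOn (TemperedFractional.sobolev₀ μ a b)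
      (fun u => TemperedFractional.sobolevNorm μ u ^ 2)
      (fun u => ‖TemperedFractional.leftDeriv μ lam u‖ ^ 2) ∧
    TemperedFractional.EquivOn (TemperedFractional.sobolev₀ μ a b)
      (fun u => ‖TemperedFractional.leftDeriv μ lam u‖ ^ 2)
      (fun u => ‖TemperedFractional.rightDeriv μ lam u‖ ^ 2) := by
  have hleft := TemperedFractional.equivOn_leftDeriv hab hμ0 hμ1 hμ hlam
  have hright := TemperedFractional.equivOn_rightDeriv hab hμ0 hμ1 hμ hlam
  refine ⟨fun u hu => ⟨TemperedFractional.isExtensionValue_leftDeriv hab hμ0 hμ1 hμ hlam hu,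
    TemperedFractional.isExtensionValue_rightDeriv hab hμ0 hμ1 hμ hlam hu⟩, ?_,
    hleft.symm, hleft.trans hright.symm⟩
  exact TemperedFractional.equivOn_sobolevNorm_sq hab hμ0 hμ1 hμ
    (fun u hu φ hφ => TemperedFractional.tendsto_testForm hab hμ0 hμ1 hμ hlam hu hφ)
    (TemperedFractional.exists_normSq_le_testForm hab hμ0 hμ1 hμ hlam hc₀)
    (TemperedFractional.exists_testForm_le hμ0 hμ1 hlam hc₀)
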